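/- Let $k$ be a field and let $V$ be a finite-dimensional graded $k$-vector space concentrated in positive odd degrees, with homogeneous basis $e_1,\dots,e_c$. Let $\Lambda=\bigwedge_k V$ be the exterior algebra, and let $\mathcal S=\operatorname{Sym}_k(\Sigma^{-1}V^\vee)=k[\chi_1,\dots,\chi_c]$, where $\chi_i$ is dual to $e_i$ and has lower degree $-|e_i|-1$; both are regarded as dg algebras with zero differential, and differentials lower degree by one. For a dg $\Lambda$-module $M$ let $\mathsf uM$ be the dg $(\Lambda\otimes_k\mathcal S)$-module $\Lambda\otimes_k\Gamma\otimes_k M$, where $\Gamma=\mathcal S^\vee$ is the graded $k$-dual of $\mathcal S$, with differential \[ 1\otimes1\otimes\partial^M+\sum_{i=1}^c(1\otimes\chi_i\otimes e_i-e_i\otimes\chi_i\otimes1), \] let $\mathsf dM=\operatorname{Hom}_\Lambda(\mathsf uM,k)$, a dg $\mathcal S$-module, and let \[ \mathrm V^{\mathsf d}_\Lambda(M)=\operatorname{Supp}_{\mathcal S}\mathrm H(\mathsf dM)=\{\mathfrak p\in\operatorname{Proj}\mathcal S\mid \mathrm H(\mathsf dM)_{\mathfrak p}\neq0\}, \] where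 $(-)_{\mathfrak p}$ is homogeneous localization. The tensor product $M\otimes_kN$ of dg $\Lambda$-modules is a dg $\Lambda$-module through the coproduct $\Lambda\to\Lambda\otimes_k\Lambda$ with $v\mapsto v\otimes1+1\otimes v$ for $v\in V$. For a dg $\mathcal S$-module $X$, $X\otimes^{\mathrm L}_{\mathcal S}Y$ denotes $F\otimes_{\mathcal S}Y$, where $F\to X$ is a semifree resolution, that is, a surjective quasi-isomorphism from a semifree dg $\mathcal S$-module. Let $M$ and $N$ be dg $\Lambda$-modules such that $\mathrm H_i(M)$ and $\mathrm H_i(N)$ are finite-dimensional over $k$ for all $i$ and zero for $i\ll0$. Then $\mathsf dM$ has a semifree resolution over $\mathcal S$, and for every choice of it there is an isomorphism \[ \mathsf d(M\otimes_kN)\simeq\mathsf dM\otimes^{\mathrm L}_{\mathcal S}\mathsf dN \] in the derived category of dg $\mathcal S$-modules. If moreover the total homology of $M$ and of $N$ is finite-dimensional over $k$, then \[ \mathrm V^{\mathsf d}_\Lambda(M\otimes_kN)=\mathrm V^{\mathsf d}_\Lambda(M)\cap\mathrm V^{\mathsf d}_\Lambda(N). \] -/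

import Mathlib

open scoped TensorProduct DirectSum
universe u

noncomputable section

section GradedSpaces

variable {k X Y : Type*} [Field k] [AddCommGroup X] [Module k X] [AddCommGroup Y] [Module k Y]

/-- A family of subspaces is an internal grading as soon as it spans and there is a linear map
sending each homogeneous element of degree `n` to itself placed in degree `n`. -/
theorem isInternal_of_coaction {gr : ℤ → Submodule k X} (δ : X →+ (ℤ →₀ X))
    (h1 : ∀ n, ∀ x ∈ gr n, δ x = Finsupp.single n x) (h2 : iSup gr = ⊤) :
    DirectSum.IsInternal gr := by
  refine ⟨?_, ?_⟩
  · rw [injective_iff_map_eq_zero]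
    intro z hz
    have key : ∀ (z : ⨁ n, gr n) (m : ℤ),
        δ (DirectSum.coeAddMonoidHom gr z) m = (z m : X) := by
      intro z m
      induction z using DirectSum.induction_on with
      | zero => simp
      | of i x =>
        rw [DirectSum.coeAddMonoidHom_of, h1 i x x.2, DirectSum.coe_of_apply, Finsupp.single_apply]
        split_ifs <;> simp
      | add x y hx hy => simp [hx, hy]
    ext m
    rw [← key z m, hz]; simp
  · intro x
    have hx : x ∈ iSup gr := h2 ▸ Submodule.mem_top
    induction hx using Submodule.iSup_induction' with
    | mem i x hx => exact ⟨DirectSum.of (fun n => gr n) i ⟨x, hx⟩, by simp⟩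
    | zero => exact ⟨0, by simp⟩
    | add x y _ _ hx hy =>
      obtain ⟨a, rfl⟩ := hx
      obtain ⟨b, rfl⟩ := hy
      exact ⟨a + b, by simp⟩

/-- To prove something for all elements of a graded space, it suffices to prove it for homogeneous
elements and for sums. -/
@[elab_as_elim]
theorem homogeneous_induction {gr : ℤ → Submodule k X} (h : DirectSum.IsInternal gr)
    {p : X → Prop} (hom : ∀ n, ∀ x ∈ gr n, p x) (add : ∀ x y, p x → p y → p (x + y)) (x : X) :
    p x := by
  have hx : x ∈ iSup gr := h.submodule_iSup_eq_top ▸ Submodule.mem_top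
  induction hx using Submodule.iSup_induction' with
  | mem i x hx => exact hom i x hx
  | zero => exact hom 0 0 (zero_mem _)
  | add x y _ _ hx hy => exact add x y hx hy

/-- The decomposition of an element into homogeneous components. -/
def components {gr : ℤ → Submodule k X} (h : DirectSum.IsInternal gr) :
    X →ₗ[k] (ℤ →₀ X) :=
  DirectSum.toModule k ℤ _ (fun n => Finsupp.lsingle n ∘ₗ (gr n).subtype) ∘ₗ
    (LinearEquiv.ofBijective (DirectSum.coeLinearMap gr) h).symm.toLinearMap

theorem components_of_mem {gr : ℤ → Submodule k X} (h : DirectSum.IsInternal gr) {n : ℤ} {x : X}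
    (hx : x ∈ gr n) : components h x = Finsupp.single n x := by
  have : (LinearEquiv.ofBijective (DirectSum.coeLinearMap gr) h).symm x =
      DirectSum.lof k ℤ (fun n => gr n) n ⟨x, hx⟩ := by
    rw [LinearEquiv.symm_apply_eq]
    exact (DirectSum.coeLinearMap_lof gr n ⟨x, hx⟩).symm
  rw [components, LinearMap.comp_apply, LinearEquiv.coe_coe, this, DirectSum.toModule_lof]
  rfl

/-- The sign operator `x ↦ (-1)^|x| x` of a graded space. -/
def signMap {gr : ℤ → Submodule k X} (h : DirectSum.IsInternal gr) : X →ₗ[k] X :=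
  Finsupp.lsum k (fun n : ℤ => (n.negOnePow : ℤ) • (LinearMap.id : X →ₗ[k] X)) ∘ₗ components h

theorem signMap_of_mem {gr : ℤ → Submodule k X} (h : DirectSum.IsInternal gr) {n : ℤ} {x : X}
    (hx : x ∈ gr n) : signMap h x = (n.negOnePow : ℤ) • x := by
  rw [signMap, LinearMap.comp_apply, components_of_mem h hx, Finsupp.lsum_single]
  rfl

theorem signMap_mem {gr : ℤ → Submodule k X} (h : DirectSum.IsInternal gr) {n : ℤ} {x : X}
    (hx : x ∈ gr n) : signMap h x ∈ gr n := by
  rw [signMap_of_mem h hx]; exact zsmul_mem hx _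

theorem negOnePow_zsmul_zsmul (n : ℤ) (x : X) :
    (n.negOnePow : ℤ) • (n.negOnePow : ℤ) • x = x := by
  rw [← mul_smul, ← Units.val_mul, ← Int.negOnePow_add, Int.negOnePow_even _ ⟨n, rfl⟩,
    Units.val_one, one_smul]

theorem signMap_signMap {gr : ℤ → Submodule k X} (h : DirectSum.IsInternal gr) (x : X) :
    signMap h (signMap h x) = x := by
  induction x using homogeneous_induction h with
  | hom n x hx =>
    rw [signMap_of_mem h hx, map_zsmul, signMap_of_mem h hx, negOnePow_zsmul_zsmul]
  | add x y hx hy => rw [map_add, map_add, hx, hy]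

/-- A map of odd degree anticommutes with the sign operators, a map of even degree commutes. -/
theorem signMap_shift {gr : ℤ → Submodule k X} {gr' : ℤ → Submodule k Y}
    (h : DirectSum.IsInternal gr) (h' : DirectSum.IsInternal gr') (f : X →ₗ[k] Y) (m : ℤ)
    (hf : ∀ n, ∀ x ∈ gr n, f x ∈ gr' (m + n)) (x : X) :
    signMap h' (f x) = (m.negOnePow : ℤ) • f (signMap h x) := by
  induction x using homogeneous_induction h with
  | hom n x hx =>
    rw [signMap_of_mem h hx, signMap_of_mem h' (hf n x hx), Int.negOnePow_add, map_zsmul,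
      Units.val_mul, mul_smul]
  | add x y hx hy => rw [map_add, map_add, map_add, map_add, hx, hy, smul_add]

/-- The grading of `X ⊗ Y`: its degree `n` part is spanned by the `x ⊗ y` with `|x| + |y| = n`. -/
def tensorGr (gr : ℤ → Submodule k X) (gr' : ℤ → Submodule k Y) (n : ℤ) : Submodule k (X ⊗[k] Y) :=
  Submodule.span k {z | ∃ i j, i + j = n ∧ ∃ x ∈ gr i, ∃ y ∈ gr' j, x ⊗ₜ[k] y = z}

theorem tmul_mem_tensorGr {gr : ℤ → Submodule k X} {gr' : ℤ → Submodule k Y} {i j n : ℤ} {x : X}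
    {y : Y} (hx : x ∈ gr i) (hy : y ∈ gr' j) (h : i + j = n) :
    x ⊗ₜ[k] y ∈ tensorGr gr gr' n :=
  Submodule.subset_span ⟨i, j, h, x, hx, y, hy, rfl⟩

/-- The decomposition of a tensor into homogeneous components. -/
def tensorComponents {gr : ℤ → Submodule k X} {gr' : ℤ → Submodule k Y}
    (h : DirectSum.IsInternal gr) (h' : DirectSum.IsInternal gr') :
    X ⊗[k] Y →ₗ[k] (ℤ →₀ X ⊗[k] Y) :=
  Finsupp.lmapDomain _ k (fun p : ℤ × ℤ => p.1 + p.2) ∘ₗ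
    (finsuppTensorFinsupp k k X Y ℤ ℤ).toLinearMap ∘ₗ
      TensorProduct.map (components h) (components h')

theorem tensorComponents_tmul {gr : ℤ → Submodule k X} {gr' : ℤ → Submodule k Y}
    (h : DirectSum.IsInternal gr) (h' : DirectSum.IsInternal gr') {i j : ℤ} {x : X} {y : Y}
    (hx : x ∈ gr i) (hy : y ∈ gr' j) :
    tensorComponents h h' (x ⊗ₜ y) = Finsupp.single (i + j) (x ⊗ₜ y) := by
  simp [tensorComponents, components_of_mem h hx, components_of_mem h' hy]

theorem tensorGr_isInternal {gr : ℤ → Submodule k X} {gr' : ℤ → Submodule k Y}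
    (h : DirectSum.IsInternal gr) (h' : DirectSum.IsInternal gr') :
    DirectSum.IsInternal (tensorGr gr gr') := by
  refine isInternal_of_coaction (tensorComponents h h').toAddMonoidHom (fun n z hz => ?_) ?_
  · induction hz using Submodule.span_induction with
    | mem z hz =>
      obtain ⟨i, j, rfl, x, hx, y, hy, rfl⟩ := hz
      exact tensorComponents_tmul h h' hx hy
    | zero => simp
    | add x y _ _ hx hy => rw [map_add, hx, hy, Finsupp.single_add]
    | smul a x _ hx =>
      have : tensorComponents h h' x = Finsupp.single n x := hx
      show tensorComponents h h' (a • x) = _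
      rw [map_smul, this, Finsupp.smul_single]
  · rw [eq_top_iff]
    intro z _
    induction z using TensorProduct.induction_on with
    | zero => exact zero_mem _
    | add x y hx hy => exact add_mem (hx trivial) (hy trivial)
    | tmul x y =>
      refine homogeneous_induction h (p := fun x => x ⊗ₜ[k] y ∈ _) (fun i x hx => ?_)
        (fun x x' hx hx' => ?_) x
      · refine homogeneous_induction h' (p := fun y => x ⊗ₜ[k] y ∈ _) (fun j y hy => ?_)
          (fun y y' hy hy' => ?_) y
        · exact Submodule.mem_iSup_of_mem (i + j) (tmul_mem_tensorGr hx hy rfl)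
        · rw [TensorProduct.tmul_add]; exact add_mem hy hy'
      · rw [TensorProduct.add_tmul]; exact add_mem hx hx'

/-- A tensor product of homogeneous linear maps is homogeneous. -/
theorem map_mem_tensorGr {gr : ℤ → Submodule k X} {gr' : ℤ → Submodule k Y}
    {f : X →ₗ[k] X} {g : Y →ₗ[k] Y} {a b : ℤ}
    (hf : ∀ i, ∀ x ∈ gr i, f x ∈ gr (a + i)) (hg : ∀ i, ∀ x ∈ gr' i, g x ∈ gr' (b + i))
    {n : ℤ} {z : X ⊗[k] Y} (hz : z ∈ tensorGr gr gr' n) :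
    TensorProduct.map f g z ∈ tensorGr gr gr' (a + b + n) := by
  induction hz using Submodule.span_induction with
  | mem z hz =>
    obtain ⟨i, j, rfl, x, hx, y, hy, rfl⟩ := hz
    exact tmul_mem_tensorGr (hf i x hx) (hg j y hy) (by ring)
  | zero => simp
  | add x y _ _ hx hy => rw [map_add]; exact add_mem hx hy
  | smul a x _ hx => rw [map_smul]; exact Submodule.smul_mem _ _ hx

/-- The functionals of degree `n`: those vanishing outside degree `-n`. -/
def dualGr (gr : ℤ → Submodule k X) (n : ℤ) : Submodule k (Module.Dual k X) where
  carrier := {f | ∀ i, i ≠ -n → ∀ x ∈ gr i, f x = 0}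
  zero_mem' _ _ _ _ := rfl
  add_mem' hf hg i hi x hx := by simp [hf i hi x hx, hg i hi x hx]
  smul_mem' a f hf i hi x hx := by simp [hf i hi x hx]

theorem iSupIndep_dualGr {gr : ℤ → Submodule k X} (h : DirectSum.IsInternal gr) :
    iSupIndep (dualGr gr) := by
  rw [iSupIndep_def]
  intro m
  rw [Submodule.disjoint_def]
  intro f hf hf'
  have key : ∀ x ∈ gr (-m), f x = 0 := by
    have hle : (⨆ j, ⨆ (_ : j ≠ m), dualGr gr j) ≤
        ({ carrier := {f | ∀ x ∈ gr (-m), f x = 0}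
           zero_mem' := fun _ _ => rfl
           add_mem' := fun hf hg x hx => by simp [hf x hx, hg x hx]
           smul_mem' := fun a f hf x hx => by simp [hf x hx] } : Submodule k (Module.Dual k X)) :=
      iSup₂_le fun j hj f hf x hx => hf (-m) (fun h => hj (by omega)) x hx
    exact hle hf'
  ext x
  rw [LinearMap.zero_apply]
  induction x using homogeneous_induction h with
  | hom i x hx =>
    by_cases hi : i = -m
    · subst hi; exact key x hx
    · exact hf i hi x hx
  | add x y hx hy => rw [map_add, hx, hy, add_zero]

/-- An independent family of subspaces is an internal grading of its sum. -/
theorem isInternal_comap_iSup {P : ℤ → Submodule k X} (h : iSupIndep P) :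
    DirectSum.IsInternal (fun n => (P n).comap (iSup P).subtype) := by
  rw [DirectSum.isInternal_submodule_iff_iSupIndep_and_iSup_eq_top]
  have e : ∀ n, ((P n).comap (iSup P).subtype).map (iSup P).subtype = P n := fun n => by
    rw [Submodule.map_comap_subtype, inf_eq_right]; exact le_iSup P n
  constructor
  · rw [iSupIndep_def]
    intro i
    rw [Submodule.disjoint_def]
    intro x hx hx'
    have h1 := (Submodule.disjoint_def.1 (iSupIndep_def.1 h i)) (x : X) hx ?_
    · exact Subtype.ext h1
    · have := Submodule.mem_map_of_mem (f := (iSup P).subtype) hx'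
      rw [Submodule.map_iSup] at this
      simpa [Submodule.map_iSup, e] using this
  · apply Submodule.map_injective_of_injective (iSup P).injective_subtype
    rw [Submodule.map_iSup, Submodule.map_top, Submodule.range_subtype]
    simp [e]

end GradedSpaces

/-- A dg module over a graded `k`-algebra `A = ⨁ 𝒜 n`, regarded as a dg algebra with zero
differential. Gradings are lower gradings, so the differential has degree `-1`. -/
structure DGModule {k A : Type u} [Field k] [Ring A] [Algebra k A] (𝒜 : ℤ → Submodule k A)
    [GradedAlgebra 𝒜] where
  /-- The underlying set. -/
  carrier : Type u
  [addCommGroup : AddCommGroup carrier]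
  [moduleBase : Module k carrier]
  [module : Module A carrier]
  [isScalarTower : IsScalarTower k A carrier]
  /-- The homogeneous elements of each degree. -/
  gr : ℤ → Submodule k carrier
  isInternal : DirectSum.IsInternal gr
  smul_mem : ∀ {i j : ℤ} {a : A} {x : carrier}, a ∈ 𝒜 i → x ∈ gr j → a • x ∈ gr (i + j)
  /-- The differential. -/
  diff : carrier →ₗ[k] carrier
  diff_mem : ∀ {n : ℤ} {x : carrier}, x ∈ gr n → diff x ∈ gr (n - 1)
  diff_diff : ∀ x : carrier, diff (diff x) = 0
  leibniz : ∀ {i : ℤ} {a : A} (x : carrier), a ∈ 𝒜 i →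
    diff (a • x) = (i.negOnePow : ℤ) • a • diff x

namespace DGModule

attribute [instance] addCommGroup moduleBase module isScalarTower

section General

variable {k A : Type u} [Field k] [Ring A] [Algebra k A] {𝒜 : ℤ → Submodule k A} [GradedAlgebra 𝒜]

/-- Elements of the graded algebra are sums of homogeneous ones. -/
theorem algebra_isInternal (𝒜 : ℤ → Submodule k A) [GradedAlgebra 𝒜] : DirectSum.IsInternal 𝒜 :=
  DirectSum.Decomposition.isInternal 𝒜

/-- The sign operator `x ↦ (-1)^|x| x`. -/
def sgn (M : DGModule 𝒜) : M.carrier →ₗ[k] M.carrier := signMap M.isInternal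

theorem sgn_smul (M : DGModule 𝒜) {i : ℤ} {a : A} (ha : a ∈ 𝒜 i) (x : M.carrier) :
    M.sgn (a • x) = (i.negOnePow : ℤ) • a • M.sgn x :=
  signMap_shift M.isInternal M.isInternal (Algebra.lsmul k k M.carrier a) i
    (fun _ _ hx => M.smul_mem ha hx) x

theorem sgn_diff (M : DGModule 𝒜) (x : M.carrier) : M.sgn (M.diff x) = - M.diff (M.sgn x) := by
  have := signMap_shift M.isInternal M.isInternal M.diff (-1)
    (fun n x hx => by rw [neg_add_eq_sub]; exact M.diff_mem hx) x
  simpa [sgn] using this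

theorem sgn_sgn (M : DGModule 𝒜) (x : M.carrier) : M.sgn (M.sgn x) = x :=
  signMap_signMap M.isInternal x

/-- The cycles, an `A`-submodule. -/
def cycles (M : DGModule 𝒜) : Submodule A M.carrier where
  carrier := {x | M.diff x = 0}
  zero_mem' := map_zero _
  add_mem' {x y} hx hy := by
    have hx : M.diff x = 0 := hx
    have hy : M.diff y = 0 := hy
    show M.diff (x + y) = 0
    rw [map_add, hx, hy, add_zero]
  smul_mem' a x hx := by
    have hx : M.diff x = 0 := hx
    show M.diff (a • x) = 0
    induction a using homogeneous_induction (algebra_isInternal 𝒜) with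
    | hom i a ha => rw [M.leibniz x ha, hx, smul_zero, smul_zero]
    | add a b ha hb => rw [add_smul, map_add, ha, hb, add_zero]

theorem mem_cycles {M : DGModule 𝒜} {x : M.carrier} : x ∈ M.cycles ↔ M.diff x = 0 := Iff.rfl

/-- The boundaries, an `A`-submodule. -/
def boundaries (M : DGModule 𝒜) : Submodule A M.carrier where
  carrier := {x | ∃ y, M.diff y = x}
  zero_mem' := ⟨0, map_zero _⟩
  add_mem' := by
    rintro _ _ ⟨x, rfl⟩ ⟨y, rfl⟩
    exact ⟨x + y, map_add _ _ _⟩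
  smul_mem' a x hx := by
    obtain ⟨y, rfl⟩ := hx
    induction a using homogeneous_induction (algebra_isInternal 𝒜) with
    | hom i a ha =>
      refine ⟨(i.negOnePow : ℤ) • a • y, ?_⟩
      rw [map_zsmul, M.leibniz y ha, negOnePow_zsmul_zsmul]
    | add a b ha hb =>
      obtain ⟨y, hy⟩ := ha
      obtain ⟨z, hz⟩ := hb
      exact ⟨y + z, by rw [map_add, hy, hz, add_smul]⟩

/-- The homology `H(M)`, an `A`-module. -/
abbrev Homology (M : DGModule 𝒜) : Type u :=
  M.cycles ⧸ M.boundaries.submoduleOf M.cycles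

/-- The degree `n` part `H_n(M)` of the homology, consisting of the classes of cycles of
degree `n`. -/
def homologyGr (M : DGModule 𝒜) (n : ℤ) : Submodule k M.Homology :=
  ((M.gr n).comap (M.cycles.subtype.restrictScalars k)).map
    ((M.boundaries.submoduleOf M.cycles).mkQ.restrictScalars k)

/-- `H_n(M)` is finite-dimensional for all `n`, and zero for `n ≪ 0`: the objects of
`D^f_+(A)`. -/
def IsDfPlus (M : DGModule 𝒜) : Prop :=
  (∀ n, Module.Finite k (M.homologyGr n)) ∧ ∃ b, ∀ n < b, M.homologyGr n = ⊥

/-- `H_n(M)` is finite-dimensional for all `n`, and zero for `n ≫ 0`: the objects of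
`D^f_-(A)`. -/
def IsDfMinus (M : DGModule 𝒜) : Prop :=
  (∀ n, Module.Finite k (M.homologyGr n)) ∧ ∃ b, ∀ n > b, M.homologyGr n = ⊥

/-- The homology of `M` is finite-dimensional: the objects of `D^f_b(A)`. -/
def IsDfb (M : DGModule 𝒜) : Prop := M.IsDfPlus ∧ M.IsDfMinus

/-- Morphisms of dg modules: `A`-linear maps of degree zero commuting with the differentials. -/
@[ext]
structure Hom (M N : DGModule 𝒜) where
  /-- The underlying linear map. -/
  toLin : M.carrier →ₗ[A] N.carrier
  map_mem : ∀ {n : ℤ} {x : M.carrier}, x ∈ M.gr n → toLin x ∈ N.gr n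
  map_diff : ∀ x, toLin (M.diff x) = N.diff (toLin x)

instance : CategoryTheory.Category (DGModule 𝒜) where
  Hom := Hom
  id M := ⟨LinearMap.id, fun h => h, fun _ => rfl⟩
  comp f g := ⟨g.toLin ∘ₗ f.toLin, fun h => g.map_mem (f.map_mem h), fun x => by
    rw [LinearMap.comp_apply, LinearMap.comp_apply, f.map_diff, g.map_diff]⟩

/-- The map induced on homology. -/
def Hom.mapHomology {M N : DGModule 𝒜} (f : Hom M N) : M.Homology →ₗ[A] N.Homology :=
  Submodule.mapQ _ _
    (f.toLin.restrict (p := M.cycles) (q := N.cycles) fun x hx => by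
      rw [mem_cycles] at hx ⊢
      rw [← f.map_diff, hx, map_zero])
    (by
      rintro ⟨x, hx⟩ ⟨y, hy⟩
      exact ⟨f.toLin y, by rw [← f.map_diff, hy]; rfl⟩)

/-- The class of quasi-isomorphisms. -/
def quasiIso (𝒜 : ℤ → Submodule k A) [GradedAlgebra 𝒜] :
    CategoryTheory.MorphismProperty (DGModule 𝒜) :=
  fun _ _ f => Function.Bijective (Hom.mapHomology f)

/-- The derived category `D(A)` of dg modules. -/
abbrev Derived (𝒜 : ℤ → Submodule k A) [GradedAlgebra 𝒜] : Type (u + 1) :=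
  (quasiIso 𝒜).Localization

/-- A dg module as an object of the derived category. -/
abbrev toDerived (M : DGModule 𝒜) : Derived 𝒜 := (quasiIso 𝒜).Q.obj M

/-- `F` is semifree: it has a basis `b` over `A` consisting of homogeneous elements, with a partition
of the basis elements into levels `0, 1, 2, …` such that the differential of a basis element lies in
the span of the basis elements of smaller level. (The spans `F(n)` of the basis elements of level
at most `n` are the filtration, and `F(n)/F(n-1)` is a coproduct of suspensions of `A`.) -/
def IsSemifree (F : DGModule 𝒜) : Prop :=
  ∃ (J : Type u) (b : Module.Basis J A F.carrier) (level : J → ℕ),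
    (∀ j, ∃ n, b j ∈ F.gr n) ∧
    ∀ j, F.diff (b j) ∈ Submodule.span A (b '' {i | level i < level j})

/-- A semifree resolution: a surjective quasi-isomorphism from a semifree dg module. -/
structure SemifreeResolution (M : DGModule 𝒜) where
  /-- The semifree dg module. -/
  obj : DGModule 𝒜
  /-- The augmentation. -/
  π : obj ⟶ M
  isSemifree : obj.IsSemifree
  quasiIso : DGModule.quasiIso 𝒜 π
  surjective : Function.Surjective (Hom.toLin π)

end General

end DGModule

section Algebras

/-- A finite family of positive odd degrees `w 0, …, w (c-1)`; it stands for the graded vector space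
`V` with homogeneous basis `e_0, …, e_{c-1}`, where `e_i` has degree `w i`. -/
abbrev OddDegrees (c : ℕ) : Type := Fin c → {n : ℕ // Odd n}

variable (k : Type u) [Field k] {c : ℕ} (w : OddDegrees c)

/-- The generator `e_i` of the exterior algebra on `V`. -/
def extGen (i : Fin c) : ExteriorAlgebra k (Fin c → k) := ExteriorAlgebra.ι k (Pi.single i 1)

/-- The grading of `Λ`, the exterior algebra on `V`, with `|e_i| = w i`. -/
def extGr (n : ℤ) : Submodule k (ExteriorAlgebra k (Fin c → k)) :=
  Submodule.span k
    {x | ∃ l : List (Fin c), (l.map fun i => ((w i : ℕ) : ℤ)).sum = n ∧ (l.map (extGen k)).prod = x}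

theorem list_prod_mem_extGr (l : List (Fin c)) :
    (l.map (extGen k)).prod ∈ extGr k w (l.map fun i => ((w i : ℕ) : ℤ)).sum :=
  Submodule.subset_span ⟨l, rfl, rfl⟩

theorem extGen_mem (i : Fin c) : extGen k i ∈ extGr k w (w i : ℕ) := by
  simpa using list_prod_mem_extGr k w [i]

theorem ι_eq_sum (v : Fin c → k) : ExteriorAlgebra.ι k v = ∑ i, v i • extGen k i := by
  conv_lhs => rw [pi_eq_sum_univ' v]
  rw [map_sum]
  exact Finset.sum_congr rfl fun i _ => map_smul _ _ _

theorem extGen_mul_self (i : Fin c) : extGen k i * extGen k i = 0 := ExteriorAlgebra.ι_sq_zero _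

theorem extGen_mul_swap (i j : Fin c) :
    extGen k i * extGen k j + extGen k j * extGen k i = 0 := ExteriorAlgebra.ι_add_mul_swap _ _

theorem sq_sum_eq_zero {R ι : Type*} [Ring R] (s : Finset ι) (f : ι → R)
    (h1 : ∀ i, f i * f i = 0) (h2 : ∀ i j, f i * f j + f j * f i = 0) :
    (∑ i ∈ s, f i) * (∑ i ∈ s, f i) = 0 := by
  classical
  induction s using Finset.induction_on with
  | empty => simp
  | insert a s ha ih =>
    rw [Finset.sum_insert ha, add_mul, mul_add, mul_add, h1, ih, zero_add, add_zero,
      Finset.mul_sum, Finset.sum_mul, ← Finset.sum_add_distrib]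
    exact Finset.sum_eq_zero fun i _ => h2 a i

theorem sq_add_sum_eq_zero {R ι : Type*} [Ring R] (s : Finset ι) (a : R) (f : ι → R)
    (h0 : a * a = 0) (h1 : ∀ i, f i * f i = 0) (h2 : ∀ i j, f i * f j + f j * f i = 0)
    (h3 : ∀ i, a * f i + f i * a = 0) :
    (a + ∑ i ∈ s, f i) * (a + ∑ i ∈ s, f i) = 0 := by
  rw [add_mul, mul_add, mul_add, h0, sq_sum_eq_zero s f h1 h2, zero_add, add_zero,
    Finset.mul_sum, Finset.sum_mul, ← Finset.sum_add_distrib]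
  exact Finset.sum_eq_zero fun i _ => h3 i

theorem add_sum_mul_comm {R ι : Type*} [Ring R] (s : Finset ι) (a b : R) (f : ι → R)
    (h0 : a * b = b * a) (h1 : ∀ i, f i * b = b * f i) :
    (a + ∑ i ∈ s, f i) * b = b * (a + ∑ i ∈ s, f i) := by
  rw [add_mul, mul_add, h0, Finset.mul_sum, Finset.sum_mul, Finset.sum_congr rfl fun i _ => h1 i]

theorem add_sum_mul_anticomm {R ι : Type*} [Ring R] (s : Finset ι) (a b : R) (f : ι → R)
    (h0 : a * b = -(b * a)) (h1 : ∀ i, f i * b = -(b * f i)) :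
    (a + ∑ i ∈ s, f i) * b = -(b * (a + ∑ i ∈ s, f i)) := by
  rw [add_mul, mul_add, h0, Finset.mul_sum, Finset.sum_mul, Finset.sum_congr rfl fun i _ => h1 i,
    Finset.sum_neg_distrib, neg_add]

/-- The decomposition of elements of `Λ` into homogeneous components. -/
def extComponents :
    ExteriorAlgebra k (Fin c → k) →ₐ[k] AddMonoidAlgebra (ExteriorAlgebra k (Fin c → k)) ℤ :=
  ExteriorAlgebra.lift k
    ⟨∑ i, (LinearMap.proj i).smulRight (AddMonoidAlgebra.single ((w i : ℕ) : ℤ) (extGen k i)), by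
      intro v
      simp only [LinearMap.sum_apply, LinearMap.smulRight_apply, LinearMap.proj_apply]
      apply sq_sum_eq_zero
      · intro i
        rw [smul_mul_smul_comm, AddMonoidAlgebra.single_mul_single, extGen_mul_self]
        simp
      · intro i j
        rw [smul_mul_smul_comm, smul_mul_smul_comm, AddMonoidAlgebra.single_mul_single,
          AddMonoidAlgebra.single_mul_single, mul_comm (v j), add_comm ((w j : ℕ) : ℤ), ← smul_add,
          ← AddMonoidAlgebra.single_add, extGen_mul_swap]
        simp⟩

theorem extComponents_gen (i : Fin c) :
    extComponents k w (extGen k i) = AddMonoidAlgebra.single ((w i : ℕ) : ℤ) (extGen k i) := by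
  rw [extGen, extComponents, ExteriorAlgebra.lift_ι_apply]
  simp only [LinearMap.sum_apply, LinearMap.smulRight_apply, LinearMap.proj_apply]
  rw [Finset.sum_eq_single i]
  · rw [Pi.single_eq_same, one_smul]; rfl
  · intro j _ hj
    rw [Pi.single_eq_of_ne hj, zero_smul]
  · exact fun h => absurd (Finset.mem_univ i) h

theorem extComponents_list (l : List (Fin c)) :
    extComponents k w (l.map (extGen k)).prod =
      AddMonoidAlgebra.single (l.map fun i => ((w i : ℕ) : ℤ)).sum (l.map (extGen k)).prod := by
  induction l with
  | nil => rw [List.map_nil, List.map_nil, List.prod_nil, map_one]; rfl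
  | cons i l ih =>
    rw [List.map_cons, List.prod_cons, map_mul, ih, extComponents_gen,
      AddMonoidAlgebra.single_mul_single, List.map_cons, List.sum_cons]

instance extGr_gradedMonoid : SetLike.GradedMonoid (extGr k w) where
  one_mem := Submodule.subset_span ⟨[], by simp, by simp⟩
  mul_mem i j x y hx hy := by
    have := Submodule.mul_mem_mul hx hy
    rw [extGr, extGr, Submodule.span_mul_span] at this
    refine Submodule.span_mono ?_ this
    rintro _ ⟨_, ⟨l, rfl, rfl⟩, _, ⟨l', rfl, rfl⟩, rfl⟩
    exact ⟨l ++ l', by simp, by simp⟩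

theorem extGr_iSup : iSup (extGr k w) = ⊤ := by
  refine Submodule.eq_top_iff'.2 fun x => ?_
  induction x using ExteriorAlgebra.induction with
  | algebraMap r =>
    rw [Algebra.algebraMap_eq_smul_one]
    exact Submodule.smul_mem _ _
      (Submodule.mem_iSup_of_mem 0 (SetLike.GradedOne.one_mem (A := extGr k w)))
  | ι v =>
    rw [ι_eq_sum]
    exact sum_mem fun i _ => Submodule.smul_mem _ _ (Submodule.mem_iSup_of_mem _ (extGen_mem k w i))
  | add a b ha hb => exact add_mem ha hb
  | mul a b ha hb =>
    induction ha using Submodule.iSup_induction' with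
    | mem i a ha =>
      induction hb using Submodule.iSup_induction' with
      | mem j b hb => exact Submodule.mem_iSup_of_mem (i + j) (SetLike.GradedMul.mul_mem ha hb)
      | zero => simp
      | add x y _ _ hx hy => rw [mul_add]; exact add_mem hx hy
    | zero => simp
    | add x y _ _ hx hy => rw [add_mul]; exact add_mem hx hy

theorem extGr_isInternal : DirectSum.IsInternal (extGr k w) := by
  refine isInternal_of_coaction
    (AddMonoidAlgebra.coeffAddEquiv.toAddMonoidHom.comp
      (extComponents k w).toRingHom.toAddMonoidHom) (fun n x hx => ?_) (extGr_iSup k w)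
  show (extComponents k w x).coeff = _
  induction hx using Submodule.span_induction with
  | mem x hx =>
    obtain ⟨l, rfl, rfl⟩ := hx
    rw [extComponents_list]; rfl
  | zero => simp
  | add x y _ _ hx hy => rw [map_add, AddMonoidAlgebra.coeff_add, hx, hy, Finsupp.single_add]
  | smul a x _ hx => rw [map_smul, AddMonoidAlgebra.coeff_smul, hx, Finsupp.smul_single]

instance extGr_gradedAlgebra : GradedAlgebra (extGr k w) where
  toGradedMonoid := extGr_gradedMonoid k w
  toDecomposition := (extGr_isInternal k w).chooseDecomposition

/-- The lower grading of `S = k[χ_0, …, χ_{c-1}]`, with `|χ_i| = -(|e_i| + 1)`; this is the symmetric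
algebra on `W = Σ⁻¹(V^∨)`, with `χ_i` dual to `e_i`. -/
def symGr (n : ℤ) : Submodule k (MvPolynomial (Fin c) k) :=
  MvPolynomial.weightedHomogeneousSubmodule k (fun i => -(((w i : ℕ) : ℤ) + 1)) n

instance symGr_gradedAlgebra : GradedAlgebra (symGr k w) :=
  MvPolynomial.weightedGradedAlgebra k (fun i => -(((w i : ℕ) : ℤ) + 1))

/-- The upper grading of `S = k[χ_0, …, χ_{c-1}]`: `S^n = S_{-n}`, so `χ_i` has upper degree
`|e_i| + 1 > 0`. -/
def symUpperGr (n : ℕ) : Submodule k (MvPolynomial (Fin c) k) :=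
  MvPolynomial.weightedHomogeneousSubmodule k (fun i => (w i : ℕ) + 1) n

instance symUpperGr_gradedAlgebra : GradedAlgebra (symUpperGr k w) :=
  MvPolynomial.weightedGradedAlgebra k (fun i => (w i : ℕ) + 1)

theorem X_mem_symGr (i : Fin c) :
    (MvPolynomial.X i : MvPolynomial (Fin c) k) ∈ symGr k w (-(((w i : ℕ) : ℤ) + 1)) :=
  MvPolynomial.isWeightedHomogeneous_X k (fun i => -(((w i : ℕ) : ℤ) + 1)) i

/-- `S` is concentrated in even degrees. -/
theorem smul_symGr {X : Type*} [AddCommGroup X] [Module (MvPolynomial (Fin c) k) X] {n : ℤ}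
    {s : MvPolynomial (Fin c) k} (hs : s ∈ symGr k w n) (x : X) :
    (n.negOnePow : ℤ) • s • x = s • x := by
  by_cases h : s = 0
  · simp [h]
  · have hs : MvPolynomial.IsWeightedHomogeneous (fun i => -(((w i : ℕ) : ℤ) + 1)) s n := hs
    obtain ⟨d, hd⟩ := MvPolynomial.ne_zero_iff.1 h
    have hn := hs hd
    have : Even n := by
      rw [← hn, Finsupp.weight_apply, Finsupp.sum]
      refine Finset.even_sum _ fun i _ => ?_
      have : Even (-(((w i : ℕ) : ℤ) + 1)) :=
        even_neg.2 ((Int.odd_coe_nat _).2 (w i).2).add_one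
      rw [nsmul_eq_mul]
      exact this.mul_left _
    rw [Int.negOnePow_even _ this, Units.val_one, one_smul]

variable {k w}

/-- The module structure given by an algebra map to operators is compatible with scalars. -/
theorem isScalarTower_of_algHom {A X : Type*} [Ring A] [Algebra k A] [AddCommGroup X] [Module k X]
    (φ : A →ₐ[k] Module.End k X) :
    letI : Module A X := Module.compHom X φ.toRingHom
    IsScalarTower k A X :=
  letI : Module A X := Module.compHom X φ.toRingHom
  ⟨fun t a x => by
    show φ (t • a) x = t • φ a x
    rw [map_smul, LinearMap.smul_apply]⟩

/-- To show that an operator shifts degrees appropriately for all of `Λ`, check generators. -/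
theorem ext_act_mem {X : Type*} [AddCommGroup X] [Module k X] {gr : ℤ → Submodule k X}
    (φ : ExteriorAlgebra k (Fin c → k) →ₐ[k] Module.End k X)
    (h : ∀ i n, ∀ x ∈ gr n, φ (extGen k i) x ∈ gr ((w i : ℕ) + n)) {i j : ℤ}
    {a : ExteriorAlgebra k (Fin c → k)} {x : X} (ha : a ∈ extGr k w i) (hx : x ∈ gr j) :
    φ a x ∈ gr (i + j) := by
  induction ha using Submodule.span_induction with
  | mem a ha =>
    obtain ⟨l, rfl, rfl⟩ := ha
    induction l with
    | nil => simpa using hx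
    | cons m l ih =>
      rw [List.map_cons, List.map_cons, List.prod_cons, map_mul, List.sum_cons, add_assoc]
      exact h _ _ _ ih
  | zero => simp
  | add a b _ _ ha hb => rw [map_add]; exact add_mem ha hb
  | smul t a _ ha => rw [map_smul]; exact Submodule.smul_mem _ _ ha

/-- To show the Leibniz rule for all of `Λ`, check generators. -/
theorem ext_act_leibniz {X : Type*} [AddCommGroup X] [Module k X]
    (φ : ExteriorAlgebra k (Fin c → k) →ₐ[k] Module.End k X) (D : X →ₗ[k] X)
    (h : ∀ i x, D (φ (extGen k i) x) = - φ (extGen k i) (D x)) {i : ℤ}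
    {a : ExteriorAlgebra k (Fin c → k)} (x : X) (ha : a ∈ extGr k w i) :
    D (φ a x) = (i.negOnePow : ℤ) • φ a (D x) := by
  induction ha using Submodule.span_induction with
  | mem a ha =>
    obtain ⟨l, rfl, rfl⟩ := ha
    induction l with
    | nil => simp
    | cons m l ih =>
      rw [List.map_cons, List.map_cons, List.prod_cons, map_mul, List.sum_cons, Module.End.mul_apply,
        h, ih, Int.negOnePow_add, Int.negOnePow_odd _ ((Int.odd_coe_nat _).2 (w m).2)]
      simp
  | zero => simp
  | add a b _ _ ha hb =>
    rw [map_add, LinearMap.add_apply, map_add, ha, hb, LinearMap.add_apply, smul_add]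
  | smul t a _ ha =>
    rw [map_smul, LinearMap.smul_apply, map_smul, ha, LinearMap.smul_apply, smul_comm]

end Algebras

namespace DGModule

variable {k : Type u} [Field k] {c : ℕ} {w : OddDegrees c}

section Exterior

variable (M N : DGModule (extGr k w))

/-- The action of `Λ` as linear operators. -/
def act (a : ExteriorAlgebra k (Fin c → k)) : M.carrier →ₗ[k] M.carrier :=
  Algebra.lsmul k k M.carrier a

@[simp] theorem act_apply (a : ExteriorAlgebra k (Fin c → k)) (x : M.carrier) :
    M.act a x = a • x := rfl

theorem gen_smul_self (i : Fin c) (x : M.carrier) : extGen k i • extGen k i • x = 0 := by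
  rw [← mul_smul, extGen_mul_self, zero_smul]

theorem gen_smul_swap (i j : Fin c) (x : M.carrier) :
    extGen k j • extGen k i • x = - (extGen k i • extGen k j • x) := by
  rw [← mul_smul, ← mul_smul, ← sub_eq_zero, sub_neg_eq_add, ← add_smul, extGen_mul_swap, zero_smul]

theorem negOnePow_w (i : Fin c) : ((((w i : ℕ) : ℤ).negOnePow : ℤˣ) : ℤ) = -1 := by
  rw [Int.negOnePow_odd _ ((Int.odd_coe_nat _).2 (w i).2)]; rfl

theorem sgn_gen (i : Fin c) (x : M.carrier) : M.sgn (extGen k i • x) = -(extGen k i • M.sgn x) := by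
  rw [M.sgn_smul (extGen_mem k w i), negOnePow_w, neg_one_smul]

theorem diff_gen (i : Fin c) (x : M.carrier) :
    M.diff (extGen k i • x) = -(extGen k i • M.diff x) := by
  rw [M.leibniz x (extGen_mem k w i), negOnePow_w, neg_one_smul]

theorem sgn_ι (v : Fin c → k) (x : M.carrier) :
    M.sgn (ExteriorAlgebra.ι k v • x) = -(ExteriorAlgebra.ι k v • M.sgn x) := by
  simp only [ι_eq_sum, Finset.sum_smul, map_sum, smul_assoc, map_smul, sgn_gen, smul_neg,
    Finset.sum_neg_distrib]

theorem sgn_mem {n : ℤ} {x : M.carrier} (hx : x ∈ M.gr n) : M.sgn x ∈ M.gr n :=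
  signMap_mem M.isInternal hx

/-- The action of `v ∈ V` on `M ⊗ N` through the coproduct `v ↦ v ⊗ 1 + 1 ⊗ v`:
`m ⊗ n ↦ v m ⊗ n + (-1)^|m| m ⊗ v n`. -/
def hopfVec :
    (Fin c → k) →ₗ[k] Module.End k (M.carrier ⊗[k] N.carrier) :=
  (TensorProduct.mapBilinear (RingHom.id k) M.carrier N.carrier M.carrier N.carrier).flip
      LinearMap.id ∘ₗ (Algebra.lsmul k k M.carrier).toLinearMap ∘ₗ ExteriorAlgebra.ι k +
    TensorProduct.mapBilinear (RingHom.id k) M.carrier N.carrier M.carrier N.carrier M.sgn ∘ₗ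
      (Algebra.lsmul k k N.carrier).toLinearMap ∘ₗ ExteriorAlgebra.ι k

theorem hopfVec_tmul (v : Fin c → k) (m : M.carrier) (n : N.carrier) :
    hopfVec M N v (m ⊗ₜ n) =
      (ExteriorAlgebra.ι k v • m) ⊗ₜ n + M.sgn m ⊗ₜ (ExteriorAlgebra.ι k v • n) := rfl

/-- The action of `Λ` on `M ⊗ N` through the coproduct. -/
def hopfAct :
    ExteriorAlgebra k (Fin c → k) →ₐ[k] Module.End k (M.carrier ⊗[k] N.carrier) :=
  ExteriorAlgebra.lift k ⟨hopfVec M N, fun v => by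
    ext m n
    have h : ∀ (L : DGModule (extGr k w)) (x : L.carrier),
        ExteriorAlgebra.ι k v • ExteriorAlgebra.ι k v • x = 0 := fun L x => by
      rw [← mul_smul, ExteriorAlgebra.ι_sq_zero, zero_smul]
    show hopfVec M N v (hopfVec M N v (m ⊗ₜ n)) = 0
    rw [hopfVec_tmul, map_add, hopfVec_tmul, hopfVec_tmul, h, h, sgn_ι, TensorProduct.neg_tmul]
    simp⟩

theorem hopfAct_gen (i : Fin c) :
    hopfAct M N (extGen k i) =
      TensorProduct.map (M.act (extGen k i)) LinearMap.id +
        TensorProduct.map M.sgn (N.act (extGen k i)) := by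
  rw [hopfAct, extGen, ExteriorAlgebra.lift_ι_apply]
  rfl

theorem hopfAct_gen_tmul (i : Fin c) (m : M.carrier) (n : N.carrier) :
    hopfAct M N (extGen k i) (m ⊗ₜ n) =
      (extGen k i • m) ⊗ₜ n + M.sgn m ⊗ₜ (extGen k i • n) := by
  rw [hopfAct_gen]; rfl

/-- The differential of a tensor product, `m ⊗ n ↦ ∂m ⊗ n + (-1)^|m| m ⊗ ∂n`. -/
def tensorDiff : M.carrier ⊗[k] N.carrier →ₗ[k] M.carrier ⊗[k] N.carrier :=
  TensorProduct.map M.diff LinearMap.id + TensorProduct.map M.sgn N.diff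

theorem tensorDiff_tmul (m : M.carrier) (n : N.carrier) :
    tensorDiff M N (m ⊗ₜ n) = M.diff m ⊗ₜ n + M.sgn m ⊗ₜ N.diff n := rfl

/-- The tensor product `M ⊗_k N` of dg `Λ`-modules, a dg `Λ`-module through the coproduct of `Λ`. -/
def hopfTensor : DGModule (extGr k w) where
  carrier := M.carrier ⊗[k] N.carrier
  addCommGroup := inferInstance
  moduleBase := inferInstance
  module := Module.compHom _ (hopfAct M N).toRingHom
  isScalarTower := isScalarTower_of_algHom (hopfAct M N)
  gr := tensorGr M.gr N.gr
  isInternal := tensorGr_isInternal M.isInternal N.isInternal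
  smul_mem ha hx := by
    refine ext_act_mem (w := w) (hopfAct M N) (fun i n x hx => ?_) ha hx
    rw [hopfAct_gen, LinearMap.add_apply]
    refine add_mem ?_ ?_
    · simpa using map_mem_tensorGr (b := 0)
        (fun j y hy => M.smul_mem (extGen_mem k w i) hy) (fun j y hy => by simpa using hy) hx
    · simpa using map_mem_tensorGr (a := 0) (f := M.sgn)
        (fun j y hy => by simpa using M.sgn_mem hy)
        (fun j y hy => N.smul_mem (extGen_mem k w i) hy) hx
  diff := tensorDiff M N
  diff_mem {n x} hx := by
    rw [tensorDiff, LinearMap.add_apply]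
    have e : ∀ (L : DGModule (extGr k w)) (i : ℤ) (y : L.carrier), y ∈ L.gr i →
      L.diff y ∈ L.gr (-1 + i) := fun L i y hy => by rw [neg_add_eq_sub]; exact L.diff_mem hy
    have en : n - 1 = -1 + 0 + n := by ring
    have en' : n - 1 = 0 + -1 + n := by ring
    refine add_mem ?_ ?_
    · rw [en]
      exact map_mem_tensorGr (e M) (fun j y hy => by simpa using hy) hx
    · rw [en']
      exact map_mem_tensorGr (fun j y hy => by simpa using M.sgn_mem hy) (e N) hx
  diff_diff x := by
    induction x using TensorProduct.induction_on with
    | zero => simp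
    | add x y hx hy => rw [map_add, map_add, hx, hy, add_zero]
    | tmul m n =>
      rw [tensorDiff_tmul, map_add, tensorDiff_tmul, tensorDiff_tmul, M.diff_diff, N.diff_diff,
        sgn_diff, TensorProduct.neg_tmul]
      simp
  leibniz {i a} x ha := by
    refine ext_act_leibniz (w := w) (hopfAct M N) (tensorDiff M N) (fun j y => ?_) x ha
    induction y using TensorProduct.induction_on with
    | zero => simp
    | add x y hx hy => rw [map_add, map_add, hx, hy, map_add, map_add, neg_add]
    | tmul m n =>
      rw [hopfAct_gen_tmul, map_add, tensorDiff_tmul, tensorDiff_tmul, tensorDiff_tmul, map_add,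
        hopfAct_gen_tmul, hopfAct_gen_tmul, diff_gen, diff_gen, sgn_gen, sgn_diff]
      simp only [TensorProduct.neg_tmul, TensorProduct.tmul_neg]
      abel

end Exterior

end DGModule

section Gamma

variable (k : Type u) [Field k] {c : ℕ} (w : OddDegrees c)

/-- The graded dual of `S`, as a space of functionals: the sums of homogeneous functionals. -/
def gammaSubmodule : Submodule k (Module.Dual k (MvPolynomial (Fin c) k)) :=
  ⨆ n, dualGr (symGr k w) n

/-- `Γ = S^∨`, the graded dual of `S`. -/
def Gamma : Type u := gammaSubmodule k w

instance : AddCommGroup (Gamma k w) := inferInstanceAs (AddCommGroup (gammaSubmodule k w))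

instance : Module k (Gamma k w) := inferInstanceAs (Module k (gammaSubmodule k w))

/-- The grading of `Γ`. -/
def gammaGr (n : ℤ) : Submodule k (Gamma k w) :=
  (dualGr (symGr k w) n).comap (gammaSubmodule k w).subtype

theorem gammaGr_isInternal : DirectSum.IsInternal (gammaGr k w) :=
  isInternal_comap_iSup (iSupIndep_dualGr (DGModule.algebra_isInternal (symGr k w)))

theorem gamma_mul_mem {i n : ℤ} {s : MvPolynomial (Fin c) k} (hs : s ∈ symGr k w i)
    {f : Module.Dual k (MvPolynomial (Fin c) k)} (hf : f ∈ dualGr (symGr k w) n) :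
    f ∘ₗ LinearMap.mulLeft k s ∈ dualGr (symGr k w) (i + n) :=
  fun j hj x hx => hf (i + j) (fun h => hj (by omega)) _ (SetLike.GradedMul.mul_mem hs hx)

theorem gamma_mul_mem_gammaSubmodule (s : MvPolynomial (Fin c) k)
    {f : Module.Dual k (MvPolynomial (Fin c) k)} (hf : f ∈ gammaSubmodule k w) :
    f ∘ₗ LinearMap.mulLeft k s ∈ gammaSubmodule k w := by
  induction s using homogeneous_induction (DGModule.algebra_isInternal (symGr k w)) with
  | hom i s hs =>
    induction hf using Submodule.iSup_induction' with
    | mem n f hf => exact Submodule.mem_iSup_of_mem _ (gamma_mul_mem k w hs hf)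
    | zero => rw [LinearMap.zero_comp]; exact zero_mem _
    | add f g _ _ hf hg => rw [LinearMap.add_comp]; exact add_mem hf hg
  | add s t hs ht =>
    have : f ∘ₗ LinearMap.mulLeft k (s + t) =
        f ∘ₗ LinearMap.mulLeft k s + f ∘ₗ LinearMap.mulLeft k t := by
      ext x; simp [add_mul]
    rw [this]; exact add_mem hs ht

/-- The action of `S` on `Γ`: `(s α)(t) = α(s t)`. -/
def gammaAct (s : MvPolynomial (Fin c) k) : Gamma k w →ₗ[k] Gamma k w where
  toFun f := ⟨f.1 ∘ₗ LinearMap.mulLeft k s, gamma_mul_mem_gammaSubmodule k w s f.2⟩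
  map_add' _ _ := rfl
  map_smul' _ _ := rfl

theorem gammaAct_mul (s t : MvPolynomial (Fin c) k) (f : Gamma k w) :
    gammaAct k w (s * t) f = gammaAct k w s (gammaAct k w t f) := by
  apply Subtype.ext
  apply LinearMap.ext
  intro x
  show f.1 (s * t * x) = f.1 (t * (s * x))
  rw [mul_comm s t, mul_assoc]

theorem gammaAct_comm (s t : MvPolynomial (Fin c) k) (f : Gamma k w) :
    gammaAct k w s (gammaAct k w t f) = gammaAct k w t (gammaAct k w s f) := by
  rw [← gammaAct_mul, mul_comm, gammaAct_mul]

theorem gammaAct_one : gammaAct k w 1 = LinearMap.id := by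
  apply LinearMap.ext
  intro f
  apply Subtype.ext
  apply LinearMap.ext
  intro x
  show f.1 (1 * x) = f.1 x
  rw [one_mul]

theorem gammaAct_add (s t : MvPolynomial (Fin c) k) :
    gammaAct k w (s + t) = gammaAct k w s + gammaAct k w t := by
  apply LinearMap.ext
  intro f
  apply Subtype.ext
  apply LinearMap.ext
  intro x
  show f.1 ((s + t) * x) = f.1 (s * x) + f.1 (t * x)
  rw [add_mul, map_add]

theorem gammaAct_smul (a : k) (s : MvPolynomial (Fin c) k) :
    gammaAct k w (a • s) = a • gammaAct k w s := by
  apply LinearMap.ext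
  intro f
  apply Subtype.ext
  apply LinearMap.ext
  intro x
  show f.1 ((a • s) * x) = a • f.1 (s * x)
  rw [smul_mul_assoc, map_smul]

theorem gammaAct_mem {i n : ℤ} {s : MvPolynomial (Fin c) k} (hs : s ∈ symGr k w i)
    {f : Gamma k w} (hf : f ∈ gammaGr k w n) : gammaAct k w s f ∈ gammaGr k w (i + n) :=
  gamma_mul_mem k w hs hf

end Gamma

namespace DGModule

variable {k : Type u} [Field k] {c : ℕ} {w : OddDegrees c}

section Universal

variable (M : DGModule (extGr k w))

/-- The sign operator of `Λ`. -/
def extSgn (k : Type u) [Field k] {c : ℕ} (w : OddDegrees c) :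
    ExteriorAlgebra k (Fin c → k) →ₗ[k] ExteriorAlgebra k (Fin c → k) :=
  signMap (extGr_isInternal k w)

theorem extSgn_gen_mul (i : Fin c) (a : ExteriorAlgebra k (Fin c → k)) :
    extSgn k w (extGen k i * a) = -(extGen k i * extSgn k w a) := by
  have := signMap_shift (extGr_isInternal k w) (extGr_isInternal k w)
    (LinearMap.mulLeft k (extGen k i)) ((w i : ℕ) : ℤ)
    (fun n x hx => SetLike.GradedMul.mul_mem (extGen_mem k w i) hx) a
  rw [negOnePow_w, neg_one_smul] at this
  exact this

theorem extSgn_extSgn (a : ExteriorAlgebra k (Fin c → k)) : extSgn k w (extSgn k w a) = a :=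
  signMap_signMap _ a

/-- The underlying space `Λ ⊗ Γ ⊗ M` of the universal resolution. -/
abbrev UCarrier : Type u := ExteriorAlgebra k (Fin c → k) ⊗[k] (Gamma k w ⊗[k] M.carrier)

/-- The grading of `Λ ⊗ Γ ⊗ M`. -/
def uGr : ℤ → Submodule k M.UCarrier := tensorGr (extGr k w) (tensorGr (gammaGr k w) M.gr)

/-- The operator `1 ⊗ χ_i ⊗ e_i - e_i ⊗ χ_i ⊗ 1` on `Λ ⊗ Γ ⊗ M`, with the usual sign
`(1 ⊗ χ_i ⊗ e_i)(a ⊗ γ ⊗ m) = (-1)^|a| a ⊗ χ_i γ ⊗ e_i m`. (`Γ` lives in even degrees.) -/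
def uTwist (i : Fin c) : M.UCarrier →ₗ[k] M.UCarrier :=
  TensorProduct.map (extSgn k w)
      (TensorProduct.map (gammaAct k w (MvPolynomial.X i)) (M.act (extGen k i))) -
    TensorProduct.map (LinearMap.mulLeft k (extGen k i))
      (TensorProduct.map (gammaAct k w (MvPolynomial.X i)) LinearMap.id)

/-- The operator `1 ⊗ 1 ⊗ ∂` on `Λ ⊗ Γ ⊗ M`, with the usual sign
`(1 ⊗ 1 ⊗ ∂)(a ⊗ γ ⊗ m) = (-1)^|a| a ⊗ γ ⊗ ∂m`. -/
def uInner : M.UCarrier →ₗ[k] M.UCarrier :=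
  TensorProduct.map (extSgn k w) (TensorProduct.map LinearMap.id M.diff)

/-- The differential `1 ⊗ 1 ⊗ ∂ + ∑ i, (1 ⊗ χ_i ⊗ e_i - e_i ⊗ χ_i ⊗ 1)` of the universal
resolution. -/
def uDiff : M.UCarrier →ₗ[k] M.UCarrier := M.uInner + ∑ i, M.uTwist i

/-- The action of `S` on `Λ ⊗ Γ ⊗ M`, through the middle factor. -/
def uSym (s : MvPolynomial (Fin c) k) : M.UCarrier →ₗ[k] M.UCarrier :=
  TensorProduct.map LinearMap.id (TensorProduct.map (gammaAct k w s) LinearMap.id)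

theorem uTwist_tmul (i : Fin c) (a : ExteriorAlgebra k (Fin c → k)) (g : Gamma k w)
    (m : M.carrier) :
    M.uTwist i (a ⊗ₜ (g ⊗ₜ m)) =
      extSgn k w a ⊗ₜ (gammaAct k w (MvPolynomial.X i) g ⊗ₜ (extGen k i • m)) -
        (extGen k i * a) ⊗ₜ (gammaAct k w (MvPolynomial.X i) g ⊗ₜ m) := rfl

theorem uInner_tmul (a : ExteriorAlgebra k (Fin c → k)) (g : Gamma k w) (m : M.carrier) :
    M.uInner (a ⊗ₜ (g ⊗ₜ m)) = extSgn k w a ⊗ₜ (g ⊗ₜ M.diff m) := rfl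

theorem uSym_tmul (s : MvPolynomial (Fin c) k) (a : ExteriorAlgebra k (Fin c → k)) (g : Gamma k w)
    (m : M.carrier) :
    M.uSym s (a ⊗ₜ (g ⊗ₜ m)) = a ⊗ₜ (gammaAct k w s g ⊗ₜ m) := rfl

variable {M} in
/-- Two linear maps on `Λ ⊗ Γ ⊗ M` agree if they agree on pure tensors. -/
theorem u_ext {f g : M.UCarrier →ₗ[k] M.UCarrier}
    (h : ∀ a γ m, f (a ⊗ₜ (γ ⊗ₜ m)) = g (a ⊗ₜ (γ ⊗ₜ m))) : f = g := by
  apply TensorProduct.ext'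
  intro a z
  induction z using TensorProduct.induction_on with
  | zero => simp
  | add x y hx hy => rw [TensorProduct.tmul_add, map_add, map_add, hx, hy]
  | tmul γ m => exact h a γ m

theorem uInner_sq : M.uInner * M.uInner = 0 := u_ext fun a γ m => by
  rw [Module.End.mul_apply, uInner_tmul, uInner_tmul, M.diff_diff]; simp

theorem uTwist_sq (i : Fin c) : M.uTwist i * M.uTwist i = 0 := u_ext fun a γ m => by
  rw [Module.End.mul_apply, uTwist_tmul, map_sub, uTwist_tmul, uTwist_tmul, gen_smul_self,
    extSgn_gen_mul, ← mul_assoc, extGen_mul_self]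
  simp [TensorProduct.neg_tmul]

theorem uTwist_swap (i j : Fin c) : M.uTwist i * M.uTwist j + M.uTwist j * M.uTwist i = 0 :=
  u_ext fun a γ m => by
  have h : extGen k j * (extGen k i * a) = -(extGen k i * (extGen k j * a)) := by
    rw [← mul_assoc, ← mul_assoc, ← sub_eq_zero, sub_neg_eq_add, ← add_mul, extGen_mul_swap,
      zero_mul]
  rw [LinearMap.add_apply, Module.End.mul_apply, Module.End.mul_apply, uTwist_tmul, uTwist_tmul,
    map_sub, map_sub, uTwist_tmul, uTwist_tmul, uTwist_tmul, uTwist_tmul, M.gen_smul_swap i j,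
    extSgn_gen_mul, extSgn_gen_mul, h,
    gammaAct_comm k w (MvPolynomial.X j) (MvPolynomial.X i)]
  simp only [TensorProduct.neg_tmul, TensorProduct.tmul_neg, LinearMap.zero_apply]
  abel

theorem uInner_uTwist (i : Fin c) : M.uInner * M.uTwist i + M.uTwist i * M.uInner = 0 :=
  u_ext fun a γ m => by
  rw [LinearMap.add_apply, Module.End.mul_apply, Module.End.mul_apply, uTwist_tmul, uInner_tmul,
    map_sub, uInner_tmul, uInner_tmul, uTwist_tmul, diff_gen, extSgn_gen_mul]
  simp only [TensorProduct.neg_tmul, TensorProduct.tmul_neg, LinearMap.zero_apply]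
  abel

theorem uDiff_sq : M.uDiff * M.uDiff = 0 :=
  sq_add_sum_eq_zero Finset.univ M.uInner M.uTwist M.uInner_sq M.uTwist_sq M.uTwist_swap
    M.uInner_uTwist

theorem uDiff_uSym (s : MvPolynomial (Fin c) k) (x : M.UCarrier) :
    M.uDiff (M.uSym s x) = M.uSym s (M.uDiff x) := by
  have h : M.uDiff * M.uSym s = M.uSym s * M.uDiff := by
    refine add_sum_mul_comm Finset.univ M.uInner (M.uSym s) M.uTwist ?_ fun i => ?_
    · exact u_ext fun a γ m => rfl
    · refine u_ext fun a γ m => ?_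
      rw [Module.End.mul_apply, Module.End.mul_apply, uSym_tmul, uTwist_tmul, uTwist_tmul, map_sub,
        uSym_tmul, uSym_tmul, gammaAct_comm k w s (MvPolynomial.X i)]
  exact LinearMap.congr_fun h x

theorem extSgn_shift (n : ℤ) (a : ExteriorAlgebra k (Fin c → k)) (ha : a ∈ extGr k w n) :
    extSgn k w a ∈ extGr k w (0 + n) := by
  rw [zero_add]; exact signMap_mem _ ha

theorem uInner_mem {n : ℤ} {x : M.UCarrier} (hx : x ∈ M.uGr n) : M.uInner x ∈ M.uGr (n - 1) := by
  have e : n - 1 = 0 + (0 + -1) + n := by ring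
  rw [e]
  exact map_mem_tensorGr extSgn_shift (fun j y hy => map_mem_tensorGr
    (fun j y hy => by simpa using hy)
    (fun i y hy => by rw [neg_add_eq_sub]; exact M.diff_mem hy) hy) hx

theorem uTwist_mem (i : Fin c) {n : ℤ} {x : M.UCarrier} (hx : x ∈ M.uGr n) :
    M.uTwist i x ∈ M.uGr (n - 1) := by
  have e1 : n - 1 = 0 + (-(((w i : ℕ) : ℤ) + 1) + ((w i : ℕ) : ℤ)) + n := by ring
  have e2 : n - 1 = ((w i : ℕ) : ℤ) + (-(((w i : ℕ) : ℤ) + 1) + 0) + n := by ring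
  refine sub_mem ?_ ?_
  · rw [e1]
    exact map_mem_tensorGr extSgn_shift (fun j y hy => map_mem_tensorGr
      (fun j y hy => gammaAct_mem k w (X_mem_symGr k w i) hy)
      (fun j y hy => M.smul_mem (extGen_mem k w i) hy) hy) hx
  · rw [e2]
    exact map_mem_tensorGr (fun j y hy => SetLike.GradedMul.mul_mem (extGen_mem k w i) hy)
      (fun j y hy => map_mem_tensorGr
        (fun j y hy => gammaAct_mem k w (X_mem_symGr k w i) hy)
        (fun j y hy => by simpa using hy) hy) hx

theorem uSym_mem {i n : ℤ} {s : MvPolynomial (Fin c) k} (hs : s ∈ symGr k w i) {x : M.UCarrier}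
    (hx : x ∈ M.uGr n) : M.uSym s x ∈ M.uGr (i + n) := by
  have e : i + n = 0 + (i + 0) + n := by ring
  rw [e]
  exact map_mem_tensorGr (fun j y hy => by simpa using hy) (fun j y hy => map_mem_tensorGr
    (fun j y hy => gammaAct_mem k w hs hy) (fun j y hy => by simpa using hy) hy) hx

/-- The action of `Λ` on `Λ ⊗ Γ ⊗ M` by multiplication on the left factor, as operators. -/
def uAct : ExteriorAlgebra k (Fin c → k) →ₐ[k] Module.End k M.UCarrier :=
  Algebra.lsmul k k M.UCarrier

theorem uAct_tmul (b a : ExteriorAlgebra k (Fin c → k)) (z : Gamma k w ⊗[k] M.carrier) :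
    M.uAct b (a ⊗ₜ z) = (b * a) ⊗ₜ z := rfl

theorem uAct_eq (b : ExteriorAlgebra k (Fin c → k)) :
    M.uAct b = TensorProduct.map (LinearMap.mulLeft k b) LinearMap.id :=
  TensorProduct.ext' fun _ _ => rfl

theorem uDiff_gen (i : Fin c) (x : M.UCarrier) :
    M.uDiff (M.uAct (extGen k i) x) = -(M.uAct (extGen k i) (M.uDiff x)) := by
  have h : M.uDiff * M.uAct (extGen k i) = - (M.uAct (extGen k i) * M.uDiff) := by
    refine add_sum_mul_anticomm Finset.univ M.uInner (M.uAct (extGen k i)) M.uTwist ?_ fun j => ?_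
    · refine u_ext fun a γ m => ?_
      rw [LinearMap.neg_apply, Module.End.mul_apply, Module.End.mul_apply, uAct_tmul, uInner_tmul,
        uInner_tmul, uAct_tmul, extSgn_gen_mul, TensorProduct.neg_tmul]
    · refine u_ext fun a γ m => ?_
      have h : extGen k j * (extGen k i * a) = -(extGen k i * (extGen k j * a)) := by
        rw [← mul_assoc, ← mul_assoc, ← sub_eq_zero, sub_neg_eq_add, ← add_mul, extGen_mul_swap,
          zero_mul]
      rw [LinearMap.neg_apply, Module.End.mul_apply, Module.End.mul_apply, uAct_tmul, uTwist_tmul,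
        uTwist_tmul, map_sub, uAct_tmul, uAct_tmul, extSgn_gen_mul, h]
      simp only [TensorProduct.neg_tmul]
      abel
  exact LinearMap.congr_fun h x

/-- The universal resolution `u M`, as a dg `Λ`-module. -/
def universalResolution : DGModule (extGr k w) where
  carrier := M.UCarrier
  gr := M.uGr
  isInternal := tensorGr_isInternal (extGr_isInternal k w)
    (tensorGr_isInternal (gammaGr_isInternal k w) M.isInternal)
  smul_mem ha hx := by
    refine ext_act_mem (w := w) M.uAct (fun i n x hx => ?_) ha hx
    rw [uAct_eq, ← add_zero ((w i : ℕ) : ℤ)]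
    exact map_mem_tensorGr (fun j y hy => SetLike.GradedMul.mul_mem (extGen_mem k w i) hy)
      (fun j y hy => by simpa using hy) hx
  diff := M.uDiff
  diff_mem {n x} hx := by
    rw [uDiff, LinearMap.add_apply, LinearMap.sum_apply]
    exact add_mem (M.uInner_mem hx) (sum_mem fun i _ => M.uTwist_mem i hx)
  diff_diff x := LinearMap.congr_fun M.uDiff_sq x
  leibniz x ha := ext_act_leibniz (w := w) M.uAct M.uDiff M.uDiff_gen x ha

theorem uSym_uAct (s : MvPolynomial (Fin c) k) (a : ExteriorAlgebra k (Fin c → k))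
    (x : M.UCarrier) : M.uSym s (M.uAct a x) = M.uAct a (M.uSym s x) := by
  have : M.uSym s * M.uAct a = M.uAct a * M.uSym s := u_ext fun b γ m => by
    rw [Module.End.mul_apply, Module.End.mul_apply, uAct_tmul, uSym_tmul, uSym_tmul, uAct_tmul]
  exact LinearMap.congr_fun this x

theorem uSym_add (s t : MvPolynomial (Fin c) k) : M.uSym (s + t) = M.uSym s + M.uSym t := by
  rw [uSym, gammaAct_add, TensorProduct.map_add_left, TensorProduct.map_add_right]; rfl

theorem uSym_scalar (a : k) (s : MvPolynomial (Fin c) k) : M.uSym (a • s) = a • M.uSym s := by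
  rw [uSym, gammaAct_smul, TensorProduct.map_smul_left, TensorProduct.map_smul_right]; rfl

theorem uSym_one : M.uSym 1 = LinearMap.id := by
  rw [uSym, gammaAct_one, TensorProduct.map_id, TensorProduct.map_id]

theorem uSym_mul (s t : MvPolynomial (Fin c) k) : M.uSym (s * t) = M.uSym s * M.uSym t :=
  u_ext fun a γ m => by
    rw [Module.End.mul_apply, uSym_tmul, uSym_tmul, uSym_tmul, gammaAct_mul]

/-- The action of `S` on `Λ ⊗ Γ ⊗ M`, as an algebra map. -/
def uSymHom : MvPolynomial (Fin c) k →ₐ[k] Module.End k M.UCarrier :=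
  AlgHom.ofLinearMap
    { toFun := M.uSym, map_add' := M.uSym_add, map_smul' := M.uSym_scalar } M.uSym_one M.uSym_mul

/-- A compatible action of `S` on a dg `Λ`-module `U`, making `U` a dg `(Λ ⊗ S)`-module. -/
structure SymAction (U : DGModule (extGr k w)) where
  /-- The action of `S` on `U`. -/
  act : MvPolynomial (Fin c) k →ₐ[k] Module.End k U.carrier
  act_mem : ∀ {i n : ℤ} {s : MvPolynomial (Fin c) k} {x : U.carrier},
    s ∈ symGr k w i → x ∈ U.gr n → act s x ∈ U.gr (i + n)
  act_smul : ∀ (s : MvPolynomial (Fin c) k) (a : ExteriorAlgebra k (Fin c → k)) (x : U.carrier),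
    act s (a • x) = a • act s x
  act_diff : ∀ (s : MvPolynomial (Fin c) k) (x : U.carrier), U.diff (act s x) = act s (U.diff x)

/-- The universal resolution `u M` is a dg `(Λ ⊗ S)`-module. -/
def universalAction : SymAction M.universalResolution where
  act := M.uSymHom
  act_mem hs hx := M.uSym_mem hs hx
  act_smul s a x := M.uSym_uAct s a x
  act_diff s x := M.uDiff_uSym s x

end Universal

section Dual

variable {U : DGModule (extGr k w)}

/-- The degree `n` part of `Hom_Λ(U, k)`: the functionals `f` on `U` that vanish outside
degree `-n` and are `Λ`-linear, where `Λ` acts on `k` through the augmentation `ε`. (The sign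
in the linearity condition `f (a x) = (-1)^(n |a|) a f(x)` disappears, since `a` acts on `k` as
zero when `|a| ≠ 0`.) -/
def homGr (U : DGModule (extGr k w)) (n : ℤ) : Submodule k (Module.Dual k U.carrier) where
  carrier := {f | f ∈ dualGr U.gr n ∧
    ∀ (a : ExteriorAlgebra k (Fin c → k)) (x : U.carrier),
      f (a • x) = ExteriorAlgebra.algebraMapInv a * f x}
  zero_mem' := ⟨zero_mem _, fun a x => by simp⟩
  add_mem' {f g} hf hg := ⟨add_mem hf.1 hg.1, fun a x => by
    rw [LinearMap.add_apply, LinearMap.add_apply, hf.2, hg.2, mul_add]⟩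
  smul_mem' t f hf := ⟨Submodule.smul_mem _ t hf.1, fun a x => by
    rw [LinearMap.smul_apply, LinearMap.smul_apply, hf.2, smul_eq_mul, smul_eq_mul,
      mul_left_comm]⟩

/-- The sums of homogeneous `Λ`-linear maps `U → k`, as a space of functionals. -/
def homSubmodule (U : DGModule (extGr k w)) : Submodule k (Module.Dual k U.carrier) :=
  ⨆ n, U.homGr n

theorem homGr_iSupIndep (U : DGModule (extGr k w)) : iSupIndep U.homGr :=
  (iSupIndep_dualGr U.isInternal).mono fun _ _ hf => hf.1

theorem comp_act_mem (T : SymAction U) {i n : ℤ} {s : MvPolynomial (Fin c) k}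
    (hs : s ∈ symGr k w i) {f : Module.Dual k U.carrier} (hf : f ∈ U.homGr n) :
    f ∘ₗ T.act s ∈ U.homGr (i + n) :=
  ⟨fun j hj x hx => hf.1 (i + j) (fun h => hj (by omega)) _ (T.act_mem hs hx), fun a x => by
    rw [LinearMap.comp_apply, LinearMap.comp_apply, T.act_smul]
    exact hf.2 a _⟩

theorem comp_act_mem_hom (T : SymAction U) (s : MvPolynomial (Fin c) k)
    {f : Module.Dual k U.carrier} (hf : f ∈ U.homSubmodule) :
    f ∘ₗ T.act s ∈ U.homSubmodule := by
  induction s using homogeneous_induction (algebra_isInternal (symGr k w)) with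
  | hom i s hs =>
    induction hf using Submodule.iSup_induction' with
    | mem n f hf => exact Submodule.mem_iSup_of_mem _ (comp_act_mem T hs hf)
    | zero => rw [LinearMap.zero_comp]; exact zero_mem _
    | add f g _ _ hf hg => rw [LinearMap.add_comp]; exact add_mem hf hg
  | add s t hs ht =>
    rw [map_add, LinearMap.comp_add]; exact add_mem hs ht

/-- The graded space `Hom_Λ(U, k)`. -/
def HomSpace (U : DGModule (extGr k w)) : Type u := U.homSubmodule

instance (U : DGModule (extGr k w)) : AddCommGroup U.HomSpace :=
  inferInstanceAs (AddCommGroup U.homSubmodule)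

instance (U : DGModule (extGr k w)) : Module k U.HomSpace :=
  inferInstanceAs (Module k U.homSubmodule)

/-- The degree `n` part of `Hom_Λ(U, k)`. -/
def homSpaceGr (U : DGModule (extGr k w)) (n : ℤ) : Submodule k U.HomSpace :=
  (U.homGr n).comap U.homSubmodule.subtype

theorem homSpaceGr_isInternal (U : DGModule (extGr k w)) : DirectSum.IsInternal U.homSpaceGr :=
  isInternal_comap_iSup U.homGr_iSupIndep

/-- The action of `S` on `Hom_Λ(U, k)` induced by its action on `U`. -/
def homAct (T : SymAction U) : MvPolynomial (Fin c) k →ₐ[k] Module.End k U.HomSpace :=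
  AlgHom.ofLinearMap
    { toFun := fun s =>
        { toFun := fun f => ⟨f.1 ∘ₗ T.act s, comp_act_mem_hom T s f.2⟩
          map_add' := fun _ _ => rfl
          map_smul' := fun _ _ => rfl }
      map_add' := fun s t => by
        apply LinearMap.ext
        intro f
        apply Subtype.ext
        show f.1 ∘ₗ T.act (s + t) = f.1 ∘ₗ T.act s + f.1 ∘ₗ T.act t
        rw [map_add, LinearMap.comp_add]
      map_smul' := fun a s => by
        apply LinearMap.ext
        intro f
        apply Subtype.ext
        show f.1 ∘ₗ T.act (a • s) = a • (f.1 ∘ₗ T.act s)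
        rw [map_smul, LinearMap.comp_smul] }
    (by
      apply LinearMap.ext
      intro f
      apply Subtype.ext
      show f.1 ∘ₗ T.act 1 = f.1
      rw [map_one]; rfl)
    (fun s t => by
      apply LinearMap.ext
      intro f
      apply Subtype.ext
      show f.1 ∘ₗ T.act (s * t) = (f.1 ∘ₗ T.act t) ∘ₗ T.act s
      rw [mul_comm, map_mul]; rfl)

/-- The map `x ↦ (-1)^|x| ∂x`. It is `Λ`-linear. -/
def signedDiff (U : DGModule (extGr k w)) : U.carrier →ₗ[k] U.carrier := U.diff ∘ₗ U.sgn

theorem signedDiff_smul (a : ExteriorAlgebra k (Fin c → k)) (x : U.carrier) :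
    U.signedDiff (a • x) = a • U.signedDiff x := by
  induction a using homogeneous_induction (algebra_isInternal (extGr k w)) with
  | hom i a ha =>
    rw [signedDiff, LinearMap.comp_apply, sgn_smul _ ha, map_zsmul, leibniz _ _ ha,
      negOnePow_zsmul_zsmul, LinearMap.comp_apply]
  | add a b ha hb => rw [add_smul, map_add, ha, hb, add_smul]

theorem signedDiff_sq (x : U.carrier) : U.signedDiff (U.signedDiff x) = 0 := by
  simp only [signedDiff, LinearMap.comp_apply]
  rw [sgn_diff, map_neg, diff_diff, neg_zero]

theorem comp_signedDiff_mem {n : ℤ} {f : Module.Dual k U.carrier} (hf : f ∈ U.homGr n) :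
    f ∘ₗ U.signedDiff ∈ U.homGr (n - 1) :=
  ⟨fun j hj x hx => hf.1 (j - 1) (fun h => hj (by omega)) _ (U.diff_mem (U.sgn_mem hx)),
    fun a x => by rw [LinearMap.comp_apply, LinearMap.comp_apply, signedDiff_smul, hf.2]⟩

theorem comp_signedDiff_mem_hom {f : Module.Dual k U.carrier} (hf : f ∈ U.homSubmodule) :
    f ∘ₗ U.signedDiff ∈ U.homSubmodule := by
  induction hf using Submodule.iSup_induction' with
  | mem n f hf => exact Submodule.mem_iSup_of_mem _ (comp_signedDiff_mem hf)
  | zero => rw [LinearMap.zero_comp]; exact zero_mem _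
  | add f g _ _ hf hg => rw [LinearMap.add_comp]; exact add_mem hf hg

/-- The differential `f ↦ -(-1)^|f| f ∘ ∂` of `Hom_Λ(U, k)`; since `f ∘ ∂` is supported in
degree `1 - |f|`, this is the map sending `x` to `(-1)^|x| f (∂x)`. -/
def homDiff (U : DGModule (extGr k w)) : U.HomSpace →ₗ[k] U.HomSpace where
  toFun f := ⟨f.1 ∘ₗ U.signedDiff, comp_signedDiff_mem_hom f.2⟩
  map_add' _ _ := rfl
  map_smul' _ _ := rfl

theorem act_signedDiff (T : SymAction U) {i : ℤ} {s : MvPolynomial (Fin c) k}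
    (hs : s ∈ symGr k w i) (x : U.carrier) :
    T.act s (U.signedDiff x) = (i.negOnePow : ℤ) • U.signedDiff (T.act s x) := by
  have h : U.sgn (T.act s x) = (i.negOnePow : ℤ) • T.act s (U.sgn x) :=
    signMap_shift U.isInternal U.isInternal (T.act s) i (fun n x hx => T.act_mem hs hx) x
  rw [signedDiff, LinearMap.comp_apply, LinearMap.comp_apply, h, map_zsmul, negOnePow_zsmul_zsmul,
    T.act_diff]

/-- The dg `S`-module `Hom_Λ(U, k)`, for a dg `(Λ ⊗ S)`-module `U`. -/
def homToBase (T : SymAction U) : DGModule (symGr k w) where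
  carrier := U.HomSpace
  addCommGroup := inferInstance
  moduleBase := inferInstance
  module := Module.compHom _ (homAct T).toRingHom
  isScalarTower := isScalarTower_of_algHom (homAct T)
  gr := U.homSpaceGr
  isInternal := U.homSpaceGr_isInternal
  smul_mem {_ _ _ f} hs hf := comp_act_mem T (f := f.1) hs hf
  diff := U.homDiff
  diff_mem {_ f} hf := comp_signedDiff_mem (f := f.1) hf
  diff_diff f := by
    apply Subtype.ext
    apply LinearMap.ext
    intro x
    show f.1 (U.signedDiff (U.signedDiff x)) = 0
    rw [signedDiff_sq, map_zero]
  leibniz {i s} f hs := by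
    apply Subtype.ext
    apply LinearMap.ext
    intro x
    show f.1 (T.act s (U.signedDiff x)) = (i.negOnePow : ℤ) • f.1 (U.signedDiff (T.act s x))
    rw [act_signedDiff T hs, map_zsmul]

variable (M : DGModule (extGr k w))

/-- The dg `S`-module `d M = Hom_Λ(u M, k)`. -/
def bgg : DGModule (symGr k w) := homToBase M.universalAction

/-- The support of an `S`-module `X`: the points `𝔭` of `Proj S` such that the homogeneous
localization of `X` at `𝔭`, obtained by inverting the homogeneous elements of `S` outside `𝔭`,
is nonzero. -/
def projSupport (w : OddDegrees c) (X : Type u) [AddCommGroup X]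
    [Module (MvPolynomial (Fin c) k) X] : Set (ProjectiveSpectrum (symUpperGr k w)) :=
  {𝔭 | Nontrivial (LocalizedModule
    (SetLike.homogeneousSubmonoid (symUpperGr k w) ⊓ 𝔭.asHomogeneousIdeal.toIdeal.primeCompl) X)}

/-- The cohomological support `V^d_Λ(M) = Supp_S H(d M)`. -/
def supportVariety : Set (ProjectiveSpectrum (symUpperGr k w)) := projSupport w M.bgg.Homology

end Dual

section SymTensor

variable (X Y : DGModule (symGr k w))

/-- Linear operators commuting with homogeneous elements of `S` are `S`-linear. -/
def symLinear {X Y : DGModule (symGr k w)} (f : X.carrier →ₗ[k] Y.carrier)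
    (h : ∀ (i : ℤ) (s : MvPolynomial (Fin c) k) (x : X.carrier), s ∈ symGr k w i →
      f (s • x) = s • f x) : X.carrier →ₗ[MvPolynomial (Fin c) k] Y.carrier where
  toFun := f
  map_add' := map_add f
  map_smul' s x := by
    rw [RingHom.id_apply]
    induction s using homogeneous_induction (algebra_isInternal (symGr k w)) with
    | hom i s hs => exact h i s x hs
    | add s t hs ht => rw [add_smul, map_add, hs, ht, add_smul]

/-- The differential as an `S`-linear map (`S` lives in even degrees). -/
def symDiff : X.carrier →ₗ[MvPolynomial (Fin c) k] X.carrier :=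
  symLinear X.diff fun i s x hs => by rw [X.leibniz x hs, smul_symGr k w hs]

/-- The sign operator as an `S`-linear map (`S` lives in even degrees). -/
def symSgn : X.carrier →ₗ[MvPolynomial (Fin c) k] X.carrier :=
  symLinear X.sgn fun i s x hs => by rw [X.sgn_smul hs, smul_symGr k w hs]

/-- The degree `n` part of `X ⊗_S Y`, spanned by the `x ⊗ y` with `|x| + |y| = n`. -/
def symTensorGr (n : ℤ) :
    Submodule k (X.carrier ⊗[MvPolynomial (Fin c) k] Y.carrier) :=
  Submodule.span k {z | ∃ i j, i + j = n ∧ ∃ x ∈ X.gr i, ∃ y ∈ Y.gr j, x ⊗ₜ y = z}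

theorem tmul_mem_symTensorGr {i j n : ℤ} {x : X.carrier} {y : Y.carrier} (hx : x ∈ X.gr i)
    (hy : y ∈ Y.gr j) (h : i + j = n) : x ⊗ₜ y ∈ symTensorGr X Y n :=
  Submodule.subset_span ⟨i, j, h, x, hx, y, hy, rfl⟩

/-- The quotient map `X ⊗_k Y → X ⊗_S Y`. -/
def symTensorProj :
    X.carrier ⊗[k] Y.carrier →+ X.carrier ⊗[MvPolynomial (Fin c) k] Y.carrier :=
  TensorProduct.liftAddHom
    { toFun := fun x =>
        { toFun := fun y => x ⊗ₜ y
          map_zero' := TensorProduct.tmul_zero _ _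
          map_add' := fun _ _ => TensorProduct.tmul_add _ _ _ }
      map_zero' := by ext y; exact TensorProduct.zero_tmul _ _
      map_add' := fun _ _ => by ext y; exact TensorProduct.add_tmul _ _ _ }
    (fun r x y => by
      show (r • x) ⊗ₜ y = x ⊗ₜ (r • y)
      rw [← algebraMap_smul (MvPolynomial (Fin c) k) r x,
        ← algebraMap_smul (MvPolynomial (Fin c) k) r y, TensorProduct.smul_tmul])

/-- The decomposition of elements of `X ⊗_S Y` into homogeneous components. -/
def symTensorComponents :
    X.carrier ⊗[MvPolynomial (Fin c) k] Y.carrier →+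
      (ℤ →₀ X.carrier ⊗[MvPolynomial (Fin c) k] Y.carrier) :=
  TensorProduct.liftAddHom
    { toFun := fun x =>
        { toFun := fun y => Finsupp.mapRange.addMonoidHom (symTensorProj X Y)
            (tensorComponents X.isInternal Y.isInternal (x ⊗ₜ y))
          map_zero' := by simp
          map_add' := fun _ _ => by rw [TensorProduct.tmul_add, map_add, map_add] }
      map_zero' := by ext1 y; simp
      map_add' := fun _ _ => by
        ext1 y
        simp only [AddMonoidHom.coe_mk, ZeroHom.coe_mk, AddMonoidHom.add_apply]
        rw [TensorProduct.add_tmul, map_add, map_add] }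
    (fun s x y => by
      simp only [AddMonoidHom.coe_mk, ZeroHom.coe_mk]
      induction s using homogeneous_induction (algebra_isInternal (symGr k w)) with
      | hom d s hs =>
        induction x using homogeneous_induction X.isInternal with
        | hom i x hx =>
          induction y using homogeneous_induction Y.isInternal with
          | hom j y hy =>
            rw [tensorComponents_tmul _ _ (X.smul_mem hs hx) hy,
              tensorComponents_tmul _ _ hx (Y.smul_mem hs hy), add_left_comm, add_assoc]
            rw [Finsupp.mapRange.addMonoidHom_apply, Finsupp.mapRange.addMonoidHom_apply,
              Finsupp.mapRange_single, Finsupp.mapRange_single]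
            congr 1
            exact TensorProduct.smul_tmul s x y
          | add y y' hy hy' =>
            rw [smul_add, TensorProduct.tmul_add, TensorProduct.tmul_add, map_add, map_add, map_add,
              map_add, hy, hy']
        | add x x' hx hx' =>
          rw [smul_add, TensorProduct.add_tmul, TensorProduct.add_tmul, map_add, map_add, map_add,
            map_add, hx, hx']
      | add s t hs ht =>
        rw [add_smul, add_smul, TensorProduct.add_tmul, TensorProduct.tmul_add, map_add, map_add,
          map_add, map_add, hs, ht])

theorem symTensorComponents_tmul {i j : ℤ} {x : X.carrier} {y : Y.carrier} (hx : x ∈ X.gr i)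
    (hy : y ∈ Y.gr j) :
    symTensorComponents X Y (x ⊗ₜ y) = Finsupp.single (i + j) (x ⊗ₜ y) := by
  show Finsupp.mapRange.addMonoidHom (symTensorProj X Y)
    (tensorComponents X.isInternal Y.isInternal (x ⊗ₜ y)) = _
  rw [tensorComponents_tmul _ _ hx hy, Finsupp.mapRange.addMonoidHom_apply,
    Finsupp.mapRange_single]
  rfl

theorem symTensorGr_isInternal : DirectSum.IsInternal (symTensorGr X Y) := by
  refine isInternal_of_coaction (symTensorComponents X Y) (fun n z hz => ?_) ?_
  · induction hz using Submodule.span_induction with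
    | mem z hz =>
      obtain ⟨i, j, rfl, x, hx, y, hy, rfl⟩ := hz
      exact symTensorComponents_tmul X Y hx hy
    | zero => simp
    | add x y _ _ hx hy => rw [map_add, hx, hy, Finsupp.single_add]
    | smul a z hz _ =>
      clear * - hz
      induction hz using Submodule.span_induction generalizing a with
      | mem z hz =>
        obtain ⟨i, j, rfl, x, hx, y, hy, rfl⟩ := hz
        rw [TensorProduct.smul_tmul']
        exact symTensorComponents_tmul X Y (Submodule.smul_mem _ a hx) hy
      | zero => simp
      | add x y _ _ hx hy => rw [smul_add, map_add, hx, hy, Finsupp.single_add]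
      | smul b z _ h => rw [← mul_smul]; exact h (a * b)
  · refine Submodule.eq_top_iff'.2 fun z => ?_
    induction z using TensorProduct.induction_on with
    | zero => exact zero_mem _
    | add x y hx hy => exact add_mem hx hy
    | tmul x y =>
      induction x using homogeneous_induction X.isInternal with
      | hom i x hx =>
        induction y using homogeneous_induction Y.isInternal with
        | hom j y hy =>
          exact Submodule.mem_iSup_of_mem (i + j) (tmul_mem_symTensorGr X Y hx hy rfl)
        | add y y' hy hy' => rw [TensorProduct.tmul_add]; exact add_mem hy hy'
      | add x x' hx hx' => rw [TensorProduct.add_tmul]; exact add_mem hx hx'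

/-- The differential of `X ⊗_S Y`, `x ⊗ y ↦ ∂x ⊗ y + (-1)^|x| x ⊗ ∂y`. -/
def symTensorDiff :
    X.carrier ⊗[MvPolynomial (Fin c) k] Y.carrier →ₗ[MvPolynomial (Fin c) k]
      X.carrier ⊗[MvPolynomial (Fin c) k] Y.carrier :=
  TensorProduct.map X.symDiff LinearMap.id + TensorProduct.map X.symSgn Y.symDiff

theorem symTensorDiff_tmul (x : X.carrier) (y : Y.carrier) :
    symTensorDiff X Y (x ⊗ₜ y) = X.diff x ⊗ₜ y + X.sgn x ⊗ₜ Y.diff y := rfl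

/-- The tensor product `X ⊗_S Y` of dg `S`-modules. -/
def symTensor : DGModule (symGr k w) where
  carrier := X.carrier ⊗[MvPolynomial (Fin c) k] Y.carrier
  gr := symTensorGr X Y
  isInternal := symTensorGr_isInternal X Y
  smul_mem {i j s z} hs hz := by
    induction hz using Submodule.span_induction with
    | mem z hz =>
      obtain ⟨a, b, rfl, x, hx, y, hy, rfl⟩ := hz
      rw [TensorProduct.smul_tmul']
      exact tmul_mem_symTensorGr X Y (X.smul_mem hs hx) hy (by ring)
    | zero => simp
    | add x y _ _ hx hy => rw [smul_add]; exact add_mem hx hy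
    | smul a z _ hz => rw [smul_comm]; exact Submodule.smul_mem _ a hz
  diff := (symTensorDiff X Y).restrictScalars k
  diff_mem {n z} hz := by
    induction hz using Submodule.span_induction with
    | mem z hz =>
      obtain ⟨a, b, rfl, x, hx, y, hy, rfl⟩ := hz
      exact add_mem (tmul_mem_symTensorGr X Y (X.diff_mem hx) hy (by ring))
        (tmul_mem_symTensorGr X Y (signMap_mem X.isInternal hx) (Y.diff_mem hy) (by ring))
    | zero => simp
    | add x y _ _ hx hy => rw [map_add]; exact add_mem hx hy
    | smul a z _ hz => rw [map_smul]; exact Submodule.smul_mem _ a hz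
  diff_diff z := by
    rw [LinearMap.restrictScalars_apply, LinearMap.restrictScalars_apply]
    induction z using TensorProduct.induction_on with
    | zero => simp
    | add x y hx hy => rw [map_add, map_add, hx, hy, add_zero]
    | tmul x y =>
      rw [symTensorDiff_tmul, map_add, symTensorDiff_tmul, symTensorDiff_tmul, X.diff_diff,
        Y.diff_diff, sgn_diff, TensorProduct.neg_tmul]
      simp
  leibniz {i s} z hs := by
    rw [LinearMap.restrictScalars_apply, LinearMap.restrictScalars_apply, map_smul,
      smul_symGr k w hs]

end SymTensor

end DGModule

end

/-!
The proof replaces `d M = Hom_Λ(u M, k)` by a smaller dg `S`-module. A functional on `Λ ⊗ Γ ⊗ M` that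
is linear over `Λ` amounts to a functional on `Γ ⊗ M`, and, `Γ` being the graded dual of the
degreewise finite-dimensional `S`, to a linear map `M → S`. This identifies `d M` with the *twisted
dual* `C(M)`: sums of homogeneous maps `f : M → S`, with the differential
`m ↦ f (∂ m̄) + ∑ χ_i f (e_i m̄)`, where `m̄ = (-1)^|m| m` (`twistedDualToBgg_bijective`).

The twisted dual has the following properties.

* It preserves quasi-isomorphisms (`quasiIso_dualMap`). Over `k` the cone of a quasi-isomorphism has a
  contraction, and successive corrections along it, each raising the degree in the variables `χ_i`,
  solve the equation `d g = f`. The degrees make the corrections pointwise finite.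
* If `M` is bounded below and degreewise finite-dimensional, then the dual of a suitable `k`-basis of
  `M` is an `S`-basis of `C(M)` in which the differential is strictly triangular, so that `C(M)` is
  semifree (`IsFiniteType.exists_triangularBasis`). For two such modules, the map
  `f ⊗ g ↦ (m ⊗ n ↦ ± f(m) g(n))` is an isomorphism `C(M) ⊗_S C(N) ≅ C(M ⊗ N)`
  (`dualTensorMap_bijective`).

A dg `Λ`-module `M` whose homology is bounded below and degreewise finite-dimensional has a
quasi-isomorphic submodule `M'` which is itself bounded below and degreewise finite-dimensional
(`IsDfPlus.exists_submodule`). The restriction `C(M) → C(M')` is a surjective quasi-isomorphism onto a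
semifree module, so it has a section (`exists_section`), and adding a contractible semifree summand
makes the section a semifree resolution. An arbitrary resolution `P → d M` is compared with `C(M')`
through `d M ≅ C(M) → C(M')`. Tensoring over `k`, or over `S` with semifree modules, preserves
quasi-isomorphisms (`quasiIso_hopfMap`, `quasiIso_symTensorMap`), which gives the derived isomorphism
`d(M ⊗ N) ≃ C(M' ⊗ N') ≅ C(M') ⊗_S C(N') ≃ P ⊗_S d N`.

If the total homology is finite-dimensional, then some quotient of `M'` is a finite-dimensional model,
so that for the supports `d M` and `d N` may be replaced by semifree modules `X` and `Y` of finite rank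
over `S`. For these, a prime `p` lies in the support of the homology if and only if `κ(p) ⊗ X` has nonzero
homology. If some `t ∉ p` kills `H(X)`, then triangularity makes a power of `t` null-homotopic.
Conversely, if `κ(p) ⊗ X` is contractible, then a contraction, after clearing denominators, lifts to a
map `h` on `X` for which `E = d h + h d` has a determinant outside `p`; this determinant kills
`H(X)` by the Cayley–Hamilton theorem. Over the field `κ(p)` the Künneth formula shows that
`κ(p) ⊗ X ⊗ Y` has nonzero homology when both factors have it. This gives one inclusion. The
other one holds since an element that kills `H(X)` has a power that kills any given class of
`H(X ⊗ Y)`.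
-/

noncomputable section

/-! ### Graded vector spaces and complexes over a field -/

section GradedLinearAlgebra

variable {k X Y : Type*} [Field k] [AddCommGroup X] [Module k X] [AddCommGroup Y] [Module k Y]
  {gr : ℤ → Submodule k X} {gr' : ℤ → Submodule k Y}

theorem iSup_eq_top_of_components (h : ∀ x : X, x ∈ iSup gr) : iSup gr = ⊤ :=
  Submodule.eq_top_iff'.2 h

/-- The projection onto the homogeneous component of degree `n`. -/
def component (h : DirectSum.IsInternal gr) (n : ℤ) : X →ₗ[k] X :=
  Finsupp.lapply n ∘ₗ components h

theorem component_of_mem (h : DirectSum.IsInternal gr) {n : ℤ} {x : X} (hx : x ∈ gr n) :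
    component h n x = x := by
  simp [component, components_of_mem h hx]

theorem component_of_mem_ne (h : DirectSum.IsInternal gr) {m n : ℤ} {x : X} (hx : x ∈ gr m)
    (hmn : m ≠ n) : component h n x = 0 := by
  simp [component, components_of_mem h hx, Finsupp.single_eq_of_ne hmn.symm]

theorem component_mem (h : DirectSum.IsInternal gr) (n : ℤ) (x : X) : component h n x ∈ gr n := by
  induction x using homogeneous_induction h with
  | hom m x hx =>
    by_cases e : m = n
    · subst e; rwa [component_of_mem h hx]
    · rw [component_of_mem_ne h hx e]; exact zero_mem _
  | add x y hx hy => rw [map_add]; exact add_mem hx hy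

theorem components_sum (h : DirectSum.IsInternal gr) (x : X) :
    ((components h x).sum fun _ y => y) = x := by
  induction x using homogeneous_induction h with
  | hom m x hx => rw [components_of_mem h hx, Finsupp.sum_single_index rfl]
  | add x y hx hy =>
    rw [map_add, Finsupp.sum_add_index' (fun _ => rfl) (fun _ _ _ => rfl), hx, hy]

theorem mem_of_component_mem (h : DirectSum.IsInternal gr) {P : Type*} [SetLike P X]
    [AddSubmonoidClass P X] (p : P) {x : X} (hx : ∀ n, component h n x ∈ p) : x ∈ p := by
  rw [← components_sum h x]
  exact sum_mem fun n _ => hx n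

/-- A linear map shifting degrees by `m` commutes with the projections. -/
theorem map_component (h : DirectSum.IsInternal gr) (h' : DirectSum.IsInternal gr') (f : X →+ Y)
    (m : ℤ) (hf : ∀ n, ∀ x ∈ gr n, f x ∈ gr' (n + m)) (n : ℤ) (x : X) :
    f (component h n x) = component h' (n + m) (f x) := by
  induction x using homogeneous_induction h with
  | hom i x hx =>
    by_cases e : i = n
    · subst e; rw [component_of_mem h hx, component_of_mem h' (hf i x hx)]
    · rw [component_of_mem_ne h hx e, component_of_mem_ne h' (hf i x hx) (by omega), map_zero]
  | add x y hx hy => simp only [map_add, hx, hy]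

theorem shiftGr_isInternal (h : DirectSum.IsInternal gr) (m : ℤ) :
    DirectSum.IsInternal (fun n => gr (n + m)) := by
  rw [DirectSum.isInternal_submodule_iff_iSupIndep_and_iSup_eq_top] at h ⊢
  exact ⟨h.1.comp (add_left_injective m),
    ((Equiv.addRight m).iSup_comp (g := gr)).trans h.2⟩

theorem prodGr_isInternal (h : DirectSum.IsInternal gr) (h' : DirectSum.IsInternal gr') :
    DirectSum.IsInternal (fun n => (gr n).prod (gr' n)) := by
  refine isInternal_of_coaction
    ((Finsupp.mapRange.linearMap (LinearMap.inl k X Y) ∘ₗ components h ∘ₗ LinearMap.fst k X Y +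
      Finsupp.mapRange.linearMap (LinearMap.inr k X Y) ∘ₗ components h' ∘ₗ
        LinearMap.snd k X Y : X × Y →ₗ[k] (ℤ →₀ X × Y)).toAddMonoidHom) ?_ ?_
  · rintro n ⟨x, y⟩ ⟨hx, hy⟩
    have hx : x ∈ gr n := hx
    have hy : y ∈ gr' n := hy
    simp [components_of_mem h hx, components_of_mem h' hy, ← Finsupp.single_add]
  · refine iSup_eq_top_of_components ?_
    rintro ⟨x, y⟩
    have e : ((x, y) : X × Y) = (x, 0) + (0, y) := by simp
    rw [e]
    refine add_mem ?_ ?_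
    · induction x using homogeneous_induction h with
      | hom n x hx => exact Submodule.mem_iSup_of_mem n ⟨hx, zero_mem _⟩
      | add a b ha hb =>
        have e' : ((a + b, 0) : X × Y) = (a, 0) + (b, 0) := by simp
        rw [e']; exact add_mem (ha (by simp)) (hb (by simp))
    · induction y using homogeneous_induction h' with
      | hom n x hx => exact Submodule.mem_iSup_of_mem n ⟨zero_mem _, hx⟩
      | add a b ha hb =>
        have e' : ((0, a + b) : X × Y) = (0, a) + (0, b) := by simp
        rw [e']; exact add_mem (ha (by simp)) (hb (by simp))

/-- An exact complex of vector spaces is contractible: the identity is null-homotopic. -/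
theorem exists_contraction (h : DirectSum.IsInternal gr) (d : X →ₗ[k] X)
    (hd : ∀ n, ∀ x ∈ gr n, d x ∈ gr (n - 1)) (hdd : ∀ x, d (d x) = 0)
    (hex : ∀ x, d x = 0 → ∃ y, d y = x) :
    ∃ s : X →ₗ[k] X, (∀ n, ∀ x ∈ gr n, s x ∈ gr (n + 1)) ∧ ∀ x, d (s x) + s (d x) = x := by
  obtain ⟨g, hg⟩ := d.rangeRestrict.exists_rightInverse_of_surjective d.range_rangeRestrict
  obtain ⟨s0, hs0⟩ := LinearMap.exists_extend g
  have e0 : ∀ z, d z = 0 → d (s0 z) = z := by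
    intro z hz
    obtain ⟨y, rfl⟩ := hex z hz
    have h1 := LinearMap.congr_fun hs0 ⟨d y, y, rfl⟩
    have h2 := congrArg Subtype.val (LinearMap.congr_fun hg ⟨d y, y, rfl⟩)
    rw [LinearMap.comp_apply, ← h1] at h2
    simpa using h2
  -- the part of degree one of `s0`
  let s1 : X →ₗ[k] X :=
    Finsupp.lsum k (fun n : ℤ => component h (n + 1) ∘ₗ s0) ∘ₗ components h
  have hs1 : ∀ n, ∀ x ∈ gr n, s1 x = component h (n + 1) (s0 x) := by
    intro n x hx
    simp [s1, components_of_mem h hx]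
  have e1 : ∀ n, ∀ z ∈ gr n, d z = 0 → d (s1 z) = z := by
    intro n z hz hdz
    rw [hs1 n z hz]
    have := map_component h h d.toAddMonoidHom (-1) (fun n x hx => hd n x hx) (n + 1) (s0 z)
    simp only [LinearMap.toAddMonoidHom_coe] at this
    rw [this, e0 z hdz, component_of_mem h]
    simpa using hz
  refine ⟨s1 ∘ₗ (LinearMap.id - s1 ∘ₗ d), ?_, ?_⟩
  · intro n x hx
    have hm : ∀ n, ∀ x ∈ gr n, s1 x ∈ gr (n + 1) := fun n x hx => by
      rw [hs1 n x hx]; exact component_mem h _ _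
    refine hm n _ (sub_mem hx ?_)
    simpa using hm (n - 1) _ (hd n x hx)
  · intro x
    induction x using homogeneous_induction h with
    | hom n x hx =>
      have hc : d (x - s1 (d x)) = 0 := by
        rw [map_sub, e1 (n - 1) (d x) (hd n x hx) (hdd x), sub_self]
      have hm : x - s1 (d x) ∈ gr n := by
        refine sub_mem hx ?_
        rw [hs1 _ _ (hd n x hx), sub_add_cancel]
        exact component_mem h _ _
      have := e1 n _ hm hc
      simp only [LinearMap.comp_apply, LinearMap.sub_apply, LinearMap.id_apply, hdd, map_zero,
        sub_zero, this, sub_add_cancel]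
    | add x y hx hy =>
      rw [map_add, map_add, map_add, map_add, add_add_add_comm, hx, hy]

/-- A complex of vector spaces has a homogeneous basis such that some of the basis elements form a
basis of the space of cycles. -/
theorem exists_cycle_basis {X : Type u} [AddCommGroup X] [Module k X] {gr : ℤ → Submodule k X}
    (h : DirectSum.IsInternal gr) (d : X →ₗ[k] X) (hd : ∀ n, ∀ x ∈ gr n, d x ∈ gr (n - 1)) :
    ∃ (J : Type u) (b : Module.Basis J k X) (deg : J → ℤ) (cyc : J → Prop),
      (∀ j, b j ∈ gr (deg j)) ∧ (∀ j, cyc j → d (b j) = 0) ∧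
      ∀ x, d x = 0 → ∀ j, ¬ cyc j → b.repr x j = 0 := by
  classical
  let K : ∀ n, Submodule k (gr n) := fun n => LinearMap.ker (d ∘ₗ (gr n).subtype)
  choose W hW using fun n => Submodule.exists_isCompl (K n)
  let v : ∀ n, Module.Basis _ k (gr n) := fun n =>
    ((Module.Basis.ofVectorSpace k (K n)).prod (Module.Basis.ofVectorSpace k (W n))).map
      (Submodule.prodEquivOfIsCompl _ _ (hW n))
  refine ⟨_, h.collectedBasis v, Sigma.fst, fun j => j.2.isLeft = true, ?_, ?_, ?_⟩
  · exact fun j => h.collectedBasis_mem v j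
  · rintro ⟨n, a | a⟩ hj
    · rw [h.collectedBasis_coe]
      have : (v n (Sum.inl a)) ∈ K n := by simp [v]
      exact this
    · simp at hj
  · intro x hx
    have hc : ∀ n, d (component h n x) = 0 := fun n => by
      have := map_component h h d.toAddMonoidHom (-1) (fun n x hx => hd n x hx) n x
      simp only [LinearMap.toAddMonoidHom_coe] at this
      rw [this, hx, map_zero]
    rintro ⟨n, a⟩ hj
    rw [← components_sum h x, Finsupp.sum, map_sum, Finsupp.finsetSum_apply]
    refine Finset.sum_eq_zero fun m _ => ?_
    have hm : components h x m ∈ gr m := component_mem h m x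
    by_cases e : m = n
    · subst e
      rw [h.collectedBasis_repr_of_mem v hm]
      have hk : (⟨components h x m, hm⟩ : gr m) ∈ K m := hc m
      rcases a with a | a
      · simp at hj
      · have : (Submodule.prodEquivOfIsCompl _ _ (hW m)).symm ⟨components h x m, hm⟩ =
            (⟨⟨components h x m, hm⟩, hk⟩, 0) := by
          rw [LinearEquiv.symm_apply_eq]; simp
        simp [v, this]
    · exact h.collectedBasis_repr_of_mem_ne v e hm

end GradedLinearAlgebra

/-! ### Triangular differentials -/

section Triangular

variable {R : Type*} [CommRing R]

/-- Let `D` be a differential on `⨁ j, V` that is triangular with respect to levels of the indices,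
with diagonal entries `δ j`. If `t` kills the homology of all diagonal entries, then each cycle of
`D` is killed in homology by a power of `t`. For `t = 1` this is the statement that a complex with
a filtration is acyclic if its subquotients are. -/
theorem exists_boundary_of_triangular {V J : Type*} [AddCommGroup V] [Module R V]
    (D : (J →₀ V) →ₗ[R] (J →₀ V)) (δ : J → V →ₗ[R] V) (level : J → ℕ) (t : R)
    (hD : ∀ z, D (D z) = 0)
    (htri : ∀ j v i, level j ≤ level i →
      D (Finsupp.single j v) i = (Finsupp.single j (δ j v) : J →₀ V) i)
    (hδ : ∀ j v, δ j v = 0 → ∃ u, δ j u = t • v) (n : ℕ) (z : J →₀ V)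
    (hz : ∀ j, n ≤ level j → z j = 0) (hDz : D z = 0) : ∃ u, D u = t ^ n • z := by
  classical
  induction n generalizing z with
  | zero =>
    have : z = 0 := Finsupp.ext fun j => hz j (Nat.zero_le _)
    exact ⟨0, by simp [this]⟩
  | succ n ih =>
    have key : ∀ y : J →₀ V, (∀ j, n + 1 ≤ level j → y j = 0) → ∀ i, n ≤ level i →
        D y i = δ i (y i) := by
      intro y hy i hi
      conv_lhs => rw [← Finsupp.sum_single y]
      rw [Finsupp.sum, map_sum, Finsupp.finsetSum_apply]
      have : ∀ j ∈ y.support, D (Finsupp.single j (y j)) i =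
          (Finsupp.single j (δ j (y j)) : J →₀ V) i := by
        intro j hj
        apply htri
        by_contra hlt
        exact Finsupp.mem_support_iff.1 hj (hy j (by omega))
      rw [Finset.sum_congr rfl this, Finset.sum_eq_single i]
      · simp
      · intro j _ hj
        exact Finsupp.single_eq_of_ne hj.symm
      · intro hi
        rw [Finsupp.notMem_support_iff.1 hi]; simp
    have hc : ∀ j, n ≤ level j → δ j (z j) = 0 := fun j hj => by rw [← key z hz j hj, hDz]; rfl
    have hu : ∀ j, ∃ u, n ≤ level j → δ j u = t • z j := fun j => by
      by_cases hj : n ≤ level j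
      · obtain ⟨u, hu⟩ := hδ j _ (hc j hj)
        exact ⟨u, fun _ => hu⟩
      · exact ⟨0, fun h => absurd h hj⟩
    choose u hu using hu
    let y : J →₀ V := Finsupp.onFinset (z.support.filter fun j => n ≤ level j)
      (fun j => if z j ≠ 0 ∧ n ≤ level j then u j else 0) (by
        intro j hj
        have := (ite_ne_right_iff.1 hj).1
        simpa using this)
    have hy : ∀ j, n + 1 ≤ level j → y j = 0 := fun j hj => by
      simp [y, hz j hj]
    have hy' : ∀ j, n ≤ level j → δ j (y j) = t • z j := fun j hj => by
      by_cases h0 : z j = 0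
      · simp [y, h0]
      · simp [y, h0, hj, hu j hj]
    obtain ⟨x, hx⟩ := ih (t • z - D y) (fun j hj => by
      rw [Finsupp.sub_apply, key y hy j hj, hy' j hj, Finsupp.smul_apply, sub_self])
      (by rw [map_sub, map_smul, hDz, hD, smul_zero, sub_zero])
    refine ⟨x + t ^ n • y, ?_⟩
    rw [map_add, map_smul, hx, smul_sub, sub_add_cancel, ← mul_smul, pow_succ]

section Tensor

/-- The differential `x ⊗ y ↦ dx ⊗ y + σx ⊗ dy` of a tensor product, where `σ` is the sign operator
of the left factor. -/
def tensorD {X Y : Type*} [AddCommGroup X] [Module R X] [AddCommGroup Y] [Module R Y]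
    (d σ : X →ₗ[R] X) (dY : Y →ₗ[R] Y) : X ⊗[R] Y →ₗ[R] X ⊗[R] Y :=
  TensorProduct.map d LinearMap.id + TensorProduct.map σ dY

theorem tensorD_tmul {X Y : Type*} [AddCommGroup X] [Module R X] [AddCommGroup Y] [Module R Y]
    (d σ : X →ₗ[R] X) (dY : Y →ₗ[R] Y) (x : X) (y : Y) :
    tensorD d σ dY (x ⊗ₜ y) = d x ⊗ₜ y + σ x ⊗ₜ dY y := rfl

variable {V Y J : Type*} [AddCommGroup V] [Module R V] [AddCommGroup Y] [Module R Y]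

theorem exists_level_bound (level : J → ℕ) (z : J →₀ V) : ∃ n, ∀ j, n ≤ level j → z j = 0 := by
  refine ⟨z.support.sup level + 1, fun j hj => ?_⟩
  by_contra h
  have := Finset.le_sup (f := level) (Finsupp.mem_support_iff.2 h)
  omega

/-- Tensoring on the right with a module having a triangular basis preserves the property that `t`
kills homology, up to replacing `t` by a power. -/
theorem exists_boundary_tensor_right (d σ : V →ₗ[R] V) (dY : Y →ₗ[R] Y)
    (b : Module.Basis J R Y) (level : J → ℕ) (t : R)
    (hd : ∀ v, d (d v) = 0) (hσ : ∀ v, σ (d v) = - d (σ v)) (hdY : ∀ y, dY (dY y) = 0)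
    (htri : ∀ j i, level j ≤ level i → b.repr (dY (b j)) i = 0)
    (hV : ∀ v, d v = 0 → ∃ u, d u = t • v) (z : V ⊗[R] Y)
    (hz : tensorD d σ dY z = 0) :
    ∃ n u, tensorD d σ dY u = t ^ n • z := by
  classical
  set E := tensorD d σ dY
  let e := TensorProduct.equivFinsuppOfBasisRight (M := V) b
  have hE : ∀ z, E (E z) = 0 := by
    intro z
    induction z using TensorProduct.induction_on with
    | zero => simp
    | add x y hx hy => rw [map_add, map_add, hx, hy, add_zero]
    | tmul x y => simp [E, tensorD_tmul, hd, hdY, hσ, TensorProduct.neg_tmul]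
  have hs : ∀ j v, e.symm (Finsupp.single j v) = v ⊗ₜ b j := by
    intro j v
    rw [LinearEquiv.symm_apply_eq, TensorProduct.equivFinsuppOfBasisRight_apply_tmul]
    ext i
    by_cases h : j = i <;> simp [h]
  obtain ⟨n, hn⟩ := exists_level_bound level (e z)
  obtain ⟨u, hu⟩ := exists_boundary_of_triangular (e.toLinearMap ∘ₗ E ∘ₗ e.symm.toLinearMap)
    (fun _ => d) level t (fun z => by simp [hE]) (fun j v i hji => by
      simp only [LinearMap.comp_apply, LinearEquiv.coe_coe, hs]
      simp only [E, tensorD_tmul, map_add,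
        Finsupp.add_apply, e, TensorProduct.equivFinsuppOfBasisRight_apply_tmul_apply,
        htri j i hji, zero_smul, add_zero]
      by_cases h : j = i <;> simp [h]) (fun _ => hV) n (e z) hn (by simp [hz])
  refine ⟨n, e.symm u, e.injective ?_⟩
  simpa using hu

/-- Tensoring on the left with a module having a triangular basis preserves the property that `t`
kills homology, up to replacing `t` by a power. -/
theorem exists_boundary_tensor_left (d : V →ₗ[R] V) (dY σ : Y →ₗ[R] Y)
    (b : Module.Basis J R Y) (level : J → ℕ) (t : R)
    (hd : ∀ v, d (d v) = 0) (hσ : ∀ y, σ (dY y) = - dY (σ y)) (hdY : ∀ y, dY (dY y) = 0)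
    (htri : ∀ j i, level j ≤ level i → b.repr (dY (b j)) i = 0)
    (hb : ∀ j, ∃ ε : R, ε * ε = 1 ∧ σ (b j) = ε • b j)
    (hV : ∀ v, d v = 0 → ∃ u, d u = t • v) (z : Y ⊗[R] V)
    (hz : tensorD dY σ d z = 0) :
    ∃ n u, tensorD dY σ d u = t ^ n • z := by
  classical
  choose ε hε hb using hb
  set E := tensorD dY σ d
  let e := TensorProduct.equivFinsuppOfBasisLeft (N := V) b
  have hE : ∀ z, E (E z) = 0 := by
    intro z
    induction z using TensorProduct.induction_on with
    | zero => simp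
    | add x y hx hy => rw [map_add, map_add, hx, hy, add_zero]
    | tmul x y => simp [E, tensorD_tmul, hd, hdY, hσ, TensorProduct.neg_tmul]
  have hs : ∀ j v, e.symm (Finsupp.single j v) = b j ⊗ₜ v := by
    intro j v
    rw [LinearEquiv.symm_apply_eq, TensorProduct.equivFinsuppOfBasisLeft_apply_tmul]
    ext i
    by_cases h : j = i <;> simp [h]
  obtain ⟨n, hn⟩ := exists_level_bound level (e z)
  obtain ⟨u, hu⟩ := exists_boundary_of_triangular (e.toLinearMap ∘ₗ E ∘ₗ e.symm.toLinearMap)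
    (fun j => ε j • d) level t (fun z => by simp [hE]) (fun j v i hji => by
      simp only [LinearMap.comp_apply, LinearEquiv.coe_coe, hs]
      simp only [E, tensorD_tmul, map_add,
        Finsupp.add_apply, e, TensorProduct.equivFinsuppOfBasisLeft_apply_tmul_apply,
        htri j i hji, zero_smul, zero_add, hb, LinearMap.smul_apply]
      by_cases h : j = i <;> simp [h]) (fun j v hv => by
      have hv' : d v = 0 := by
        have := congrArg (ε j • ·) hv
        simpa [← mul_smul, hε] using this
      obtain ⟨u, hu⟩ := hV v hv'
      exact ⟨ε j • u, by simp [hu, ← mul_smul, ← mul_assoc, hε]⟩) n (e z) hn (by simp [hz])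
  refine ⟨n, e.symm u, e.injective ?_⟩
  simpa using hu

end Tensor

/-- The mapping cone of a map `f` of differential modules, as a module with a differential. -/
def coneDiff {X X' : Type*} [AddCommGroup X] [Module R X] [AddCommGroup X'] [Module R X']
    (d : X →ₗ[R] X) (d' : X' →ₗ[R] X') (f : X →ₗ[R] X') : X × X' →ₗ[R] X × X' :=
  (d ∘ₗ LinearMap.fst R X X').prod (f ∘ₗ LinearMap.fst R X X' - d' ∘ₗ LinearMap.snd R X X')

/-- The sign operator of the mapping cone. -/
def coneSgn {X X' : Type*} [AddCommGroup X] [Module R X] [AddCommGroup X'] [Module R X']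
    (σ : X →ₗ[R] X) (σ' : X' →ₗ[R] X') : X × X' →ₗ[R] X × X' :=
  (σ ∘ₗ LinearMap.fst R X X').prod (- (σ' ∘ₗ LinearMap.snd R X X'))

theorem coneDiff_apply {X X' : Type*} [AddCommGroup X] [Module R X] [AddCommGroup X'] [Module R X']
    (d : X →ₗ[R] X) (d' : X' →ₗ[R] X') (f : X →ₗ[R] X') (v : X × X') :
    coneDiff d d' f v = (d v.1, f v.1 - d' v.2) := rfl

theorem coneSgn_apply {X X' : Type*} [AddCommGroup X] [Module R X] [AddCommGroup X'] [Module R X']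
    (σ : X →ₗ[R] X) (σ' : X' →ₗ[R] X') (v : X × X') : coneSgn σ σ' v = (σ v.1, - σ' v.2) := rfl

section ConeTensor

variable {X X' Y J : Type*} [AddCommGroup X] [Module R X] [AddCommGroup X'] [Module R X']
  [AddCommGroup Y] [Module R Y]

/-- Tensoring on the right with a module having a triangular basis preserves quasi-isomorphisms,
which are described here by the acyclicity of their mapping cones. -/
theorem cone_acyclic_tensor_right (d σ : X →ₗ[R] X) (d' σ' : X' →ₗ[R] X') (f : X →ₗ[R] X')
    (dY : Y →ₗ[R] Y) (b : Module.Basis J R Y) (level : J → ℕ)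
    (hd : ∀ v, d (d v) = 0) (hσ : ∀ v, σ (d v) = - d (σ v))
    (hd' : ∀ v, d' (d' v) = 0) (hσ' : ∀ v, σ' (d' v) = - d' (σ' v))
    (hfd : ∀ v, f (d v) = d' (f v)) (hfσ : ∀ v, f (σ v) = σ' (f v))
    (hdY : ∀ y, dY (dY y) = 0)
    (htri : ∀ j i, level j ≤ level i → b.repr (dY (b j)) i = 0)
    (hf : ∀ x y, d x = 0 → f x = d' y → ∃ x1 y1, d x1 = x ∧ y - f x1 = d' y1)
    (x : X ⊗[R] Y) (y : X' ⊗[R] Y)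
    (hx : tensorD d σ dY x = 0)
    (hxy : TensorProduct.map f LinearMap.id x =
      tensorD d' σ' dY y) :
    ∃ x1 y1, tensorD d σ dY x1 = x ∧
      y - TensorProduct.map f LinearMap.id x1 =
        tensorD d' σ' dY y1 := by
  set D := tensorD d σ dY with hD
  set D' := tensorD d' σ' dY with hD'
  set E := tensorD (coneDiff d d' f) (coneSgn σ σ') dY with hE
  let i1 : X ⊗[R] Y →ₗ[R] (X × X') ⊗[R] Y := TensorProduct.map (LinearMap.inl R X X') LinearMap.id
  let i2 : X' ⊗[R] Y →ₗ[R] (X × X') ⊗[R] Y := TensorProduct.map (LinearMap.inr R X X') LinearMap.id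
  let p1 : (X × X') ⊗[R] Y →ₗ[R] X ⊗[R] Y := TensorProduct.map (LinearMap.fst R X X') LinearMap.id
  let p2 : (X × X') ⊗[R] Y →ₗ[R] X' ⊗[R] Y := TensorProduct.map (LinearMap.snd R X X') LinearMap.id
  have h1 : ∀ z, E (i1 z) = i1 (D z) + i2 (TensorProduct.map f LinearMap.id z) :=
    LinearMap.congr_fun (show E ∘ₗ i1 = i1 ∘ₗ D + i2 ∘ₗ TensorProduct.map f LinearMap.id from
      TensorProduct.ext' fun x y => by
        simp only [LinearMap.comp_apply, LinearMap.add_apply, tensorD_tmul, hE, hD, i1, i2,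
          coneDiff_apply, coneSgn_apply,
          TensorProduct.map_tmul, LinearMap.id_apply, map_add, LinearMap.inl_apply,
          LinearMap.inr_apply, map_zero, neg_zero, sub_zero]
        rw [add_right_comm, ← TensorProduct.add_tmul, Prod.mk_add_mk, add_zero, zero_add])
  have h2 : ∀ z, E (i2 z) = - i2 (D' z) :=
    LinearMap.congr_fun (show E ∘ₗ i2 = - (i2 ∘ₗ D') from
      TensorProduct.ext' fun x y => by
        simp only [LinearMap.comp_apply, tensorD_tmul, hE, hD', i2, coneDiff_apply, coneSgn_apply,
          TensorProduct.map_tmul, LinearMap.id_apply, map_add,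
          LinearMap.inr_apply, map_zero, zero_sub, LinearMap.neg_apply, neg_add]
        simp [← TensorProduct.neg_tmul])
  have h3 : ∀ z, p1 (E z) = D (p1 z) :=
    LinearMap.congr_fun (show p1 ∘ₗ E = D ∘ₗ p1 from TensorProduct.ext' fun x y => rfl)
  have h4 : ∀ z, p2 (E z) = TensorProduct.map f LinearMap.id (p1 z) - D' (p2 z) :=
    LinearMap.congr_fun (show p2 ∘ₗ E = TensorProduct.map f LinearMap.id ∘ₗ p1 - D' ∘ₗ p2 from
      TensorProduct.ext' fun x y => by
        simp only [LinearMap.comp_apply, tensorD_tmul, hE, hD', p1, p2, coneDiff_apply,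
          coneSgn_apply,
          TensorProduct.map_tmul, LinearMap.id_apply, map_add,
          LinearMap.fst_apply, LinearMap.snd_apply, LinearMap.sub_apply, TensorProduct.sub_tmul,
          TensorProduct.neg_tmul]
        abel)
  have h5 : ∀ z, p1 (i1 z) = z := LinearMap.congr_fun (show p1 ∘ₗ i1 = LinearMap.id from
    TensorProduct.ext' fun x y => rfl)
  have h6 : ∀ z, p2 (i2 z) = z := LinearMap.congr_fun (show p2 ∘ₗ i2 = LinearMap.id from
    TensorProduct.ext' fun x y => rfl)
  have h7 : ∀ z, p1 (i2 z) = 0 := LinearMap.congr_fun (show p1 ∘ₗ i2 = 0 from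
    TensorProduct.ext' fun x y => by simp [p1, i2])
  have h8 : ∀ z, p2 (i1 z) = 0 := LinearMap.congr_fun (show p2 ∘ₗ i1 = 0 from
    TensorProduct.ext' fun x y => by simp [p2, i1])
  obtain ⟨n, u, hu⟩ := exists_boundary_tensor_right (coneDiff d d' f) (coneSgn σ σ') dY b level 1
    (by rintro ⟨v, v'⟩; simp [coneDiff_apply, hd, hd', hfd])
    (by rintro ⟨v, v'⟩; simp [coneDiff_apply, coneSgn_apply, hσ, hσ', hfσ]) hdY htri
    (by
      rintro ⟨v, v'⟩ hv
      rw [coneDiff_apply, Prod.mk_eq_zero] at hv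
      obtain ⟨x1, y1, e1, e2⟩ := hf v v' hv.1 (sub_eq_zero.1 hv.2)
      refine ⟨(x1, - y1), ?_⟩
      simp [coneDiff_apply, e1, ← e2])
    (i1 x + i2 y) (by rw [← hE, map_add, h1, h2, hx, hxy, map_zero]; simp)
  rw [← hE, one_pow, one_smul] at hu
  refine ⟨p1 u, - p2 u, ?_, ?_⟩
  · rw [← h3, hu, map_add, h5, h7, add_zero]
  · have := h4 u
    rw [hu, map_add, h8, h6, zero_add] at this
    rw [this, map_neg]; abel

/-- Tensoring on the left with a module having a triangular basis preserves quasi-isomorphisms. -/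
theorem cone_acyclic_tensor_left (d : X →ₗ[R] X) (d' : X' →ₗ[R] X') (f : X →ₗ[R] X')
    (dY σ : Y →ₗ[R] Y) (b : Module.Basis J R Y) (level : J → ℕ)
    (hd : ∀ v, d (d v) = 0) (hσ : ∀ v, σ (dY v) = - dY (σ v)) (hσσ : ∀ v, σ (σ v) = v)
    (hd' : ∀ v, d' (d' v) = 0) (hfd : ∀ v, f (d v) = d' (f v))
    (hdY : ∀ y, dY (dY y) = 0)
    (htri : ∀ j i, level j ≤ level i → b.repr (dY (b j)) i = 0)
    (hb : ∀ j, ∃ ε : R, ε * ε = 1 ∧ σ (b j) = ε • b j)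
    (hf : ∀ x y, d x = 0 → f x = d' y → ∃ x1 y1, d x1 = x ∧ y - f x1 = d' y1)
    (x : Y ⊗[R] X) (y : Y ⊗[R] X')
    (hx : tensorD dY σ d x = 0)
    (hxy : TensorProduct.map LinearMap.id f x =
      tensorD dY σ d' y) :
    ∃ x1 y1, tensorD dY σ d x1 = x ∧
      y - TensorProduct.map LinearMap.id f x1 =
        tensorD dY σ d' y1 := by
  set D := tensorD dY σ d with hD
  set D' := tensorD dY σ d' with hD'
  set E := tensorD dY σ (coneDiff d d' f) with hE
  let i1 : Y ⊗[R] X →ₗ[R] Y ⊗[R] (X × X') := TensorProduct.map LinearMap.id (LinearMap.inl R X X')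
  let i2 : Y ⊗[R] X' →ₗ[R] Y ⊗[R] (X × X') := TensorProduct.map σ (LinearMap.inr R X X')
  let p1 : Y ⊗[R] (X × X') →ₗ[R] Y ⊗[R] X := TensorProduct.map LinearMap.id (LinearMap.fst R X X')
  let p2 : Y ⊗[R] (X × X') →ₗ[R] Y ⊗[R] X' := TensorProduct.map σ (LinearMap.snd R X X')
  have h1 : ∀ z, E (i1 z) = i1 (D z) + i2 (TensorProduct.map LinearMap.id f z) :=
    LinearMap.congr_fun (show E ∘ₗ i1 = i1 ∘ₗ D + i2 ∘ₗ TensorProduct.map LinearMap.id f from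
      TensorProduct.ext' fun y x => by
        simp only [LinearMap.comp_apply, LinearMap.add_apply, tensorD_tmul, hE, hD, i1, i2,
          coneDiff_apply,
          TensorProduct.map_tmul, LinearMap.id_apply, map_add, LinearMap.inl_apply,
          LinearMap.inr_apply, map_zero, sub_zero]
        rw [add_assoc, ← TensorProduct.tmul_add, Prod.mk_add_mk, add_zero, zero_add])
  have h2 : ∀ z, E (i2 z) = - i2 (D' z) :=
    LinearMap.congr_fun (show E ∘ₗ i2 = - (i2 ∘ₗ D') from
      TensorProduct.ext' fun y x => by
        simp only [LinearMap.comp_apply, tensorD_tmul, hE, hD', i2, coneDiff_apply, hσ,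
          TensorProduct.map_tmul, map_add, LinearMap.neg_apply,
          LinearMap.inr_apply, map_zero, zero_sub, LinearMap.neg_apply, neg_add,
          neg_neg, TensorProduct.neg_tmul]
        simp [← TensorProduct.tmul_neg])
  have h3 : ∀ z, p1 (E z) = D (p1 z) :=
    LinearMap.congr_fun (show p1 ∘ₗ E = D ∘ₗ p1 from TensorProduct.ext' fun x y => rfl)
  have h4 : ∀ z, p2 (E z) = TensorProduct.map LinearMap.id f (p1 z) - D' (p2 z) :=
    LinearMap.congr_fun (show p2 ∘ₗ E = TensorProduct.map LinearMap.id f ∘ₗ p1 - D' ∘ₗ p2 from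
      TensorProduct.ext' fun y x => by
        simp only [LinearMap.comp_apply, tensorD_tmul, hE, hD', p1, p2, coneDiff_apply, hσ, hσσ,
          TensorProduct.map_tmul, LinearMap.id_apply, map_add,
          LinearMap.fst_apply, LinearMap.snd_apply, LinearMap.sub_apply,
          TensorProduct.tmul_sub, TensorProduct.neg_tmul]
        abel)
  have h5 : ∀ z, p1 (i1 z) = z := LinearMap.congr_fun (show p1 ∘ₗ i1 = LinearMap.id from
    TensorProduct.ext' fun x y => rfl)
  have h6 : ∀ z, p2 (i2 z) = z := LinearMap.congr_fun (show p2 ∘ₗ i2 = LinearMap.id from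
    TensorProduct.ext' fun x y => by simp [p2, i2, hσσ])
  have h7 : ∀ z, p1 (i2 z) = 0 := LinearMap.congr_fun (show p1 ∘ₗ i2 = 0 from
    TensorProduct.ext' fun x y => by simp [p1, i2])
  have h8 : ∀ z, p2 (i1 z) = 0 := LinearMap.congr_fun (show p2 ∘ₗ i1 = 0 from
    TensorProduct.ext' fun x y => by simp [p2, i1])
  obtain ⟨n, u, hu⟩ := exists_boundary_tensor_left (coneDiff d d' f) dY σ b level 1
    (by rintro ⟨v, v'⟩; simp [coneDiff_apply, hd, hd', hfd]) hσ hdY htri hb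
    (by
      rintro ⟨v, v'⟩ hv
      rw [coneDiff_apply, Prod.mk_eq_zero] at hv
      obtain ⟨x1, y1, e1, e2⟩ := hf v v' hv.1 (sub_eq_zero.1 hv.2)
      refine ⟨(x1, - y1), ?_⟩
      simp [coneDiff_apply, e1, ← e2])
    (i1 x + i2 y) (by rw [← hE, map_add, h1, h2, hx, hxy, map_zero]; simp)
  rw [← hE, one_pow, one_smul] at hu
  refine ⟨p1 u, - p2 u, ?_, ?_⟩
  · rw [← h3, hu, map_add, h5, h7, add_zero]
  · have := h4 u
    rw [hu, map_add, h8, h6, zero_add] at this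
    rw [this, map_neg]; abel

end ConeTensor

/-- Linear maps out of a module with a basis can be constructed level by level. -/
theorem exists_linearMap_of_level {F X J : Type*} [AddCommGroup F] [Module R F] [AddCommGroup X]
    [Module R X] (b : Module.Basis J R F) (level : J → ℕ) (G : J → (F →ₗ[R] X) → Prop)
    (hcongr : ∀ j (φ φ' : F →ₗ[R] X), (∀ i, level i ≤ level j → φ (b i) = φ' (b i)) →
      G j φ → G j φ')
    (hstep : ∀ n (φ : F →ₗ[R] X), (∀ i, level i < n → G i φ) →
      ∃ φ' : F →ₗ[R] X, (∀ i, level i < n → φ' (b i) = φ (b i)) ∧ ∀ i, level i = n → G i φ') :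
    ∃ φ : F →ₗ[R] X, ∀ j, G j φ := by
  choose! next h1 h2 using hstep
  have hgood : ∀ n φ, (∀ i, level i < n → G i φ) → ∀ i, level i < n + 1 → G i (next n φ) := by
    intro n φ h i hi
    rcases Nat.lt_succ_iff_lt_or_eq.1 hi with hi | hi
    · exact hcongr i φ _ (fun j hj => (h1 n φ h j (by omega)).symm) (h i hi)
    · exact h2 n φ h i hi
  let s : ∀ n : ℕ, {φ : F →ₗ[R] X // ∀ i, level i < n → G i φ} := fun n =>
    Nat.rec ⟨0, fun i hi => absurd hi (Nat.not_lt_zero _)⟩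
      (fun n φ => ⟨next n φ.1, hgood n φ.1 φ.2⟩) n
  have hs : ∀ n i, level i < n → (s (n + 1)).1 (b i) = (s n).1 (b i) :=
    fun n i hi => h1 n (s n).1 (s n).2 i hi
  have hs' : ∀ m n i, level i < n → (s (n + m)).1 (b i) = (s n).1 (b i) := by
    intro m n i hi
    induction m with
    | zero => rfl
    | succ m ih => rw [← add_assoc, hs _ i (by omega), ih]
  refine ⟨b.constr R fun j => (s (level j + 1)).1 (b j), fun j => ?_⟩
  refine hcongr j (s (level j + 1)).1 _ (fun i hi => ?_) ((s (level j + 1)).2 j (by omega))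
  rw [Module.Basis.constr_basis]
  obtain ⟨m, hm⟩ := Nat.exists_eq_add_of_le (Nat.succ_le_succ hi)
  rw [Nat.succ_eq_add_one, Nat.succ_eq_add_one] at hm
  rw [hm, hs' m (level i + 1) i (by omega)]

end Triangular

namespace DGModule

/-! ### Quasi-isomorphisms and semifree modules -/

section QuasiIso

variable {k A : Type u} [Field k] [Ring A] [Algebra k A] {𝒜 : ℤ → Submodule k A} [GradedAlgebra 𝒜]
  {M N L : DGModule 𝒜}

/-- The class of a cycle in homology. -/
def homologyClass (M : DGModule 𝒜) (x : M.carrier) (hx : M.diff x = 0) : M.Homology :=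
  (M.boundaries.submoduleOf M.cycles).mkQ ⟨x, hx⟩

theorem homologyClass_eq_zero {x : M.carrier} {hx : M.diff x = 0} :
    M.homologyClass x hx = 0 ↔ ∃ y, M.diff y = x :=
  Submodule.Quotient.mk_eq_zero _

theorem exists_homologyClass (z : M.Homology) : ∃ x hx, M.homologyClass x hx = z := by
  obtain ⟨⟨x, hx⟩, rfl⟩ := Submodule.mkQ_surjective _ z
  exact ⟨x, hx, rfl⟩

theorem smul_mem_cycles (M : DGModule 𝒜) (a : A) {x : M.carrier} (hx : M.diff x = 0) :
    M.diff (a • x) = 0 := M.cycles.smul_mem a hx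

theorem smul_homologyClass (a : A) (x : M.carrier) (hx : M.diff x = 0) :
    a • M.homologyClass x hx = M.homologyClass (a • x) (M.smul_mem_cycles a hx) := rfl

theorem homologyClass_sub (x y : M.carrier) (hx : M.diff x = 0) (hy : M.diff y = 0) :
    M.homologyClass x hx - M.homologyClass y hy =
      M.homologyClass (x - y) (by rw [map_sub, hx, hy, sub_zero]) := rfl

theorem Hom.diff_eq_zero (f : Hom M N) {x : M.carrier} (hx : M.diff x = 0) :
    N.diff (f.toLin x) = 0 := by rw [← f.map_diff, hx, map_zero]

theorem Hom.mapHomology_class (f : Hom M N) (x : M.carrier) (hx : M.diff x = 0) :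
    f.mapHomology (M.homologyClass x hx) = N.homologyClass (f.toLin x) (f.diff_eq_zero hx) := rfl

/-- A morphism is a quasi-isomorphism if and only if its mapping cone is acyclic. -/
theorem quasiIso_iff (f : Hom M N) : quasiIso 𝒜 (X := M) (Y := N) f ↔
    ∀ x y, M.diff x = 0 → f.toLin x = N.diff y →
      ∃ x1 y1, M.diff x1 = x ∧ y - f.toLin x1 = N.diff y1 := by
  constructor
  · rintro ⟨hi, hs⟩ x y hx hxy
    have h0 : M.homologyClass x hx = 0 := by
      apply hi
      rw [map_zero, f.mapHomology_class, homologyClass_eq_zero]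
      exact ⟨y, hxy.symm⟩
    obtain ⟨x2, rfl⟩ := homologyClass_eq_zero.1 h0
    have hc : N.diff (y - f.toLin x2) = 0 := by rw [map_sub, ← f.map_diff, ← hxy, sub_self]
    obtain ⟨z, hz⟩ := hs (N.homologyClass _ hc)
    obtain ⟨z, hdz, rfl⟩ := exists_homologyClass z
    rw [f.mapHomology_class, eq_comm, ← sub_eq_zero, homologyClass_sub,
      homologyClass_eq_zero] at hz
    obtain ⟨y1, hy1⟩ := hz
    exact ⟨x2 + z, y1, by rw [map_add, hdz, add_zero], by rw [hy1, map_add]; abel⟩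
  · intro h
    constructor
    · refine (injective_iff_map_eq_zero f.mapHomology).2 fun z hz => ?_
      obtain ⟨x, hx, rfl⟩ := exists_homologyClass z
      rw [f.mapHomology_class, homologyClass_eq_zero] at hz
      obtain ⟨y, hy⟩ := hz
      obtain ⟨x1, -, h1, -⟩ := h x y hx hy.symm
      exact homologyClass_eq_zero.2 ⟨x1, h1⟩
    · intro z
      obtain ⟨y, hy, rfl⟩ := exists_homologyClass z
      obtain ⟨x1, y1, h1, h2⟩ := h 0 y (map_zero _) (by rw [map_zero, hy])
      refine ⟨M.homologyClass x1 h1, ?_⟩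
      rw [f.mapHomology_class, eq_comm, ← sub_eq_zero, homologyClass_sub, homologyClass_eq_zero]
      exact ⟨y1, h2.symm⟩

/-- The composition of morphisms. -/
def Hom.comp (g : Hom N L) (f : Hom M N) : Hom M L :=
  ⟨g.toLin ∘ₗ f.toLin, fun h => g.map_mem (f.map_mem h), fun x => by
    rw [LinearMap.comp_apply, LinearMap.comp_apply, f.map_diff, g.map_diff]⟩

theorem Hom.mapHomology_comp (g : Hom N L) (f : Hom M N) (z : M.Homology) :
    (g.comp f).mapHomology z = g.mapHomology (f.mapHomology z) := by
  obtain ⟨x, hx, rfl⟩ := exists_homologyClass z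
  rfl

theorem quasiIso_comp {g : Hom N L} {f : Hom M N} (hg : quasiIso 𝒜 (X := N) (Y := L) g)
    (hf : quasiIso 𝒜 (X := M) (Y := N) f) : quasiIso 𝒜 (X := M) (Y := L) (g.comp f) := by
  have : ⇑(g.comp f).mapHomology = g.mapHomology ∘ f.mapHomology :=
    funext fun z => Hom.mapHomology_comp g f z
  show Function.Bijective (g.comp f).mapHomology
  rw [this]
  exact Function.Bijective.comp hg hf

/-- If `g ∘ f` and `g` are quasi-isomorphisms, then so is `f`. -/
theorem quasiIso_of_comp_left {g : Hom N L} {f : Hom M N} (hg : quasiIso 𝒜 (X := N) (Y := L) g)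
    (hgf : quasiIso 𝒜 (X := M) (Y := L) (g.comp f)) : quasiIso 𝒜 (X := M) (Y := N) f := by
  have : ⇑(g.comp f).mapHomology = g.mapHomology ∘ f.mapHomology :=
    funext fun z => Hom.mapHomology_comp g f z
  have h : Function.Bijective (g.comp f).mapHomology := hgf
  rw [this] at h
  exact (Function.Bijective.of_comp_iff' hg _).1 h

theorem quasiIso_of_bijective (f : Hom M N) (hf : Function.Bijective f.toLin) :
    quasiIso 𝒜 (X := M) (Y := N) f := by
  rw [quasiIso_iff]
  intro x y hx hxy
  obtain ⟨x1, rfl⟩ := hf.2 y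
  refine ⟨x1, 0, ?_, by simp⟩
  apply hf.1
  rw [hxy, f.map_diff]

theorem Hom.map_component (f : Hom M N) (n : ℤ) (x : M.carrier) :
    f.toLin (component M.isInternal n x) = component N.isInternal n (f.toLin x) := by
  have := _root_.map_component M.isInternal N.isInternal f.toLin.toAddMonoidHom 0
    (fun n x hx => by simpa using f.map_mem hx) n x
  simpa using this

theorem diff_component (M : DGModule 𝒜) (n : ℤ) (x : M.carrier) :
    M.diff (component M.isInternal n x) = component M.isInternal (n - 1) (M.diff x) :=
  _root_.map_component M.isInternal M.isInternal M.diff.toAddMonoidHom (-1)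
    (fun _ _ hx => M.diff_mem hx) n x

theorem Hom.map_sgn (f : Hom M N) (x : M.carrier) : f.toLin (M.sgn x) = N.sgn (f.toLin x) := by
  induction x using homogeneous_induction M.isInternal with
  | hom n x hx =>
    rw [sgn, sgn, signMap_of_mem _ hx, signMap_of_mem _ (f.map_mem hx), map_zsmul]
  | add x y hx hy => simp only [map_add, hx, hy]

/-- The inverse of a bijective morphism. -/
def Hom.inverse (f : Hom M N) (hf : Function.Bijective f.toLin) : Hom N M where
  toLin := (LinearEquiv.ofBijective f.toLin hf).symm.toLinearMap
  map_mem {n y} hy := by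
    obtain ⟨x, rfl⟩ := hf.2 y
    have : (LinearEquiv.ofBijective f.toLin hf).symm (f.toLin x) = x :=
      (LinearEquiv.ofBijective f.toLin hf).symm_apply_apply x
    rw [LinearEquiv.coe_coe, this]
    have h : component M.isInternal n x = x :=
      hf.1 (by rw [f.map_component, component_of_mem _ hy])
    rw [← h]; exact component_mem _ _ _
  map_diff y := by
    obtain ⟨x, rfl⟩ := hf.2 y
    rw [LinearEquiv.coe_coe, ← f.map_diff]
    have h : ∀ x, (LinearEquiv.ofBijective f.toLin hf).symm (f.toLin x) = x :=
      (LinearEquiv.ofBijective f.toLin hf).symm_apply_apply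
    rw [h, h]

theorem Hom.inverse_bijective (f : Hom M N) (hf : Function.Bijective f.toLin) :
    Function.Bijective (f.inverse hf).toLin :=
  (LinearEquiv.ofBijective f.toLin hf).symm.bijective

end QuasiIso

section Semifree

variable {k A : Type u} [Field k] [Ring A] [Algebra k A] {𝒜 : ℤ → Submodule k A} [GradedAlgebra 𝒜]

/-- A homogeneous basis is triangular if the differential of a basis element only involves basis
elements of smaller level. -/
structure TriangularBasis (F : DGModule 𝒜) (J : Type u) where
  /-- The basis. -/
  basis : Module.Basis J A F.carrier
  /-- The degrees of the basis elements. -/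
  deg : J → ℤ
  /-- The levels of the basis elements. -/
  level : J → ℕ
  basis_mem : ∀ j, basis j ∈ F.gr (deg j)
  repr_diff : ∀ j i, level j ≤ level i → basis.repr (F.diff (basis j)) i = 0

theorem IsSemifree.exists_triangularBasis {F : DGModule 𝒜} (hF : F.IsSemifree) :
    ∃ J, Nonempty (F.TriangularBasis J) := by
  obtain ⟨J, b, level, hdeg, h⟩ := hF
  choose deg hdeg using hdeg
  refine ⟨J, ⟨⟨b, deg, level, hdeg, fun j i hji => ?_⟩⟩⟩
  by_contra hne
  have := b.repr_support_subset_of_mem_span _ (h j) (Finsupp.mem_support_iff.2 hne)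
  have h' : level i < level j := this
  omega

theorem TriangularBasis.isSemifree {F : DGModule 𝒜} {J : Type u} (T : F.TriangularBasis J) :
    F.IsSemifree := by
  refine ⟨J, T.basis, T.level, fun j => ⟨_, T.basis_mem j⟩, fun j => ?_⟩
  rw [Module.Basis.mem_span_image]
  intro i hi
  by_contra hne
  exact Finsupp.mem_support_iff.1 hi (T.repr_diff j i (not_lt.1 hne))

end Semifree

end DGModule

/-! ### Semifree resolutions and tensor products preserve quasi-isomorphisms -/

namespace DGModule

section SymModules

variable {k : Type u} [Field k] {c : ℕ} {w : OddDegrees c}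

theorem symDiff_apply (X : DGModule (symGr k w)) (x : X.carrier) : X.symDiff x = X.diff x := rfl

theorem symSgn_apply (X : DGModule (symGr k w)) (x : X.carrier) : X.symSgn x = X.sgn x := rfl

theorem diff_smul (X : DGModule (symGr k w)) (s : MvPolynomial (Fin c) k) (x : X.carrier) :
    X.diff (s • x) = s • X.diff x := X.symDiff.map_smul s x

theorem sgn_basis {F : DGModule (symGr k w)} {J : Type u} (T : F.TriangularBasis J) (j : J) :
    ∃ ε : MvPolynomial (Fin c) k, ε * ε = 1 ∧ F.symSgn (T.basis j) = ε • T.basis j := by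
  refine ⟨(((T.deg j).negOnePow : ℤ) : MvPolynomial (Fin c) k), ?_, ?_⟩
  · rw [← Int.cast_mul, ← Units.val_mul, ← Int.negOnePow_add, Int.negOnePow_even _ ⟨_, rfl⟩]
    simp
  · rw [symSgn_apply, sgn, signMap_of_mem _ (T.basis_mem j), Int.cast_smul_eq_zsmul]

namespace TriangularBasis

variable {F X : DGModule (symGr k w)} {J : Type u} (T : F.TriangularBasis J)

/-- Linear maps that agree on the basis elements of smaller level agree on the differential of a
basis element. -/
theorem map_diff_congr {Z : Type*} [AddCommGroup Z] [Module (MvPolynomial (Fin c) k) Z]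
    {φ φ' : F.carrier →ₗ[MvPolynomial (Fin c) k] Z} {j : J}
    (h : ∀ i, T.level i < T.level j → φ (T.basis i) = φ' (T.basis i)) :
    φ (F.diff (T.basis j)) = φ' (F.diff (T.basis j)) := by
  rw [← T.basis.linearCombination_repr (F.diff (T.basis j)), Finsupp.linearCombination_apply,
    Finsupp.sum, map_sum, map_sum]
  refine Finset.sum_congr rfl fun i hi => ?_
  have : T.level i < T.level j := by
    by_contra hne
    exact Finsupp.mem_support_iff.1 hi (T.repr_diff j i (not_lt.1 hne))
  rw [map_smul, map_smul, h i this]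

/-- A linear map that preserves the degrees of the basis elements preserves degrees. -/
theorem map_mem_of_basis_mem (φ : F.carrier →ₗ[MvPolynomial (Fin c) k] X.carrier)
    (h : ∀ j, φ (T.basis j) ∈ X.gr (T.deg j)) {n : ℤ} {x : F.carrier} (hx : x ∈ F.gr n) :
    φ x ∈ X.gr n := by
  have key : ∀ x, φ (component F.isInternal n x) = component X.isInternal n (φ x) := by
    intro x
    rw [← T.basis.linearCombination_repr x]
    induction T.basis.repr x using Finsupp.induction_linear with
    | zero => simp
    | add g g' hg hg' => simp only [map_add, hg, hg']
    | single j s =>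
      rw [Finsupp.linearCombination_single]
      induction s using homogeneous_induction (algebra_isInternal (symGr k w)) with
      | hom i s hs =>
        have h1 := F.smul_mem hs (T.basis_mem j)
        have h2 : φ (s • T.basis j) ∈ X.gr (i + T.deg j) := by
          rw [map_smul]; exact X.smul_mem hs (h j)
        by_cases e : i + T.deg j = n
        · subst e
          rw [component_of_mem _ h1, component_of_mem _ h2]
        · rw [component_of_mem_ne _ h1 e, component_of_mem_ne _ h2 e, map_zero]
      | add s t hs ht => simp only [add_smul, map_add, hs, ht]
  rw [← component_of_mem F.isInternal hx, key]
  exact component_mem _ _ _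

end TriangularBasis

/-- A surjective quasi-isomorphism onto a semifree module has a section. -/
theorem exists_section {Q X : DGModule (symGr k w)} {J : Type u} (T : Q.TriangularBasis J)
    (r : Hom X Q) (hr : quasiIso (symGr k w) (X := X) (Y := Q) r)
    (hsurj : Function.Surjective r.toLin) : ∃ s : Hom Q X, ∀ q, r.toLin (s.toLin q) = q := by
  classical
  obtain ⟨φ, hφ⟩ := exists_linearMap_of_level T.basis T.level
    (fun j (φ : Q.carrier →ₗ[MvPolynomial (Fin c) k] X.carrier) =>
      r.toLin (φ (T.basis j)) = T.basis j ∧ φ (T.basis j) ∈ X.gr (T.deg j) ∧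
        X.diff (φ (T.basis j)) = φ (Q.diff (T.basis j)))
    (by
      intro j φ φ' h hG
      rw [← h j le_rfl, ← T.map_diff_congr (fun i hi => h i hi.le)]
      exact hG)
    (by
      intro n φ hφ
      -- only the values on the basis elements of level less than `n` matter
      let φ0 : Q.carrier →ₗ[MvPolynomial (Fin c) k] X.carrier :=
        T.basis.constr (MvPolynomial (Fin c) k)
          fun i => if T.level i < n then φ (T.basis i) else 0
      have h0 : ∀ i, T.level i < n → φ0 (T.basis i) = φ (T.basis i) := fun i hi => by
        simp [φ0, hi]
      have hmem : ∀ i, φ0 (T.basis i) ∈ X.gr (T.deg i) := fun i => by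
        by_cases hi : T.level i < n
        · rw [h0 i hi]; exact (hφ i hi).2.1
        · simp [φ0, hi]
      have hv : ∀ j, ∃ v, T.level j = n → r.toLin v = T.basis j ∧ v ∈ X.gr (T.deg j) ∧
          X.diff v = φ0 (Q.diff (T.basis j)) := by
        intro j
        by_cases hj : T.level j = n
        swap
        · exact ⟨0, fun h => absurd h hj⟩
        subst hj
        have hd : ∀ i, T.level i < T.level j →
            X.diff (φ0 (T.basis i)) = φ0 (Q.diff (T.basis i)) := fun i hi => by
          rw [h0 i hi, (hφ i hi).2.2]
          exact (T.map_diff_congr fun l hl => h0 l (hl.trans hi)).symm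
        have e1 : r.toLin (φ0 (Q.diff (T.basis j))) = Q.diff (T.basis j) :=
          T.map_diff_congr (φ := r.toLin ∘ₗ φ0) (φ' := LinearMap.id) fun i hi => by
            rw [LinearMap.comp_apply, h0 i hi, (hφ i hi).1, LinearMap.id_apply]
        have e2 : X.diff (φ0 (Q.diff (T.basis j))) = 0 := by
          have := T.map_diff_congr (φ := X.symDiff ∘ₗ φ0) (φ' := φ0 ∘ₗ Q.symDiff)
            (j := j) fun i hi => hd i hi
          simpa [symDiff_apply, Q.diff_diff] using this
        obtain ⟨x1, y1, h1, h2⟩ := (quasiIso_iff r).1 hr _ _ e2 e1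
        obtain ⟨x2, rfl⟩ := hsurj y1
        have hv1 : r.toLin (x1 + X.diff x2) = T.basis j := by
          rw [map_add, r.map_diff, ← h2, add_sub_cancel]
        refine ⟨component X.isInternal (T.deg j) (x1 + X.diff x2), fun _ => ⟨?_, ?_, ?_⟩⟩
        · rw [r.map_component, hv1, component_of_mem _ (T.basis_mem j)]
        · exact component_mem _ _ _
        · rw [X.diff_component, map_add, h1, X.diff_diff, add_zero,
            component_of_mem _ (T.map_mem_of_basis_mem φ0 hmem (Q.diff_mem (T.basis_mem j)))]
      choose v hv using hv
      refine ⟨T.basis.constr (MvPolynomial (Fin c) k)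
          fun i => if T.level i < n then φ (T.basis i) else v i, fun i hi => ?_, fun i hi => ?_⟩
      · simp [hi]
      · have : ∀ l, T.level l < T.level i → (T.basis.constr (MvPolynomial (Fin c) k)
            fun i => if T.level i < n then φ (T.basis i) else v i) (T.basis l) =
              φ0 (T.basis l) := fun l hl => by
          rw [h0 l (by omega)]
          have : T.level l < n := by omega
          simp [this]
        rw [T.map_diff_congr this]
        simpa [hi] using hv i hi)
  refine ⟨⟨φ, fun hx => T.map_mem_of_basis_mem φ (fun j => (hφ j).2.1) hx, fun x => ?_⟩,
    fun q => ?_⟩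
  · exact (LinearMap.congr_fun (T.basis.ext (f₁ := X.symDiff ∘ₗ φ) (f₂ := φ ∘ₗ Q.symDiff)
      fun j => (hφ j).2.2) x).symm
  · exact LinearMap.congr_fun (T.basis.ext (f₁ := r.toLin ∘ₗ φ) (f₂ := LinearMap.id)
      fun j => (hφ j).1) q

section Resolution

variable (Q X : DGModule (symGr k w))

/-- The direct sum of `Q` with the free contractible module on the graded vector space underlying
`X`. -/
def contractibleSum : DGModule (symGr k w) where
  carrier := Q.carrier ×
    ((MvPolynomial (Fin c) k ⊗[k] X.carrier) × (MvPolynomial (Fin c) k ⊗[k] X.carrier))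
  gr n := (Q.gr n).prod ((tensorGr (symGr k w) X.gr n).prod (tensorGr (symGr k w) X.gr (n + 1)))
  isInternal :=
    have h := tensorGr_isInternal (algebra_isInternal (symGr k w)) X.isInternal
    prodGr_isInternal Q.isInternal (prodGr_isInternal h (shiftGr_isInternal h 1))
  smul_mem {i j s x} hs hx := by
    have h : ∀ n, ∀ z ∈ tensorGr (symGr k w) X.gr n, s • z ∈ tensorGr (symGr k w) X.gr (i + n) := by
      intro n z hz
      have := map_mem_tensorGr (a := i) (b := 0) (f := LinearMap.mulLeft k s)
        (g := (LinearMap.id : X.carrier →ₗ[k] X.carrier))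
        (fun _ _ hx => SetLike.GradedMul.mul_mem hs hx) (fun _ _ hx => by simpa using hx) hz
      rw [add_zero] at this
      convert this using 1
      induction z using TensorProduct.induction_on with
      | zero => simp
      | tmul a b => rfl
      | add x y hx hy =>
        clear * -
        exact LinearMap.congr_fun (f := (LinearMap.lsmul (MvPolynomial (Fin c) k)
          (MvPolynomial (Fin c) k ⊗[k] X.carrier) s).restrictScalars k)
          (TensorProduct.ext' fun _ _ => rfl) _
    refine ⟨Q.smul_mem hs hx.1, h _ _ hx.2.1, ?_⟩
    have := h _ _ hx.2.2
    rwa [← add_assoc] at this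
  diff := (Q.diff ∘ₗ LinearMap.fst k _ _).prod
    ((0 : _ →ₗ[k] _).prod (LinearMap.fst k _ _ ∘ₗ LinearMap.snd k _ _))
  diff_mem {n x} hx := by
    refine ⟨Q.diff_mem hx.1, zero_mem _, ?_⟩
    show x.2.1 ∈ tensorGr (symGr k w) X.gr (n - 1 + 1)
    rw [sub_add_cancel]; exact hx.2.1
  diff_diff x := by
    show (Q.diff (Q.diff x.1), ((0 : MvPolynomial (Fin c) k ⊗[k] X.carrier),
      (0 : MvPolynomial (Fin c) k ⊗[k] X.carrier))) = 0
    rw [Q.diff_diff]; rfl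
  leibniz {i s} x hs := by
    rw [smul_symGr k w hs]
    show (Q.diff (s • x.1), ((0 : MvPolynomial (Fin c) k ⊗[k] X.carrier), s • x.2.1)) =
      (s • Q.diff x.1, (s • (0 : MvPolynomial (Fin c) k ⊗[k] X.carrier), s • x.2.1))
    rw [diff_smul, smul_zero]

theorem contractibleSum_diff (x : (contractibleSum Q X).carrier) :
    (contractibleSum Q X).diff x = (Q.diff x.1, (0, x.2.1)) := rfl

variable {Q X} in
theorem contractibleSum_isSemifree (hQ : Q.IsSemifree) : (contractibleSum Q X).IsSemifree := by
  obtain ⟨J, ⟨T⟩⟩ := hQ.exists_triangularBasis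
  obtain ⟨I, b, deg, -, hdeg, -, -⟩ := exists_cycle_basis X.isInternal X.diff
    fun n x hx => X.diff_mem hx
  have hb : ∀ i, (b.baseChange (MvPolynomial (Fin c) k) i) ∈ tensorGr (symGr k w) X.gr (deg i) := by
    intro i
    rw [Module.Basis.baseChange_apply]
    exact tmul_mem_tensorGr SetLike.GradedOne.one_mem (hdeg i) (zero_add _)
  let bS := b.baseChange (MvPolynomial (Fin c) k)
  let B := T.basis.prod (bS.prod bS)
  have e1 : ∀ j, B (Sum.inl j) = (T.basis j, (0, 0)) := fun j => by
    ext <;> simp [B]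
  have e2 : ∀ i, B (Sum.inr (Sum.inl i)) = (0, (bS i, 0)) := fun i => by
    refine Prod.ext ?_ (Prod.ext ?_ ?_) <;> simp [B]
  have e3 : ∀ i, B (Sum.inr (Sum.inr i)) = (0, (0, bS i)) := fun i => by
    refine Prod.ext ?_ (Prod.ext ?_ ?_) <;> simp [B]
  let deg' : J ⊕ (I ⊕ I) → ℤ := Sum.elim T.deg (Sum.elim deg fun i => deg i - 1)
  let level : J ⊕ (I ⊕ I) → ℕ := Sum.elim T.level (Sum.elim (fun _ => 1) fun _ => 0)
  have hmem : ∀ l, B l ∈ (Q.gr (deg' l)).prod ((tensorGr (symGr k w) X.gr (deg' l)).prod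
      (tensorGr (symGr k w) X.gr (deg' l + 1))) := by
    rintro (j | i | i)
    · rw [e1]; exact ⟨T.basis_mem j, zero_mem _, zero_mem _⟩
    · rw [e2]; exact ⟨zero_mem _, hb i, zero_mem _⟩
    · rw [e3]
      refine ⟨zero_mem _, zero_mem _, ?_⟩
      show bS i ∈ tensorGr (symGr k w) X.gr (deg i - 1 + 1)
      rw [sub_add_cancel]; exact hb i
  have hr : ∀ q a i, B.repr (q, (0, a)) (Sum.inr (Sum.inl i)) = 0 := by simp [B]
  have hr' : ∀ q a j, B.repr (q, (0, a)) (Sum.inl j) = T.basis.repr q j := by simp [B]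
  have hr'' : ∀ q i, B.repr (q, (0, 0)) (Sum.inr (Sum.inr i)) = 0 := by simp [B]
  have hrepr : ∀ l l', level l ≤ level l' →
      B.repr (Q.diff (B l).1, (0, (B l).2.1)) l' = 0 := by
    rintro (j | i | i) (j' | i' | i') h
    · rw [e1, hr']; exact T.repr_diff j j' h
    · exact hr _ _ _
    · rw [e1]; exact hr'' _ _
    · rw [e2, map_zero, hr', map_zero]; rfl
    · exact hr _ _ _
    · simp [level] at h
    · rw [e3, map_zero, hr', map_zero]; rfl
    · exact hr _ _ _
    · rw [e3]; exact hr'' _ _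
  exact TriangularBasis.isSemifree ⟨B, deg', level, hmem, hrepr⟩

variable {Q X}

/-- The morphism from `contractibleSum Q X` to `X` given by a morphism from `Q` to `X`. -/
def contractibleSumDesc (s : Hom Q X) : Hom (contractibleSum Q X) X where
  toLin := s.toLin ∘ₗ LinearMap.fst _ _ _ +
    ((LinearMap.id : X.carrier →ₗ[k] X.carrier).liftBaseChange (MvPolynomial (Fin c) k)) ∘ₗ
      LinearMap.fst _ _ _ ∘ₗ LinearMap.snd _ _ _ +
    X.symDiff ∘ₗ ((LinearMap.id : X.carrier →ₗ[k] X.carrier).liftBaseChange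
      (MvPolynomial (Fin c) k)) ∘ₗ LinearMap.snd _ _ _ ∘ₗ LinearMap.snd _ _ _
  map_mem {n x} hx := by
    have h : ∀ n, ∀ z ∈ tensorGr (symGr k w) X.gr n,
        ((LinearMap.id : X.carrier →ₗ[k] X.carrier).liftBaseChange (MvPolynomial (Fin c) k)) z ∈
          X.gr n := by
      intro n z hz
      induction hz using Submodule.span_induction with
      | mem z hz =>
        obtain ⟨i, j, rfl, s, hs, x, hx, rfl⟩ := hz
        exact X.smul_mem hs hx
      | zero => simp
      | add x y _ _ hx hy => rw [map_add]; exact add_mem hx hy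
      | smul a z _ hz =>
        rw [← algebraMap_smul (MvPolynomial (Fin c) k) a z, map_smul, algebraMap_smul]
        exact Submodule.smul_mem _ a hz
    refine add_mem (add_mem (s.map_mem hx.1) (h _ _ hx.2.1)) ?_
    have := X.diff_mem (h _ _ hx.2.2)
    rwa [add_sub_cancel_right] at this
  map_diff x := by
    have h : ∀ (ev : MvPolynomial (Fin c) k ⊗[k] X.carrier →ₗ[MvPolynomial (Fin c) k] X.carrier)
        (q : Q.carrier) (a b : MvPolynomial (Fin c) k ⊗[k] X.carrier),
        s.toLin (Q.diff q) + ev 0 + X.diff (ev a) =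
          X.diff (s.toLin q + ev a + X.diff (ev b)) := fun ev q a b => by
      simp only [map_zero, add_zero, map_add, X.diff_diff, s.map_diff]
    exact h ((LinearMap.id : X.carrier →ₗ[k] X.carrier).liftBaseChange (MvPolynomial (Fin c) k))
      x.1 x.2.1 x.2.2

theorem contractibleSumDesc_apply (s : Hom Q X) (x : (contractibleSum Q X).carrier) :
    (contractibleSumDesc s).toLin x = s.toLin x.1 +
      ((LinearMap.id : X.carrier →ₗ[k] X.carrier).liftBaseChange (MvPolynomial (Fin c) k)) x.2.1 +
      X.diff (((LinearMap.id : X.carrier →ₗ[k] X.carrier).liftBaseChange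
        (MvPolynomial (Fin c) k)) x.2.2) := rfl

/-- A quasi-isomorphism from a semifree module can be made surjective by adding a contractible
semifree module. -/
theorem nonempty_semifreeResolution (hQ : Q.IsSemifree) (s : Hom Q X)
    (hs : quasiIso (symGr k w) (X := Q) (Y := X) s) : Nonempty X.SemifreeResolution := by
  refine ⟨⟨contractibleSum Q X, contractibleSumDesc s, contractibleSum_isSemifree hQ, ?_, ?_⟩⟩
  · rw [quasiIso_iff]
    intro x y hx hxy
    have hq : Q.diff x.1 = 0 := congrArg Prod.fst hx
    have ha : x.2.1 = 0 := congrArg (fun z => z.2.2) hx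
    rw [contractibleSumDesc_apply, ha, map_zero, add_zero] at hxy
    obtain ⟨q1, y1, h1, h2⟩ := (quasiIso_iff s).1 hs x.1
      (y - ((LinearMap.id : X.carrier →ₗ[k] X.carrier).liftBaseChange
        (MvPolynomial (Fin c) k)) x.2.2) hq (by rw [map_sub, ← hxy, add_sub_cancel_right])
    refine ⟨(q1, (x.2.2, 0)), y1, ?_, ?_⟩
    · refine (contractibleSum_diff Q X _).trans (Prod.ext h1 (Prod.ext ha.symm rfl))
    · have e : ∀ ev : MvPolynomial (Fin c) k ⊗[k] X.carrier →ₗ[MvPolynomial (Fin c) k] X.carrier,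
          y - ev x.2.2 - s.toLin q1 = X.diff y1 →
          y - (s.toLin q1 + ev x.2.2 + X.diff (ev 0)) = X.diff y1 := fun ev h => by
        rw [← h, map_zero, map_zero]; abel
      exact e _ h2
  · intro x
    refine ⟨(0, (1 ⊗ₜ x, 0)), (contractibleSumDesc_apply s _).trans ?_⟩
    show s.toLin 0 + LinearMap.liftBaseChange _ _ (1 ⊗ₜ x) +
      X.diff (LinearMap.liftBaseChange _ _ 0) = x
    simp

end Resolution

section SymTensorMaps

variable {X X' Y Y' : DGModule (symGr k w)}

/-- The tensor product of two morphisms over `S`. -/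
def Hom.symTensorMap (f : Hom X X') (g : Hom Y Y') : Hom (X.symTensor Y) (X'.symTensor Y') where
  toLin := TensorProduct.map f.toLin g.toLin
  map_mem {n z} hz := by
    have h : ∀ z ∈ symTensorGr X Y n,
        TensorProduct.map f.toLin g.toLin z ∈ symTensorGr X' Y' n := by
      intro z hz
      induction hz using Submodule.span_induction with
      | mem z hz =>
        obtain ⟨i, j, h, x, hx, y, hy, rfl⟩ := hz
        exact tmul_mem_symTensorGr X' Y' (f.map_mem hx) (g.map_mem hy) h
      | zero => rw [map_zero]; exact zero_mem _
      | add x y _ _ hx hy => rw [map_add]; exact add_mem hx hy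
      | smul a z _ hz =>
        rw [← algebraMap_smul (MvPolynomial (Fin c) k) a z, map_smul, algebraMap_smul]
        exact Submodule.smul_mem _ a hz
    exact h z hz
  map_diff z := by
    refine LinearMap.congr_fun (f := TensorProduct.map f.toLin g.toLin ∘ₗ symTensorDiff X Y)
      (g := symTensorDiff X' Y' ∘ₗ TensorProduct.map f.toLin g.toLin) ?_ z
    refine TensorProduct.ext' fun x y => ?_
    rw [LinearMap.comp_apply, LinearMap.comp_apply, symTensorDiff_tmul, TensorProduct.map_tmul,
      symTensorDiff_tmul, map_add, TensorProduct.map_tmul, TensorProduct.map_tmul, f.map_diff,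
      f.map_sgn, g.map_diff]

/-- The identity morphism. -/
def Hom.id (X : DGModule (symGr k w)) : Hom X X := ⟨LinearMap.id, fun h => h, fun _ => rfl⟩

/-- Tensoring with a semifree module on the right preserves quasi-isomorphisms. -/
theorem quasiIso_symTensor_right (f : Hom X X') (hf : quasiIso (symGr k w) (X := X) (Y := X') f)
    (hY : Y.IsSemifree) : quasiIso (symGr k w) (X := X.symTensor Y) (Y := X'.symTensor Y)
      (f.symTensorMap (Hom.id Y)) := by
  obtain ⟨J, ⟨T⟩⟩ := hY.exists_triangularBasis
  rw [quasiIso_iff] at hf ⊢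
  exact cone_acyclic_tensor_right X.symDiff X.symSgn X'.symDiff X'.symSgn f.toLin Y.symDiff
    T.basis T.level X.diff_diff X.sgn_diff X'.diff_diff X'.sgn_diff f.map_diff f.map_sgn
    Y.diff_diff T.repr_diff hf

/-- Tensoring with a semifree module on the left preserves quasi-isomorphisms. -/
theorem quasiIso_symTensor_left (f : Hom X X') (hf : quasiIso (symGr k w) (X := X) (Y := X') f)
    (hY : Y.IsSemifree) : quasiIso (symGr k w) (X := Y.symTensor X) (Y := Y.symTensor X')
      ((Hom.id Y).symTensorMap f) := by
  obtain ⟨J, ⟨T⟩⟩ := hY.exists_triangularBasis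
  rw [quasiIso_iff] at hf ⊢
  exact cone_acyclic_tensor_left X.symDiff X'.symDiff f.toLin Y.symDiff Y.symSgn
    T.basis T.level X.diff_diff Y.sgn_diff Y.sgn_sgn X'.diff_diff f.map_diff
    Y.diff_diff T.repr_diff (sgn_basis T) hf

/-- A tensor product of two quasi-isomorphisms over `S` is a quasi-isomorphism if the source of the
first and the target of the second are semifree. -/
theorem quasiIso_symTensorMap (f : Hom X X') (g : Hom Y Y')
    (hf : quasiIso (symGr k w) (X := X) (Y := X') f)
    (hg : quasiIso (symGr k w) (X := Y) (Y := Y') g) (hX : X.IsSemifree) (hY : Y'.IsSemifree) :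
    quasiIso (symGr k w) (X := X.symTensor Y) (Y := X'.symTensor Y') (f.symTensorMap g) := by
  have e : f.symTensorMap g = (f.symTensorMap (Hom.id Y')).comp ((Hom.id X).symTensorMap g) :=
    Hom.ext (TensorProduct.ext' fun _ _ => rfl)
  rw [e]
  exact quasiIso_comp (quasiIso_symTensor_right f hf hY) (quasiIso_symTensor_left g hg hX)

end SymTensorMaps

end SymModules

section ExtModules

variable {k : Type u} [Field k] {c : ℕ} {w : OddDegrees c}

/-- A map commuting with the generators of `Λ` is `Λ`-linear. -/
theorem map_ext_smul {M N : DGModule (extGr k w)} (f : M.carrier →ₗ[k] N.carrier)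
    (h : ∀ (i : Fin c) (x : M.carrier), f (extGen k i • x) = extGen k i • f x)
    (a : ExteriorAlgebra k (Fin c → k))
    (x : M.carrier) : f (a • x) = a • f x := by
  induction a using homogeneous_induction (extGr_isInternal k w) with
  | hom n a ha =>
    induction ha using Submodule.span_induction with
    | mem a ha =>
      obtain ⟨l, -, rfl⟩ := ha
      induction l with
      | nil => simp
      | cons i l ih => rw [List.map_cons, List.prod_cons, mul_smul, h, ih, mul_smul]
    | zero => simp
    | add a b _ _ ha hb => rw [add_smul, map_add, ha, hb, add_smul]
    | smul t a _ ha => rw [smul_assoc, map_smul, ha, smul_assoc]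
  | add a b ha hb => rw [add_smul, map_add, ha, hb, add_smul]

variable {M M' N N' : DGModule (extGr k w)}

/-- The tensor product of two morphisms over `k`. -/
def Hom.hopfMap (f : Hom M M') (g : Hom N N') : Hom (M.hopfTensor N) (M'.hopfTensor N') where
  toLin :=
    { toFun := TensorProduct.map (f.toLin.restrictScalars k) (g.toLin.restrictScalars k)
      map_add' := map_add _
      map_smul' := fun a z => by
        refine map_ext_smul (M := M.hopfTensor N) (N := M'.hopfTensor N')
          (TensorProduct.map (f.toLin.restrictScalars k) (g.toLin.restrictScalars k))
          (fun i z => ?_) a z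
        refine LinearMap.congr_fun (f := TensorProduct.map (f.toLin.restrictScalars k)
          (g.toLin.restrictScalars k) ∘ₗ hopfAct M N (extGen k i)) (g := hopfAct M' N' (extGen k i)
            ∘ₗ TensorProduct.map (f.toLin.restrictScalars k) (g.toLin.restrictScalars k)) ?_ z
        refine TensorProduct.ext' fun x y => ?_
        rw [LinearMap.comp_apply, LinearMap.comp_apply, hopfAct_gen_tmul, TensorProduct.map_tmul,
          hopfAct_gen_tmul, map_add, TensorProduct.map_tmul, TensorProduct.map_tmul]
        simp only [LinearMap.coe_restrictScalars, map_smul, f.map_sgn] }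
  map_mem {n z} hz := by
    have h : ∀ z ∈ tensorGr M.gr N.gr n, TensorProduct.map (f.toLin.restrictScalars k)
        (g.toLin.restrictScalars k) z ∈ tensorGr M'.gr N'.gr n := by
      intro z hz
      induction hz using Submodule.span_induction with
      | mem z hz =>
        obtain ⟨i, j, h, x, hx, y, hy, rfl⟩ := hz
        exact tmul_mem_tensorGr (f.map_mem hx) (g.map_mem hy) h
      | zero => rw [map_zero]; exact zero_mem _
      | add x y _ _ hx hy => rw [map_add]; exact add_mem hx hy
      | smul a z _ hz => rw [map_smul]; exact Submodule.smul_mem _ a hz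
    exact h z hz
  map_diff z := by
    refine LinearMap.congr_fun (f := TensorProduct.map (f.toLin.restrictScalars k)
          (g.toLin.restrictScalars k) ∘ₗ tensorDiff M N) (g := tensorDiff M' N'
            ∘ₗ TensorProduct.map (f.toLin.restrictScalars k) (g.toLin.restrictScalars k)) ?_ z
    refine TensorProduct.ext' fun x y => ?_
    rw [LinearMap.comp_apply, LinearMap.comp_apply, tensorDiff_tmul, TensorProduct.map_tmul,
      tensorDiff_tmul, map_add, TensorProduct.map_tmul, TensorProduct.map_tmul]
    simp only [LinearMap.coe_restrictScalars, f.map_sgn, f.map_diff, g.map_diff]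

/-- Over a field every complex has a triangular basis: cycles have level zero and the other basis
elements have level one. -/
theorem exists_two_level_basis (N : DGModule (extGr k w)) :
    ∃ (J : Type u) (b : Module.Basis J k N.carrier) (level : J → ℕ),
      (∀ j i, level j ≤ level i → b.repr (N.diff (b j)) i = 0) ∧
      ∀ j, ∃ ε : k, ε * ε = 1 ∧ N.sgn (b j) = ε • b j := by
  classical
  obtain ⟨J, b, deg, cyc, hdeg, hcyc, hrepr⟩ := exists_cycle_basis N.isInternal N.diff
    fun n x hx => N.diff_mem hx
  refine ⟨J, b, fun j => if cyc j then 0 else 1, fun j i hji => ?_, fun j => ?_⟩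
  · by_cases hj : cyc j
    · simp [hcyc j hj]
    · refine hrepr _ (N.diff_diff _) i fun hi => ?_
      simp [hj, hi] at hji
  · refine ⟨(((deg j).negOnePow : ℤ) : k), ?_, ?_⟩
    · rw [← Int.cast_mul, ← Units.val_mul, ← Int.negOnePow_add, Int.negOnePow_even _ ⟨_, rfl⟩]
      simp
    · rw [sgn, signMap_of_mem _ (hdeg j), Int.cast_smul_eq_zsmul]

/-- Künneth: a tensor product over `k` of two quasi-isomorphisms is a quasi-isomorphism. -/
theorem quasiIso_hopfMap (f : Hom M M') (g : Hom N N')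
    (hf : quasiIso (extGr k w) (X := M) (Y := M') f)
    (hg : quasiIso (extGr k w) (X := N) (Y := N') g) :
    quasiIso (extGr k w) (X := M.hopfTensor N) (Y := M'.hopfTensor N') (f.hopfMap g) := by
  let idM : Hom M M := ⟨LinearMap.id, fun h => h, fun _ => rfl⟩
  let idN : Hom N' N' := ⟨LinearMap.id, fun h => h, fun _ => rfl⟩
  have e : f.hopfMap g = (f.hopfMap idN).comp (idM.hopfMap g) := by
    refine Hom.ext (LinearMap.ext fun z => ?_)
    refine LinearMap.congr_fun (f := TensorProduct.map (f.toLin.restrictScalars k)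
      (g.toLin.restrictScalars k)) (g := TensorProduct.map (f.toLin.restrictScalars k)
      (idN.toLin.restrictScalars k) ∘ₗ TensorProduct.map (idM.toLin.restrictScalars k)
      (g.toLin.restrictScalars k)) (TensorProduct.ext' fun _ _ => rfl) z
  rw [e]
  refine quasiIso_comp ?_ ?_
  · obtain ⟨J, b, level, htri, -⟩ := exists_two_level_basis N'
    rw [quasiIso_iff] at hf ⊢
    exact cone_acyclic_tensor_right M.diff M.sgn M'.diff M'.sgn (f.toLin.restrictScalars k)
      N'.diff b level M.diff_diff M.sgn_diff M'.diff_diff M'.sgn_diff f.map_diff f.map_sgn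
      N'.diff_diff htri hf
  · obtain ⟨J, b, level, htri, hε⟩ := exists_two_level_basis M
    rw [quasiIso_iff] at hg ⊢
    exact cone_acyclic_tensor_left N.diff N'.diff (g.toLin.restrictScalars k) M.diff M.sgn
      b level N.diff_diff M.sgn_diff M.sgn_sgn N'.diff_diff g.map_diff M.diff_diff htri hε hg

end ExtModules

end DGModule

/-! ### Homogeneous maps into the symmetric algebra and twisted differentials -/

section SymMaps

variable {k : Type u} [Field k] {c : ℕ} {V : Type u} [AddCommGroup V] [Module k V]

/-- `S` is concentrated in degrees at most zero. -/
theorem eq_zero_of_mem_symGr {w : OddDegrees c} {n : ℤ} (hn : 0 < n)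
    {s : MvPolynomial (Fin c) k} (hs : s ∈ symGr k w n) : s = 0 := by
  by_contra h
  have hs : MvPolynomial.IsWeightedHomogeneous (fun i => -(((w i : ℕ) : ℤ) + 1)) s n := hs
  obtain ⟨d, hd⟩ := MvPolynomial.ne_zero_iff.1 h
  have hn' := hs hd
  rw [Finsupp.weight_apply, Finsupp.sum] at hn'
  have : ∑ i ∈ d.support, d i • -(((w i : ℕ) : ℤ) + 1) ≤ 0 :=
    Finset.sum_nonpos fun i _ => by
      rw [nsmul_eq_mul]
      exact mul_nonpos_of_nonneg_of_nonpos (by positivity) (by omega)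
  omega

/-- The linear maps `V → S` of degree `n`. -/
def symMapGr (w : OddDegrees c) (gr : ℤ → Submodule k V) (n : ℤ) :
    Submodule k (V →ₗ[k] MvPolynomial (Fin c) k) where
  carrier := {f | ∀ j, ∀ x ∈ gr j, f x ∈ symGr k w (j + n)}
  zero_mem' _ _ _ := zero_mem _
  add_mem' hf hg j x hx := add_mem (hf j x hx) (hg j x hx)
  smul_mem' a _ hf j x hx := Submodule.smul_mem _ a (hf j x hx)

theorem linearMap_ext_homogeneous {Z : Type*} [AddCommGroup Z] [Module k Z]
    {gr : ℤ → Submodule k V} (h : DirectSum.IsInternal gr)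
    {f g : V →ₗ[k] Z} (hfg : ∀ j, ∀ x ∈ gr j, f x = g x) : f = g := by
  ext x
  induction x using homogeneous_induction h with
  | hom j x hx => exact hfg j x hx
  | add x y hx hy => rw [map_add, map_add, hx, hy]

/-- The linear map that is given by `F j` on the elements of degree `j`. -/
def gluedMap {Z : Type*} [AddCommGroup Z] [Module k Z] {gr : ℤ → Submodule k V}
    (h : DirectSum.IsInternal gr) (F : ℤ → V →ₗ[k] Z) : V →ₗ[k] Z :=
  Finsupp.lsum k F ∘ₗ components h

theorem gluedMap_of_mem {Z : Type*} [AddCommGroup Z] [Module k Z] {gr : ℤ → Submodule k V}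
    (h : DirectSum.IsInternal gr) (F : ℤ → V →ₗ[k] Z) {j : ℤ} {x : V} (hx : x ∈ gr j) :
    gluedMap h F x = F j x := by
  rw [gluedMap, LinearMap.comp_apply, components_of_mem h hx, Finsupp.lsum_single]

theorem iSupIndep_symMapGr (w : OddDegrees c) {gr : ℤ → Submodule k V}
    (h : DirectSum.IsInternal gr) : iSupIndep (symMapGr w gr) := by
  rw [iSupIndep_def]
  intro m
  rw [Submodule.disjoint_def]
  intro f hf hf'
  let T : (V →ₗ[k] MvPolynomial (Fin c) k) →+ (V →ₗ[k] MvPolynomial (Fin c) k) :=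
    { toFun := fun f => gluedMap h fun j =>
        component (DGModule.algebra_isInternal (symGr k w)) (j + m) ∘ₗ f
      map_zero' := linearMap_ext_homogeneous h fun j x hx => by
        rw [gluedMap_of_mem h _ hx]; simp
      map_add' := fun f g => linearMap_ext_homogeneous h fun j x hx => by
        rw [LinearMap.add_apply, gluedMap_of_mem h _ hx, gluedMap_of_mem h _ hx,
          gluedMap_of_mem h _ hx, LinearMap.comp_apply, LinearMap.add_apply, map_add]; rfl }
  have hT : ∀ f, T f = gluedMap h fun j =>
        component (DGModule.algebra_isInternal (symGr k w)) (j + m) ∘ₗ f := fun _ => rfl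
  have h1 : T f = f := linearMap_ext_homogeneous h fun j x hx => by
    rw [hT, gluedMap_of_mem h _ hx, LinearMap.comp_apply, component_of_mem _ (hf j x hx)]
  have h2 : T f = 0 := by
    clear h1 hf
    rw [iSup_subtype'] at hf'
    induction hf' using Submodule.iSup_induction' with
    | mem i f hf =>
      refine linearMap_ext_homogeneous h fun j x hx => ?_
      rw [hT, gluedMap_of_mem h _ hx, LinearMap.comp_apply,
        component_of_mem_ne _ (hf j x hx) (n := j + m) (fun e => i.2 (by simpa using e))]; rfl
    | zero => exact map_zero T
    | add f g _ _ hf hg => rw [map_add, hf, hg, add_zero]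
  rw [← h1, h2]

/-- Composition on the right with a linear map. -/
def preComp {V' : Type u} [AddCommGroup V'] [Module k V'] (d : V →ₗ[k] V') :
    (V' →ₗ[k] MvPolynomial (Fin c) k) →ₗ[MvPolynomial (Fin c) k]
      (V →ₗ[k] MvPolynomial (Fin c) k) where
  toFun f := f ∘ₗ d
  map_add' _ _ := rfl
  map_smul' _ _ := rfl

/-- The operator `f ↦ f ∘ d + ∑ χ_i (f ∘ e_i)` on the linear maps `V → S`. -/
def twistedD (d : V →ₗ[k] V) (e : Fin c → V →ₗ[k] V) :
    Module.End (MvPolynomial (Fin c) k) (V →ₗ[k] MvPolynomial (Fin c) k) :=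
  preComp d + ∑ i, (MvPolynomial.X i : MvPolynomial (Fin c) k) • preComp (e i)

theorem twistedD_apply (d : V →ₗ[k] V) (e : Fin c → V →ₗ[k] V)
    (f : V →ₗ[k] MvPolynomial (Fin c) k) (x : V) :
    twistedD d e f x = f (d x) + ∑ i, MvPolynomial.X i * f (e i x) := by
  simp [twistedD, preComp, LinearMap.sum_apply]

theorem twistedD_twistedD (d : V →ₗ[k] V) (e : Fin c → V →ₗ[k] V) (h0 : ∀ x, d (d x) = 0)
    (h1 : ∀ i x, e i (e i x) = 0) (h2 : ∀ i j x, e i (e j x) + e j (e i x) = 0)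
    (h3 : ∀ i x, d (e i x) + e i (d x) = 0) (f : V →ₗ[k] MvPolynomial (Fin c) k) :
    twistedD d e (twistedD d e f) = 0 := by
  have key : ∀ i (g : V →ₗ[k] MvPolynomial (Fin c) k) (x : V),
      ((MvPolynomial.X i : MvPolynomial (Fin c) k) • preComp (e i)) g x =
        MvPolynomial.X i * g (e i x) := fun _ _ _ => rfl
  have key' : ∀ (g : V →ₗ[k] MvPolynomial (Fin c) k) (x : V), preComp d g x = g (d x) :=
    fun _ _ => rfl
  have hsq : twistedD d e * twistedD d e = 0 := by
    rw [twistedD]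
    refine sq_add_sum_eq_zero Finset.univ (preComp d)
      (fun i => (MvPolynomial.X i : MvPolynomial (Fin c) k) • preComp (e i)) ?_ (fun i => ?_)
      (fun i j => ?_) fun i => ?_
    · ext1 g; ext1 x
      rw [Module.End.mul_apply, key', key', h0, map_zero]; rfl
    · ext1 g; ext1 x
      rw [Module.End.mul_apply, key, key, h1, map_zero, mul_zero, mul_zero]; rfl
    · ext1 g; ext1 x
      rw [LinearMap.add_apply, Module.End.mul_apply, Module.End.mul_apply, LinearMap.add_apply, key,
        key, key, key, mul_left_comm, ← mul_add, ← mul_add, ← map_add, h2, map_zero, mul_zero,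
        mul_zero]; rfl
    · ext1 g; ext1 x
      rw [LinearMap.add_apply, Module.End.mul_apply, Module.End.mul_apply, LinearMap.add_apply, key,
        key', key', key, ← mul_add, ← map_add, add_comm, h3, map_zero, mul_zero]; rfl
  exact LinearMap.congr_fun hsq f

theorem twistedD_mem {w : OddDegrees c} {gr : ℤ → Submodule k V} {d : V →ₗ[k] V}
    {e : Fin c → V →ₗ[k] V} (hd : ∀ n, ∀ x ∈ gr n, d x ∈ gr (n - 1))
    (he : ∀ i n, ∀ x ∈ gr n, e i x ∈ gr ((w i : ℕ) + n)) {n : ℤ}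
    {f : V →ₗ[k] MvPolynomial (Fin c) k} (hf : f ∈ symMapGr w gr n) :
    twistedD d e f ∈ symMapGr w gr (n - 1) := by
  intro j x hx
  rw [twistedD_apply]
  refine add_mem ?_ (sum_mem fun i _ => ?_)
  · rw [show j + (n - 1) = j - 1 + n by ring]
    exact hf _ _ (hd j x hx)
  · have := SetLike.GradedMul.mul_mem (A := symGr k w) (X_mem_symGr k w i) (hf _ _ (he i j x hx))
    rwa [show -(((w i : ℕ) : ℤ) + 1) + ((w i : ℕ) + j + n) = j + (n - 1) by ring] at this

/-- If `d` is contractible, then the twisted differential is exact on homogeneous maps: a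
contraction `h` of `d` is a contraction of the twisted differential up to an error that increases
the order in the `χ_i`, and iterating this converges on every homogeneous element because `S` is
zero in positive degrees. -/
theorem exists_twistedD_eq {w : OddDegrees c} {gr : ℤ → Submodule k V}
    (hgr : DirectSum.IsInternal gr) (d : V →ₗ[k] V) (e : Fin c → V →ₗ[k] V)
    (hd : ∀ n, ∀ x ∈ gr n, d x ∈ gr (n - 1))
    (he : ∀ i n, ∀ x ∈ gr n, e i x ∈ gr ((w i : ℕ) + n)) (h0 : ∀ x, d (d x) = 0)
    (h1 : ∀ i x, e i (e i x) = 0) (h2 : ∀ i j x, e i (e j x) + e j (e i x) = 0)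
    (h3 : ∀ i x, d (e i x) + e i (d x) = 0) (hex : ∀ x, d x = 0 → ∃ y, d y = x) {n : ℤ}
    (f : V →ₗ[k] MvPolynomial (Fin c) k) (hf : f ∈ symMapGr w gr n) (hDf : twistedD d e f = 0) :
    ∃ g ∈ symMapGr w gr (n + 1), twistedD d e g = f := by
  obtain ⟨h, hh, hdh⟩ := exists_contraction hgr d hd h0 hex
  let F : ℕ → (V →ₗ[k] MvPolynomial (Fin c) k) :=
    fun r => Nat.rec f (fun _ g => g - twistedD d e (g ∘ₗ h)) r
  have hF : ∀ r, F (r + 1) = F r - twistedD d e (F r ∘ₗ h) := fun _ => rfl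
  have hcomp : ∀ {g}, g ∈ symMapGr w gr n → g ∘ₗ h ∈ symMapGr w gr (n + 1) := fun hg j x hx => by
    rw [show j + (n + 1) = j + 1 + n by ring]
    exact hg _ _ (hh j x hx)
  have hFmem : ∀ r, F r ∈ symMapGr w gr n := by
    intro r
    induction r with
    | zero => exact hf
    | succ r ih =>
      have := twistedD_mem hd he (hcomp ih)
      rw [add_sub_cancel_right] at this
      exact sub_mem ih this
  have hDF : ∀ r, twistedD d e (F r) = 0 := by
    intro r
    induction r with
    | zero => exact hDf
    | succ r ih => rw [hF, map_sub, ih, twistedD_twistedD d e h0 h1 h2 h3, sub_zero]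
  have herr : ∀ r x, F (r + 1) x = - ∑ i, MvPolynomial.X i * F r (e i (h x) + h (e i x)) := by
    intro r x
    have e1 : F r (d (h x)) + ∑ i, MvPolynomial.X i * F r (e i (h x)) = 0 := by
      rw [← twistedD_apply, hDF]; rfl
    have e2 : F r x = F r (d (h x)) + F r (h (d x)) := by rw [← map_add, hdh]
    simp only [map_add, mul_add, Finset.sum_add_distrib]
    rw [hF, LinearMap.sub_apply, twistedD_apply, e2]
    simp only [LinearMap.comp_apply]
    linear_combination e1
  have hvan : ∀ (r : ℕ) j, 0 < j + n + r → ∀ x ∈ gr j, F r x = 0 := by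
    intro r
    induction r with
    | zero =>
      intro j hj x hx
      exact eq_zero_of_mem_symGr (by simpa using hj) (hf j x hx)
    | succ r ih =>
      intro j hj x hx
      rw [herr, neg_eq_zero]
      refine Finset.sum_eq_zero fun i _ => ?_
      have hi := (w i).2.pos
      rw [ih ((w i : ℕ) + (j + 1)) (by push_cast at hj; omega) _
        (add_mem (he i _ _ (hh j x hx)) (by
          rw [← add_assoc]; exact hh _ _ (he i j x hx))), mul_zero]
  let G : ℕ → (V →ₗ[k] MvPolynomial (Fin c) k) := fun R => ∑ r ∈ Finset.range R, F r ∘ₗ h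
  have hG : ∀ R x, G R x = ∑ r ∈ Finset.range R, F r (h x) := fun R x => by
    simp [G, LinearMap.sum_apply]
  let R : ℤ → ℕ := fun j => (-(j + n)).toNat
  let g := gluedMap hgr fun j => G (R j)
  have hg : ∀ j, ∀ x ∈ gr j, ∀ N, R j ≤ N → g x = G N x := by
    intro j x hx N hN
    rw [gluedMap_of_mem hgr _ hx, hG, hG]
    refine Finset.sum_subset (Finset.range_mono hN) fun r _ hr => ?_
    rw [Finset.mem_range, not_lt] at hr
    exact hvan r (j + 1) (by simp only [R] at hr; omega) _ (hh j x hx)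
  have hDG : ∀ N, twistedD d e (G N) = f - F N := by
    intro N
    induction N with
    | zero => simp [G, F]
    | succ N ih =>
      have : G (N + 1) = G N + F N ∘ₗ h := Finset.sum_range_succ _ _
      rw [this, map_add, ih, hF]; abel
  refine ⟨g, fun j x hx => ?_, linearMap_ext_homogeneous hgr fun j x hx => ?_⟩
  · rw [hg j x hx _ le_rfl, hG]
    exact sum_mem fun r _ => hcomp (hFmem r) j x hx
  · have e1 : twistedD d e g x = twistedD d e (G (R (j - 1))) x := by
      rw [twistedD_apply, twistedD_apply, hg _ _ (hd j x hx) _ le_rfl]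
      congr 1
      refine Finset.sum_congr rfl fun i _ => ?_
      rw [hg _ _ (he i j x hx) (R (j - 1)) (by simp only [R]; omega)]
    rw [e1, hDG, LinearMap.sub_apply, hvan (R (j - 1)) j (by simp only [R]; omega) x hx, sub_zero]

end SymMaps

namespace DGModule

section TwistedDual

variable {k : Type u} [Field k] {c : ℕ} {w : OddDegrees c}

/-- The underlying space of the twisted dual of `M`: the sums of homogeneous linear maps
`M → S`. -/
def TwistedDualSpace (M : DGModule (extGr k w)) : Type u :=
  (⨆ n, symMapGr w M.gr n : Submodule k (M.carrier →ₗ[k] MvPolynomial (Fin c) k))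

variable (M : DGModule (extGr k w))

instance : AddCommGroup M.TwistedDualSpace :=
  inferInstanceAs (AddCommGroup
    (⨆ n, symMapGr w M.gr n : Submodule k (M.carrier →ₗ[k] MvPolynomial (Fin c) k)))

instance : Module k M.TwistedDualSpace :=
  inferInstanceAs (Module k
    (⨆ n, symMapGr w M.gr n : Submodule k (M.carrier →ₗ[k] MvPolynomial (Fin c) k)))

variable {M} in
theorem smul_mem_symMapGr {i n : ℤ} {s : MvPolynomial (Fin c) k} (hs : s ∈ symGr k w i)
    {f : M.carrier →ₗ[k] MvPolynomial (Fin c) k} (hf : f ∈ symMapGr w M.gr n) :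
    s • f ∈ symMapGr w M.gr (i + n) := fun j x hx => by
  have := SetLike.GradedMul.mul_mem (A := symGr k w) hs (hf j x hx)
  rwa [add_left_comm] at this

theorem smul_mem_iSup_symMapGr (s : MvPolynomial (Fin c) k)
    {f : M.carrier →ₗ[k] MvPolynomial (Fin c) k} (hf : f ∈ ⨆ n, symMapGr w M.gr n) :
    s • f ∈ ⨆ n, symMapGr w M.gr n := by
  induction s using homogeneous_induction (algebra_isInternal (symGr k w)) with
  | hom i s hs =>
    induction hf using Submodule.iSup_induction' with
    | mem n f hf => exact Submodule.mem_iSup_of_mem _ (smul_mem_symMapGr hs hf)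
    | zero => rw [smul_zero]; exact zero_mem _
    | add f g _ _ hf hg => rw [smul_add]; exact add_mem hf hg
  | add s t hs ht => rw [add_smul]; exact add_mem hs ht

instance : Module (MvPolynomial (Fin c) k) M.TwistedDualSpace where
  smul s f := ⟨s • f.1, M.smul_mem_iSup_symMapGr s f.2⟩
  one_smul f := Subtype.ext (one_smul _ f.1)
  mul_smul s t f := Subtype.ext (mul_smul s t f.1)
  smul_zero s := Subtype.ext (smul_zero s)
  smul_add s f g := Subtype.ext (smul_add s f.1 g.1)
  add_smul s t f := Subtype.ext (add_smul s t f.1)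
  zero_smul f := Subtype.ext (zero_smul _ f.1)

/-- The differential of `M` composed with the sign operator. -/
def innerDiff : M.carrier →ₗ[k] M.carrier := M.diff ∘ₗ M.sgn

/-- The action of `e_i` composed with the sign operator. -/
def innerGen (i : Fin c) : M.carrier →ₗ[k] M.carrier := M.act (extGen k i) ∘ₗ M.sgn

theorem innerDiff_mem (n : ℤ) (x : M.carrier) (hx : x ∈ M.gr n) : M.innerDiff x ∈ M.gr (n - 1) :=
  M.diff_mem (M.sgn_mem hx)

theorem innerGen_mem (i : Fin c) (n : ℤ) (x : M.carrier) (hx : x ∈ M.gr n) :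
    M.innerGen i x ∈ M.gr ((w i : ℕ) + n) :=
  M.smul_mem (extGen_mem k w i) (M.sgn_mem hx)

theorem innerDiff_innerDiff (x : M.carrier) : M.innerDiff (M.innerDiff x) = 0 := by
  simp [innerDiff, sgn_diff, sgn_sgn, diff_diff]

theorem innerGen_innerGen (i j : Fin c) (x : M.carrier) :
    M.innerGen i (M.innerGen j x) = -(extGen k i • extGen k j • x) := by
  simp [innerGen, sgn_gen, sgn_sgn]

theorem innerGen_self (i : Fin c) (x : M.carrier) : M.innerGen i (M.innerGen i x) = 0 := by
  rw [innerGen_innerGen, gen_smul_self, neg_zero]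

theorem innerGen_swap (i j : Fin c) (x : M.carrier) :
    M.innerGen i (M.innerGen j x) + M.innerGen j (M.innerGen i x) = 0 := by
  rw [innerGen_innerGen, innerGen_innerGen, M.gen_smul_swap i j, neg_neg, neg_add_cancel]

theorem innerDiff_innerGen (i : Fin c) (x : M.carrier) :
    M.innerDiff (M.innerGen i x) + M.innerGen i (M.innerDiff x) = 0 := by
  simp [innerDiff, innerGen, sgn_gen, sgn_diff, sgn_sgn, diff_gen]

variable {M} in
theorem twistedD_mem_iSup {f : M.carrier →ₗ[k] MvPolynomial (Fin c) k}
    (hf : f ∈ ⨆ n, symMapGr w M.gr n) :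
    twistedD M.innerDiff M.innerGen f ∈ ⨆ n, symMapGr w M.gr n := by
  induction hf using Submodule.iSup_induction' with
  | mem n f hf =>
    exact Submodule.mem_iSup_of_mem _ (twistedD_mem M.innerDiff_mem M.innerGen_mem hf)
  | zero => rw [map_zero]; exact zero_mem _
  | add f g _ _ hf hg => rw [map_add]; exact add_mem hf hg

/-- The twisted dual of a dg `Λ`-module `M`: the graded space of maps `M → S` with the differential
sending `f` to `m ↦ (-1)^|m| (f (∂m) + ∑ χ_i f (e_i m))`. -/
def twistedDual : DGModule (symGr k w) where
  carrier := M.TwistedDualSpace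
  addCommGroup := inferInstance
  moduleBase := inferInstance
  module := inferInstance
  isScalarTower := ⟨fun a s f => Subtype.ext (smul_assoc a s f.1)⟩
  gr n := (symMapGr w M.gr n).comap
    (⨆ n, symMapGr w M.gr n : Submodule k (M.carrier →ₗ[k] MvPolynomial (Fin c) k)).subtype
  isInternal := isInternal_comap_iSup (iSupIndep_symMapGr w M.isInternal)
  smul_mem {_ _ _ f} hs hf := smul_mem_symMapGr (f := f.1) hs hf
  diff :=
    { toFun := fun f => ⟨twistedD M.innerDiff M.innerGen f.1, twistedD_mem_iSup f.2⟩
      map_add' := fun f g => Subtype.ext (map_add (twistedD M.innerDiff M.innerGen) f.1 g.1)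
      map_smul' := fun a f => Subtype.ext
        (((twistedD M.innerDiff M.innerGen).restrictScalars k).map_smul a f.1) }
  diff_mem {_ f} hf := twistedD_mem (f := f.1) M.innerDiff_mem M.innerGen_mem hf
  diff_diff f := Subtype.ext (twistedD_twistedD M.innerDiff M.innerGen M.innerDiff_innerDiff
    M.innerGen_self M.innerGen_swap M.innerDiff_innerGen f.1)
  leibniz {_ s} f hs := Subtype.ext ((map_smul (twistedD M.innerDiff M.innerGen) s f.1).trans
    (smul_symGr k w hs _).symm)

/-- The linear map `M → S` underlying an element of the twisted dual. -/
def evalDual : M.twistedDual.carrier →ₗ[MvPolynomial (Fin c) k]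
    (M.carrier →ₗ[k] MvPolynomial (Fin c) k) where
  toFun f := f.1
  map_add' _ _ := rfl
  map_smul' _ _ := rfl

theorem evalDual_injective : Function.Injective M.evalDual := fun _ _ h => Subtype.ext h

theorem mem_twistedDual_gr {n : ℤ} {f : M.twistedDual.carrier} :
    f ∈ M.twistedDual.gr n ↔ M.evalDual f ∈ symMapGr w M.gr n := Iff.rfl

variable {M} in
theorem exists_evalDual {f : M.carrier →ₗ[k] MvPolynomial (Fin c) k}
    (hf : f ∈ ⨆ n, symMapGr w M.gr n) : ∃ g, M.evalDual g = f := ⟨⟨f, hf⟩, rfl⟩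

variable {M} in
theorem exists_evalDual_of_mem {n : ℤ} {f : M.carrier →ₗ[k] MvPolynomial (Fin c) k}
    (hf : f ∈ symMapGr w M.gr n) : ∃ g ∈ M.twistedDual.gr n, M.evalDual g = f :=
  ⟨⟨f, Submodule.mem_iSup_of_mem n hf⟩, hf, rfl⟩

theorem evalDual_diff (f : M.twistedDual.carrier) :
    M.evalDual (M.twistedDual.diff f) = twistedD M.innerDiff M.innerGen (M.evalDual f) := rfl

theorem evalDual_mem (f : M.twistedDual.carrier) : M.evalDual f ∈ ⨆ n, symMapGr w M.gr n := f.2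

variable {M} {L : DGModule (extGr k w)}

/-- The morphism of twisted duals induced by a morphism of dg `Λ`-modules. -/
def Hom.dualMap (φ : Hom M L) : Hom L.twistedDual M.twistedDual where
  toLin :=
    { toFun := fun f => ⟨preComp (φ.toLin.restrictScalars k) (L.evalDual f), by
        have h := L.evalDual_mem f
        generalize L.evalDual f = f at h
        induction h using Submodule.iSup_induction' with
        | mem n f hf =>
          exact Submodule.mem_iSup_of_mem n fun j x hx => hf j _ (φ.map_mem hx)
        | zero => rw [map_zero]; exact zero_mem _
        | add f g _ _ hf hg => rw [map_add]; exact add_mem hf hg⟩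
      map_add' := fun _ _ => rfl
      map_smul' := fun _ _ => rfl }
  map_mem hf := fun j x hx => hf j _ (φ.map_mem hx)
  map_diff f := by
    apply M.evalDual_injective
    rw [evalDual_diff]
    refine LinearMap.ext fun x => ?_
    rw [twistedD_apply]
    have : ∀ f : L.carrier →ₗ[k] MvPolynomial (Fin c) k,
        twistedD L.innerDiff L.innerGen f (φ.toLin x) = f (φ.toLin (M.innerDiff x)) +
          ∑ i, MvPolynomial.X i * f (φ.toLin (M.innerGen i x)) := fun f => by
      rw [twistedD_apply]
      simp only [innerDiff, innerGen, LinearMap.comp_apply, φ.map_diff, φ.map_sgn, act_apply,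
        map_smul]
    exact this (L.evalDual f)

theorem evalDual_dualMap (φ : Hom M L) (f : L.twistedDual.carrier) :
    M.evalDual (φ.dualMap.toLin f) = L.evalDual f ∘ₗ φ.toLin.restrictScalars k := rfl

end TwistedDual

section Homogeneous

variable {k A : Type u} [Field k] [Ring A] [Algebra k A] {𝒜 : ℤ → Submodule k A} [GradedAlgebra 𝒜]
  {M N : DGModule 𝒜}

/-- Acyclicity of the mapping cone can be checked on homogeneous elements. -/
theorem quasiIso_of_homogeneous (f : Hom M N)
    (h : ∀ n, ∀ x ∈ M.gr n, ∀ y ∈ N.gr (n + 1), M.diff x = 0 → f.toLin x = N.diff y →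
      ∃ x1 y1, M.diff x1 = x ∧ y - f.toLin x1 = N.diff y1) :
    quasiIso 𝒜 (X := M) (Y := N) f := by
  classical
  rw [quasiIso_iff]
  intro x y hx hxy
  have hn : ∀ n, ∃ x1 y1, M.diff x1 = component M.isInternal n x ∧
      component N.isInternal (n + 1) y - f.toLin x1 = N.diff y1 := fun n => by
    refine h n _ (component_mem _ _ _) _ (component_mem _ _ _) ?_ ?_
    · rw [diff_component, hx, map_zero]
    · rw [f.map_component, hxy, diff_component, add_sub_cancel_right]
  choose x1 y1 h1 h2 using hn
  let s := (components M.isInternal x).support ∪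
    ((components N.isInternal y).support.image fun n => n - 1)
  have hsx : ∑ n ∈ s, component M.isInternal n x = x := by
    conv_rhs => rw [← components_sum M.isInternal x]
    refine (Finset.sum_subset Finset.subset_union_left fun n _ hn => ?_).symm
    exact Finsupp.notMem_support_iff.1 hn
  have hsy : ∑ n ∈ s, component N.isInternal (n + 1) y = y := by
    conv_rhs => rw [← components_sum N.isInternal y]
    have : ∑ n ∈ s, component N.isInternal (n + 1) y =
        ∑ n ∈ s.image fun n => n + 1, component N.isInternal n y :=
      (Finset.sum_image fun a _ b _ e => by simpa using e).symm
    rw [this]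
    refine (Finset.sum_subset (fun n hn => ?_) fun n _ hn => ?_).symm
    · exact Finset.mem_image.2 ⟨n - 1, Finset.mem_union_right _ (Finset.mem_image_of_mem _ hn),
        by ring⟩
    · exact Finsupp.notMem_support_iff.1 hn
  refine ⟨∑ n ∈ s, x1 n, ∑ n ∈ s, y1 n, ?_, ?_⟩
  · rw [map_sum, Finset.sum_congr rfl fun n _ => h1 n, hsx]
  · rw [map_sum, map_sum, ← Finset.sum_congr rfl fun n _ => h2 n, Finset.sum_sub_distrib, hsy]

end Homogeneous

section TwistedDual

variable {k : Type u} [Field k] {c : ℕ} {w : OddDegrees c} {M L : DGModule (extGr k w)}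

/-- The twisted dual preserves quasi-isomorphisms. The cone of a quasi-isomorphism is exact, and a
pair of maps into `S` as in the criterion `quasiIso_iff` for the dual morphism is a map on this cone
that is closed for the twisted differential. -/
theorem quasiIso_dualMap (φ : Hom M L) (hφ : quasiIso (extGr k w) (X := M) (Y := L) φ) :
    quasiIso (symGr k w) (X := L.twistedDual) (Y := M.twistedDual) φ.dualMap := by
  rw [quasiIso_iff] at hφ
  refine quasiIso_of_homogeneous _ fun n f hf g hg hdf hfg => ?_
  -- the differential and the operators of the mapping cone of `φ`
  let φk := φ.toLin.restrictScalars k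
  let d : M.carrier × L.carrier →ₗ[k] M.carrier × L.carrier :=
    (-(M.innerDiff ∘ₗ LinearMap.fst k M.carrier L.carrier)).prod
      (L.innerDiff ∘ₗ LinearMap.snd k M.carrier L.carrier +
        φk ∘ₗ LinearMap.fst k M.carrier L.carrier)
  let e : Fin c → M.carrier × L.carrier →ₗ[k] M.carrier × L.carrier := fun i =>
    (-(M.innerGen i ∘ₗ LinearMap.fst k M.carrier L.carrier)).prod
      (L.innerGen i ∘ₗ LinearMap.snd k M.carrier L.carrier)
  have hdv : ∀ v, d v = (-M.innerDiff v.1, L.innerDiff v.2 + φ.toLin v.1) := fun _ => rfl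
  have hev : ∀ i v, e i v = (-M.innerGen i v.1, L.innerGen i v.2) := fun _ _ => rfl
  have hφd : ∀ x, φ.toLin (M.innerDiff x) = L.innerDiff (φ.toLin x) := fun x => by
    simp only [innerDiff, LinearMap.comp_apply, φ.map_diff, φ.map_sgn]
  have hφe : ∀ i x, φ.toLin (M.innerGen i x) = L.innerGen i (φ.toLin x) := fun i x => by
    simp only [innerGen, LinearMap.comp_apply, act_apply, map_smul, φ.map_sgn]
  have hD : ∀ (a : M.twistedDual.carrier) (b : L.twistedDual.carrier) (v : M.carrier × L.carrier),
      twistedD d e ((M.evalDual a).coprod (L.evalDual b)) v =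
        M.evalDual (φ.dualMap.toLin b - M.twistedDual.diff a) v.1 +
          L.evalDual (L.twistedDual.diff b) v.2 := fun a b v => by
    rw [twistedD_apply, map_sub, evalDual_diff, evalDual_diff, evalDual_dualMap]
    simp only [hdv, hev, LinearMap.coprod_apply, LinearMap.sub_apply, twistedD_apply,
      LinearMap.comp_apply, LinearMap.coe_restrictScalars, map_add, map_neg, mul_add, mul_neg,
      Finset.sum_add_distrib, Finset.sum_neg_distrib]
    ring
  obtain ⟨G, hGmem, hG⟩ := exists_twistedD_eq (w := w)
    (gr := fun j => (M.gr (j + -1)).prod (L.gr j))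
    (prodGr_isInternal (shiftGr_isInternal M.isInternal (-1)) L.isInternal) d e
    (fun j v hv => by
      rw [hdv]
      refine ⟨neg_mem ?_, add_mem (L.innerDiff_mem _ _ hv.2) (φ.map_mem hv.1)⟩
      exact M.innerDiff_mem _ _ hv.1)
    (fun i j v hv => by
      rw [hev]
      refine ⟨neg_mem ?_, L.innerGen_mem _ _ _ hv.2⟩
      have := M.innerGen_mem i _ _ hv.1
      rwa [← add_assoc] at this)
    (fun v => by
      simp only [hdv, map_neg, map_add, innerDiff_innerDiff, neg_neg, zero_add, hφd]
      simp)
    (fun i v => by simp [hev, innerGen_self])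
    (fun i j v => by
      simp only [hev, map_neg, neg_neg, Prod.mk_add_mk, innerGen_swap]; rfl)
    (fun i v => by
      have h1 := M.innerDiff_innerGen i v.1
      have h2 := L.innerDiff_innerGen i v.2
      simp only [hdv, hev, map_neg, neg_neg, Prod.mk_add_mk, map_add, hφe, h1]
      refine Prod.ext rfl (Eq.trans ?_ h2)
      simp only; abel)
    (fun v hv => by
      have hv1 : M.innerDiff v.1 = 0 := neg_eq_zero.1 (congrArg Prod.fst hv)
      have hv2 : L.innerDiff v.2 + φ.toLin v.1 = 0 := congrArg Prod.snd hv
      have hm : M.diff v.1 = 0 := by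
        have : M.sgn (M.innerDiff v.1) = 0 := by rw [hv1, map_zero]
        simpa [innerDiff, sgn_diff, sgn_sgn] using this
      obtain ⟨m1, l1, hm1, hl1⟩ := hφ v.1 (-L.sgn v.2) hm
        (by rw [map_neg]; exact (neg_eq_of_add_eq_zero_right hv2).symm)
      refine ⟨(-M.sgn m1, l1), ?_⟩
      rw [hdv]
      refine Prod.ext ?_ ?_
      · simp [innerDiff, sgn_sgn, hm1]
      · have := congrArg L.sgn hl1
        simp only [map_sub, map_neg, sgn_sgn, sgn_diff] at this
        simp only [innerDiff, LinearMap.comp_apply, map_neg, φ.map_sgn]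
        have h' : v.2 = -L.sgn (φ.toLin m1) - -L.diff (L.sgn l1) := by rw [← this]; abel
        exact (h'.trans (by abel)).symm)
    (n := n) ((M.evalDual g).coprod (L.evalDual f))
    (fun j v hv => by
      rw [LinearMap.coprod_apply]
      refine add_mem ?_ (hf j _ hv.2)
      have := hg _ _ hv.1
      rwa [show j + -1 + (n + 1) = j + n by ring] at this)
    (LinearMap.ext fun v => by
      rw [hD, hfg, sub_self, hdf, map_zero, map_zero]; simp)
  obtain ⟨a, -, ha⟩ := exists_evalDual_of_mem (M := M) (n := n + 1 + 1)
    (f := G ∘ₗ LinearMap.inl k _ _) (fun j x hx => by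
      have := hGmem (j + 1) (x, 0) ⟨by simpa using hx, zero_mem _⟩
      rwa [show j + 1 + (n + 1) = j + (n + 1 + 1) by ring] at this)
  obtain ⟨b, -, hb⟩ := exists_evalDual_of_mem (M := L) (n := n + 1)
    (f := G ∘ₗ LinearMap.inr k _ _) (fun j x hx => hGmem j (0, x) ⟨zero_mem _, hx⟩)
  have hGab : G = (M.evalDual a).coprod (L.evalDual b) := by
    rw [ha, hb]; exact LinearMap.prod_ext (by ext; simp) (by ext; simp)
  have key : ∀ v : M.carrier × L.carrier,
      M.evalDual (φ.dualMap.toLin b - M.twistedDual.diff a) v.1 +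
        L.evalDual (L.twistedDual.diff b) v.2 = M.evalDual g v.1 + L.evalDual f v.2 := fun v => by
    rw [← hD, ← hGab, hG, LinearMap.coprod_apply]
  refine ⟨b, -a, L.evalDual_injective (LinearMap.ext fun x => ?_),
    M.evalDual_injective (LinearMap.ext fun x => ?_)⟩
  · simpa using key (0, x)
  · have := key (x, 0)
    simp only [map_zero, add_zero] at this
    rw [map_sub, map_neg, map_neg, LinearMap.sub_apply, ← this, map_sub, LinearMap.sub_apply,
      LinearMap.neg_apply]
    abel

end TwistedDual

end DGModule

/-! ### The twisted dual is the dual of the universal resolution -/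

section Gamma

variable {k : Type u} [Field k] {c : ℕ} {w : OddDegrees c}

theorem signMap_tmul {X Y : Type*} [AddCommGroup X] [Module k X] [AddCommGroup Y] [Module k Y]
    {gr : ℤ → Submodule k X} {gr' : ℤ → Submodule k Y} (h : DirectSum.IsInternal gr)
    (h' : DirectSum.IsInternal gr') (x : X) (y : Y) :
    signMap (tensorGr_isInternal h h') (x ⊗ₜ y) = signMap h x ⊗ₜ signMap h' y := by
  induction x using homogeneous_induction h with
  | hom i x hx =>
    induction y using homogeneous_induction h' with
    | hom j y hy =>
      rw [signMap_of_mem _ (tmul_mem_tensorGr hx hy rfl), signMap_of_mem h hx,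
        signMap_of_mem h' hy, Int.negOnePow_add, Units.val_mul, mul_smul]
      simp only [← Int.cast_smul_eq_zsmul k, TensorProduct.smul_tmul, TensorProduct.tmul_smul]
      exact smul_comm _ _ _
    | add y y' hy hy' => rw [TensorProduct.tmul_add, map_add, hy, hy', map_add,
      TensorProduct.tmul_add]
  | add x x' hx hx' => rw [TensorProduct.add_tmul, map_add, hx, hx', map_add,
      TensorProduct.add_tmul]

/-- The functional underlying an element of `Γ`. -/
def gammaVal (k : Type u) [Field k] {c : ℕ} (w : OddDegrees c) :
    Gamma k w →ₗ[k] Module.Dual k (MvPolynomial (Fin c) k) where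
  toFun g := g.1
  map_add' _ _ := rfl
  map_smul' _ _ := rfl

theorem gammaVal_injective : Function.Injective (gammaVal k w) := fun _ _ h => Subtype.ext h

theorem signMap_gamma (g : Gamma k w) : signMap (gammaGr_isInternal k w) g = g := by
  induction g using homogeneous_induction (gammaGr_isInternal k w) with
  | hom n g hg =>
    rw [signMap_of_mem _ hg]
    apply gammaVal_injective
    rw [map_zsmul]
    refine LinearMap.ext fun s => ?_
    rw [LinearMap.smul_apply, ← map_zsmul]
    induction s using homogeneous_induction (DGModule.algebra_isInternal (symGr k w)) with
    | hom i s hs =>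
      by_cases hi : i = -n
      · have := smul_symGr k w hs (1 : MvPolynomial (Fin c) k)
        rw [smul_eq_mul, mul_one, hi, Int.negOnePow_neg] at this
        rw [this]
      · rw [map_zsmul, show gammaVal k w g s = 0 from hg i hi s hs, smul_zero]
    | add s t hs ht => rw [smul_add, map_add, map_add, hs, ht]
  | add x y hx hy => rw [map_add, hx, hy]

/-- The augmentation of `Λ` vanishes outside degree zero. -/
theorem algebraMapInv_eq_zero {n : ℤ} (hn : n ≠ 0) {a : ExteriorAlgebra k (Fin c → k)}
    (ha : a ∈ extGr k w n) : ExteriorAlgebra.algebraMapInv a = 0 := by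
  induction ha using Submodule.span_induction with
  | mem a ha =>
    obtain ⟨l, hl, rfl⟩ := ha
    cases l with
    | nil => exact absurd hl.symm hn
    | cons i l =>
      rw [List.map_cons, List.prod_cons, map_mul, extGen]
      simp [ExteriorAlgebra.algebraMapInv]
  | zero => exact map_zero _
  | add a b _ _ ha hb => rw [map_add, ha, hb, add_zero]
  | smul t a _ ha => rw [map_smul, ha, smul_zero]

theorem algebraMapInv_extGen_mul (i : Fin c) (a : ExteriorAlgebra k (Fin c → k)) :
    ExteriorAlgebra.algebraMapInv (extGen k i * a) = 0 := by
  rw [map_mul, extGen]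
  simp [ExteriorAlgebra.algebraMapInv]

theorem monomial_mem_symGr (w : OddDegrees c) (d : Fin c →₀ ℕ) (a : k) :
    MvPolynomial.monomial d a ∈
      symGr k w (Finsupp.weight (fun i => -(((w i : ℕ) : ℤ) + 1)) d) :=
  MvPolynomial.isWeightedHomogeneous_monomial _ _ _ rfl

/-- The coefficient of a monomial, as an element of `Γ`. -/
def gammaCoeff (k : Type u) [Field k] {c : ℕ} (w : OddDegrees c) (d : Fin c →₀ ℕ) : Gamma k w :=
  ⟨MvPolynomial.lcoeff k d, Submodule.mem_iSup_of_mem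
    (-Finsupp.weight (fun i => -(((w i : ℕ) : ℤ) + 1)) d) fun i hi s hs => by
      by_contra h
      have hs : MvPolynomial.IsWeightedHomogeneous (fun i => -(((w i : ℕ) : ℤ) + 1)) s i := hs
      exact hi (by rw [hs h, neg_neg])⟩

theorem gammaVal_gammaCoeff (d : Fin c →₀ ℕ) (s : MvPolynomial (Fin c) k) :
    gammaVal k w (gammaCoeff k w d) s = s.coeff d := rfl

/-- The lower degree of a monomial is the negative of its upper degree. -/
theorem weight_eq_neg (w : OddDegrees c) (d : Fin c →₀ ℕ) :
    ((Finsupp.weight (fun i => (w i : ℕ) + 1) d : ℕ) : ℤ) =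
      - Finsupp.weight (fun i => -(((w i : ℕ) : ℤ) + 1)) d := by
  rw [Finsupp.weight_apply, Finsupp.weight_apply, Finsupp.sum, Finsupp.sum,
    ← Finset.sum_neg_distrib, Nat.cast_sum]
  refine Finset.sum_congr rfl fun i _ => ?_
  simp only [smul_eq_mul, nsmul_eq_mul]
  push_cast
  ring

theorem finite_weight_eq (w : OddDegrees c) (n : ℤ) :
    {d : Fin c →₀ ℕ | Finsupp.weight (fun i => -(((w i : ℕ) : ℤ) + 1)) d = n}.Finite := by
  refine (Finsupp.finite_of_nat_weight_le (fun i => (w i : ℕ) + 1) (fun i => by omega)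
    (-n).toNat).subset fun d hd => ?_
  have hd : Finsupp.weight (fun i => -(((w i : ℕ) : ℤ) + 1)) d = n := hd
  have := weight_eq_neg w d
  show Finsupp.weight (fun i => (w i : ℕ) + 1) d ≤ (-n).toNat
  omega

end Gamma

namespace DGModule

section DualOfUniversal

variable {k : Type u} [Field k] {c : ℕ} {w : OddDegrees c} (M : DGModule (extGr k w))

/-- The functional `a ⊗ γ ⊗ m ↦ ε(a) γ(f m)` on `Λ ⊗ Γ ⊗ M`. -/
def uFunctional : (M.carrier →ₗ[k] MvPolynomial (Fin c) k) →ₗ[k] Module.Dual k M.UCarrier where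
  toFun f := LinearMap.mul' k k ∘ₗ TensorProduct.map ExteriorAlgebra.algebraMapInv.toLinearMap
    (TensorProduct.lift ((gammaVal k w).compl₂ f))
  map_add' f g := by
    refine TensorProduct.ext' fun a z => ?_
    induction z using TensorProduct.induction_on with
    | zero => simp
    | add x y hx hy => rw [TensorProduct.tmul_add, map_add, map_add, hx, hy]
    | tmul γ m => simp [mul_add]
  map_smul' t f := by
    refine TensorProduct.ext' fun a z => ?_
    induction z using TensorProduct.induction_on with
    | zero => simp
    | add x y hx hy => rw [TensorProduct.tmul_add, map_add, map_add, hx, hy]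
    | tmul γ m => simp [mul_left_comm]

theorem uFunctional_tmul (f : M.carrier →ₗ[k] MvPolynomial (Fin c) k)
    (a : ExteriorAlgebra k (Fin c → k)) (γ : Gamma k w) (m : M.carrier) :
    M.uFunctional f (a ⊗ₜ (γ ⊗ₜ m)) = ExteriorAlgebra.algebraMapInv a * gammaVal k w γ (f m) := rfl

variable {M} in
/-- Two functionals on `Λ ⊗ Γ ⊗ M` agree if they agree on homogeneous pure tensors. -/
theorem uDual_ext {f g : Module.Dual k M.UCarrier}
    (h : ∀ a, ∀ r, ∀ γ ∈ gammaGr k w r, ∀ j, ∀ m ∈ M.gr j,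
      f (a ⊗ₜ (γ ⊗ₜ m)) = g (a ⊗ₜ (γ ⊗ₜ m))) : f = g := by
  refine TensorProduct.ext' fun a z => ?_
  induction z using TensorProduct.induction_on with
  | zero => simp
  | add x y hx hy => rw [TensorProduct.tmul_add, map_add, map_add, hx, hy]
  | tmul γ m =>
    induction γ using homogeneous_induction (gammaGr_isInternal k w) with
    | hom r γ hγ =>
      induction m using homogeneous_induction M.isInternal with
      | hom j m hm => exact h a r γ hγ j m hm
      | add x y hx hy =>
        rw [TensorProduct.tmul_add, TensorProduct.tmul_add, map_add, map_add, hx, hy]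
    | add x y hx hy =>
      rw [TensorProduct.add_tmul, TensorProduct.tmul_add, map_add, map_add, hx, hy]

variable {M} in
theorem uFunctional_mem {n : ℤ} {f : M.carrier →ₗ[k] MvPolynomial (Fin c) k}
    (hf : f ∈ symMapGr w M.gr n) : M.uFunctional f ∈ M.universalResolution.homGr n := by
  refine ⟨fun j hj x hx => ?_, fun b x => ?_⟩
  · have key : ∀ x ∈ M.uGr j, M.uFunctional f x = 0 := by
      intro x hx
      induction hx using Submodule.span_induction with
      | mem x hx =>
        obtain ⟨p, q, rfl, a, ha, z, hz, rfl⟩ := hx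
        induction hz using Submodule.span_induction with
        | mem z hz =>
          obtain ⟨r, s, rfl, γ, hγ, m, hm, rfl⟩ := hz
          rw [uFunctional_tmul]
          by_cases hp : p = 0
          · have : gammaVal k w γ (f m) = 0 := hγ _ (fun e => hj (by omega)) _ (hf s m hm)
            rw [this, mul_zero]
          · rw [algebraMapInv_eq_zero hp ha, zero_mul]
        | zero => simp
        | add x y _ _ hx hy => rw [TensorProduct.tmul_add, map_add, hx, hy, add_zero]
        | smul t x _ hx => rw [TensorProduct.tmul_smul, map_smul, hx, smul_zero]
      | zero => simp
      | add x y _ _ hx hy => rw [map_add, hx, hy, add_zero]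
      | smul t x _ hx => rw [map_smul, hx, smul_zero]
    exact key x hx
  · refine LinearMap.congr_fun (f := M.uFunctional f ∘ₗ M.uAct b)
      (g := ExteriorAlgebra.algebraMapInv b • M.uFunctional f)
      (uDual_ext fun a r γ _ j m _ => ?_) x
    rw [LinearMap.comp_apply, uAct_tmul, LinearMap.smul_apply, uFunctional_tmul, uFunctional_tmul,
      map_mul, smul_eq_mul, mul_assoc]

theorem sgn_universalResolution (a : ExteriorAlgebra k (Fin c → k)) (γ : Gamma k w)
    (m : M.carrier) :
    M.universalResolution.sgn (a ⊗ₜ (γ ⊗ₜ m)) = (extSgn k w a ⊗ₜ (γ ⊗ₜ M.sgn m) : M.UCarrier) := by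
  refine (signMap_tmul (extGr_isInternal k w)
    (tensorGr_isInternal (gammaGr_isInternal k w) M.isInternal) a (γ ⊗ₜ m)).trans ?_
  rw [signMap_tmul (gammaGr_isInternal k w) M.isInternal, signMap_gamma]; rfl

theorem uFunctional_twistedD (f : M.carrier →ₗ[k] MvPolynomial (Fin c) k) :
    M.uFunctional (twistedD M.innerDiff M.innerGen f) =
      M.uFunctional f ∘ₗ M.universalResolution.signedDiff := by
  refine uDual_ext fun a r γ _ j m _ => ?_
  have h : M.universalResolution.signedDiff (a ⊗ₜ (γ ⊗ₜ m)) =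
      M.uDiff (extSgn k w a ⊗ₜ (γ ⊗ₜ M.sgn m)) :=
    congrArg M.uDiff (M.sgn_universalResolution a γ m)
  refine Eq.trans ?_ (congrArg (M.uFunctional f) h).symm
  rw [uDiff, LinearMap.add_apply, LinearMap.sum_apply, map_add, map_sum, uInner_tmul,
    uFunctional_tmul, uFunctional_tmul, extSgn_extSgn, twistedD_apply, map_add, mul_add, map_sum,
    Finset.mul_sum]
  congr 1
  refine Finset.sum_congr rfl fun i _ => ?_
  rw [uTwist_tmul, map_sub, uFunctional_tmul, uFunctional_tmul, algebraMapInv_extGen_mul, zero_mul,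
    sub_zero, extSgn_extSgn]
  rfl

/-- The comparison morphism from the twisted dual of `M` to the dual of the universal resolution. -/
def twistedDualToBgg : Hom M.twistedDual M.bgg where
  toLin :=
    { toFun := fun f => ⟨M.uFunctional (M.evalDual f), by
        have h := M.evalDual_mem f
        generalize M.evalDual f = f at h
        induction h using Submodule.iSup_induction' with
        | mem n f hf => exact Submodule.mem_iSup_of_mem n (uFunctional_mem hf)
        | zero => rw [map_zero]; exact zero_mem _
        | add f g _ _ hf hg => rw [map_add]; exact add_mem hf hg⟩
      map_add' := fun f g => Subtype.ext
        ((congrArg M.uFunctional (map_add M.evalDual f g)).trans (map_add M.uFunctional _ _))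
      map_smul' := fun s f => Subtype.ext
        (show M.uFunctional (s • M.evalDual f) = M.uFunctional (M.evalDual f) ∘ₗ M.uSym s from
          uDual_ext fun a r γ _ j m _ => rfl) }
  map_mem hf := uFunctional_mem hf
  map_diff f := Subtype.ext (M.uFunctional_twistedD (M.evalDual f))

theorem twistedDualToBgg_injective : Function.Injective M.twistedDualToBgg.toLin := by
  refine (injective_iff_map_eq_zero _).2 fun f hf => ?_
  have hf : M.uFunctional (M.evalDual f) = 0 := congrArg Subtype.val hf
  apply M.evalDual_injective
  rw [map_zero]
  refine LinearMap.ext fun m => MvPolynomial.ext _ _ fun d => ?_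
  have := LinearMap.congr_fun hf (1 ⊗ₜ (gammaCoeff k w d ⊗ₜ m))
  rwa [uFunctional_tmul, map_one, one_mul, gammaVal_gammaCoeff] at this

variable {M} in
/-- Every homogeneous `Λ`-linear functional on `Λ ⊗ Γ ⊗ M` comes from a homogeneous map `M → S`,
whose coefficients are the values of the functional at the elements of `Γ` dual to the monomials.
On a homogeneous element only finitely many coefficients are nonzero. -/
theorem exists_uFunctional_eq {n : ℤ} {F : Module.Dual k M.UCarrier}
    (hF : F ∈ M.universalResolution.homGr n) : ∃ f ∈ symMapGr w M.gr n, M.uFunctional f = F := by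
  have hF1 : ∀ p, p ≠ -n → ∀ x ∈ M.uGr p, F x = 0 := hF.1
  have hF2 : ∀ (a : ExteriorAlgebra k (Fin c → k)) (z : Gamma k w ⊗[k] M.carrier),
      F (a ⊗ₜ z) = ExteriorAlgebra.algebraMapInv a * F (1 ⊗ₜ z) := fun a z => by
    have : F (M.uAct a (1 ⊗ₜ z)) = ExteriorAlgebra.algebraMapInv a * F (1 ⊗ₜ z) := hF.2 a (1 ⊗ₜ z)
    rwa [uAct_tmul, mul_one] at this
  let D : ℤ → Finset (Fin c →₀ ℕ) := fun j => (finite_weight_eq w (j + n)).toFinset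
  have hD : ∀ j d, d ∈ D j ↔ Finsupp.weight (fun i => -(((w i : ℕ) : ℤ) + 1)) d = j + n :=
    fun j d => by simp [D]
  let co : Gamma k w → M.carrier →ₗ[k] k := fun γ =>
    F ∘ₗ TensorProduct.mk k (ExteriorAlgebra k (Fin c → k)) (Gamma k w ⊗[k] M.carrier) 1 ∘ₗ
      TensorProduct.mk k (Gamma k w) M.carrier γ
  have hco : ∀ γ m, co γ m = F (1 ⊗ₜ (γ ⊗ₜ m)) := fun _ _ => rfl
  let f : M.carrier →ₗ[k] MvPolynomial (Fin c) k := gluedMap M.isInternal fun j =>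
    ∑ d ∈ D j, MvPolynomial.monomial d ∘ₗ co (gammaCoeff k w d)
  have hf : ∀ j, ∀ m ∈ M.gr j, f m =
      ∑ d ∈ D j, MvPolynomial.monomial d (co (gammaCoeff k w d) m) := fun j m hm => by
    rw [gluedMap_of_mem _ _ hm, LinearMap.sum_apply]; rfl
  refine ⟨f, fun j m hm => ?_, uDual_ext fun a r γ hγ j m hm => ?_⟩
  · rw [hf j m hm]
    refine sum_mem fun d hd => ?_
    rw [← (hD j d).1 hd]
    exact monomial_mem_symGr w d _
  · rw [uFunctional_tmul, hF2, hf j m hm, map_sum]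
    congr 1
    have hmon : ∀ d (t : k), gammaVal k w γ (MvPolynomial.monomial d t) =
        t * gammaVal k w γ (MvPolynomial.monomial d 1) := fun d t => by
      rw [← smul_eq_mul, ← map_smul, MvPolynomial.smul_monomial, smul_eq_mul, mul_one]
    have hγd : ∀ d, Finsupp.weight (fun i => -(((w i : ℕ) : ℤ) + 1)) d ≠ -r →
        gammaVal k w γ (MvPolynomial.monomial d 1) = 0 :=
      fun d hd => hγ _ hd _ (monomial_mem_symGr w d 1)
    by_cases hr : j + n = -r
    · have : γ = ∑ d ∈ D j, gammaVal k w γ (MvPolynomial.monomial d 1) • gammaCoeff k w d := by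
        apply gammaVal_injective
        rw [map_sum]
        refine (MvPolynomial.basisMonomials (Fin c) k).ext fun e => ?_
        rw [MvPolynomial.coe_basisMonomials, LinearMap.sum_apply]
        simp only [map_smul, LinearMap.smul_apply, gammaVal_gammaCoeff, MvPolynomial.coeff_monomial,
          smul_eq_mul, mul_ite, mul_zero]
        rw [Finset.sum_ite_eq]
        split_ifs with he
        · rw [mul_one]
        · exact hγd e fun h => he ((hD j e).2 (by rw [h, hr]))
      conv_rhs => rw [this]
      rw [TensorProduct.sum_tmul, TensorProduct.tmul_sum, map_sum]
      refine Finset.sum_congr rfl fun d _ => ?_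
      rw [hmon, ← TensorProduct.smul_tmul', TensorProduct.tmul_smul, map_smul, hco, smul_eq_mul,
        mul_comm]
    · rw [hF1 (r + j) (fun e => hr (by omega)) _ (tmul_mem_tensorGr SetLike.GradedOne.one_mem
        (tmul_mem_tensorGr hγ hm rfl) (zero_add _))]
      refine Finset.sum_eq_zero fun d hd => ?_
      rw [hmon, hγd d (fun h => hr (by rw [← (hD j d).1 hd, h])), mul_zero]

theorem twistedDualToBgg_surjective : Function.Surjective M.twistedDualToBgg.toLin := by
  rintro ⟨F, hF⟩
  have key : ∃ f ∈ ⨆ n, symMapGr w M.gr n, M.uFunctional f = F := by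
    induction hF using Submodule.iSup_induction' with
    | mem n F hF =>
      obtain ⟨f, hf, h⟩ := exists_uFunctional_eq hF
      exact ⟨f, Submodule.mem_iSup_of_mem n hf, h⟩
    | zero => exact ⟨0, zero_mem _, map_zero _⟩
    | add F G _ _ hF hG =>
      obtain ⟨f, hf, rfl⟩ := hF
      obtain ⟨g, hg, rfl⟩ := hG
      exact ⟨f + g, add_mem hf hg, map_add _ _ _⟩
  obtain ⟨f, hf, h⟩ := key
  obtain ⟨g, rfl⟩ := exists_evalDual hf
  exact ⟨g, Subtype.ext h⟩

theorem twistedDualToBgg_bijective : Function.Bijective M.twistedDualToBgg.toLin :=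
  ⟨M.twistedDualToBgg_injective, M.twistedDualToBgg_surjective⟩

end DualOfUniversal

end DGModule

/-! ### Semifree twisted duals and their tensor products -/

namespace DGModule

section DualBasis

variable {k : Type u} [Field k] {c : ℕ} {w : OddDegrees c}

theorem repr_eq_zero_of_mem {V J : Type*} [AddCommGroup V] [Module k V] {gr : ℤ → Submodule k V}
    (h : DirectSum.IsInternal gr) (b : Module.Basis J k V) {deg : J → ℤ}
    (hb : ∀ j, b j ∈ gr (deg j)) {n : ℤ} {x : V} (hx : x ∈ gr n) {j : J} (hj : deg j ≠ n) :
    b.repr x j = 0 := by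
  classical
  have key : ∀ x, b.repr (component h n x) j = 0 := by
    intro x
    rw [← b.linearCombination_repr x]
    induction b.repr x using Finsupp.induction_linear with
    | zero => simp
    | add f g hf hg => rw [map_add, map_add, map_add, Finsupp.add_apply, hf, hg, add_zero]
    | single i t =>
      rw [Finsupp.linearCombination_single, map_smul, map_smul, Finsupp.smul_apply]
      by_cases hi : deg i = n
      · rw [component_of_mem h (hi ▸ hb i), b.repr_self, Finsupp.single_apply, if_neg, smul_zero]
        rintro rfl
        exact hj hi
      · rw [component_of_mem_ne h (hb i) hi]; simp
  rw [← component_of_mem h hx, key]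

variable {M : DGModule (extGr k w)} {J : Type u} (b : Module.Basis J k M.carrier) {deg : J → ℤ}
  (hb : ∀ j, b j ∈ M.gr (deg j)) (hfin : ∀ t, {j | deg j ≤ t}.Finite)

theorem sgn_of_mem {A : Type u} [Ring A] [Algebra k A] {𝒜 : ℤ → Submodule k A} [GradedAlgebra 𝒜]
    (X : DGModule 𝒜) {n : ℤ} {x : X.carrier} (hx : x ∈ X.gr n) :
    X.sgn x = (n.negOnePow : ℤ) • x := signMap_of_mem _ hx

theorem finite_support_evalDual (hb : ∀ j, b j ∈ M.gr (deg j))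
    (hfin : ∀ t, {j | deg j ≤ t}.Finite) (f : M.twistedDual.carrier) :
    (Function.support fun j => M.evalDual f (b j)).Finite := by
  have hf := M.evalDual_mem f
  generalize M.evalDual f = f at hf
  induction hf using Submodule.iSup_induction' with
  | mem n f hf =>
    refine (hfin (-n)).subset fun j hj => ?_
    by_contra h
    refine hj (eq_zero_of_mem_symGr ?_ (hf _ _ (hb j)))
    have : ¬ deg j ≤ -n := h
    omega
  | zero => simp
  | add f g _ _ hf hg =>
    exact (hf.union hg).subset (Function.support_add (fun j => f (b j)) fun j => g (b j))

theorem constr_mem_symMapGr (hb : ∀ j, b j ∈ M.gr (deg j)) {n : ℤ} (g : J → MvPolynomial (Fin c) k)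
    (hg : ∀ j, g j ∈ symGr k w (deg j + n)) : b.constr k g ∈ symMapGr w M.gr n := by
  intro i x hx
  rw [Module.Basis.constr_apply]
  refine sum_mem fun j hj => Submodule.smul_mem _ _ ?_
  have : deg j = i := by
    by_contra h
    exact Finsupp.mem_support_iff.1 hj (repr_eq_zero_of_mem M.isInternal b hb hx h)
  exact this ▸ hg j

theorem constr_mem_iSup (hb : ∀ j, b j ∈ M.gr (deg j)) (g : J →₀ MvPolynomial (Fin c) k) :
    b.constr k g ∈ ⨆ n, symMapGr w M.gr n := by
  classical
  have e : ∀ (g g' : J → MvPolynomial (Fin c) k),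
    b.constr k (g + g') = b.constr k g + b.constr k g' := fun g g' => map_add _ _ _
  induction g using Finsupp.induction_linear with
  | zero =>
    exact (show b.constr k (0 : J → MvPolynomial (Fin c) k) = 0 from map_zero _) ▸ zero_mem _
  | add g g' hg hg' => rw [Finsupp.coe_add, e]; exact add_mem hg hg'
  | single j s =>
    induction s using homogeneous_induction (algebra_isInternal (symGr k w)) with
    | hom i s hs =>
      refine Submodule.mem_iSup_of_mem (i - deg j) (constr_mem_symMapGr b hb _ fun j' => ?_)
      rw [Finsupp.single_apply]
      split_ifs with h
      · subst h; rwa [add_sub_cancel]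
      · exact zero_mem _
    | add s t hs ht => rw [Finsupp.single_add, Finsupp.coe_add, e]; exact add_mem hs ht

/-- The basis of the twisted dual that is dual to a homogeneous basis of `M`, when only finitely
many basis elements have degree below any given bound. -/
def dualBasis : Module.Basis J (MvPolynomial (Fin c) k) M.twistedDual.carrier :=
  Module.Basis.ofRepr
    { toFun := fun f => Finsupp.ofSupportFinite _ (finite_support_evalDual b hb hfin f)
      map_add' := fun _ _ => Finsupp.ext fun _ => rfl
      map_smul' := fun _ _ => Finsupp.ext fun _ => rfl
      invFun := fun g => ⟨b.constr k g, constr_mem_iSup b hb g⟩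
      left_inv := fun _ => M.evalDual_injective (b.ext fun j => b.constr_basis k _ j)
      right_inv := fun g => Finsupp.ext fun j => b.constr_basis k g j }

theorem dualBasis_repr (f : M.twistedDual.carrier) (j : J) :
    (dualBasis b hb hfin).repr f j = M.evalDual f (b j) := rfl

theorem evalDual_dualBasis [DecidableEq J] (i j : J) :
    M.evalDual (dualBasis b hb hfin i) (b j) = if i = j then 1 else 0 := by
  rw [← dualBasis_repr b hb hfin, Module.Basis.repr_self, Finsupp.single_apply]

theorem dualBasis_mem (j : J) : dualBasis b hb hfin j ∈ M.twistedDual.gr (-deg j) := by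
  classical
  rw [mem_twistedDual_gr]
  have : M.evalDual (dualBasis b hb hfin j) = b.constr k fun i => if j = i then 1 else 0 :=
    b.ext fun i => by rw [evalDual_dualBasis, b.constr_basis]
  rw [this]
  refine constr_mem_symMapGr b hb _ fun i => ?_
  split_ifs with h
  · subst h; rw [add_neg_cancel]; exact SetLike.GradedOne.one_mem
  · exact zero_mem _

/-- `M` is bounded below and finite-dimensional in each degree. -/
def IsFiniteType (M : DGModule (extGr k w)) : Prop :=
  (∀ n, Module.Finite k (M.gr n)) ∧ ∃ b, ∀ n < b, M.gr n = ⊥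

theorem IsFiniteType.finite_deg_le (hM : M.IsFiniteType) (b : Module.Basis J k M.carrier)
    {deg : J → ℤ} (hb : ∀ j, b j ∈ M.gr (deg j)) (t : ℤ) : {j | deg j ≤ t}.Finite := by
  obtain ⟨h1, b0, h2⟩ := hM
  have h3 : ∀ n, {j | deg j = n}.Finite := fun n => by
    have := h1 n
    have hli : LinearIndependent k
        (fun j : {j // deg j = n} => (⟨b j, by have := hb j; rwa [j.2] at this⟩ : M.gr n)) :=
      LinearIndependent.of_comp (M.gr n).subtype
        (b.linearIndependent.comp (fun j : {j // deg j = n} => (j : J)) Subtype.val_injective)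
    have : Finite {j | deg j = n} := hli.finite_of_isNoetherian
    exact Set.toFinite {j | deg j = n}
  refine ((Set.finite_Icc b0 t).biUnion fun n _ => h3 n).subset fun j hj => ?_
  refine Set.mem_biUnion (x := deg j) ⟨?_, hj⟩ rfl
  by_contra h
  exact b.ne_zero j ((Submodule.mem_bot k).1 (h2 _ (not_le.1 h) ▸ hb j))

/-- The twisted dual of a dg module of finite type is semifree. In a homogeneous basis adapted to
the cycles, the operators `e_i` raise the degree and preserve the cycles, and the differential
lowers the degree by one and maps the other basis elements to cycles, so that raising the degree of
the cycles by two turns both into maps that raise the level. -/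
theorem IsFiniteType.exists_triangularBasis (hM : M.IsFiniteType) :
    ∃ (J : Type u) (b : Module.Basis J k M.carrier) (deg : J → ℤ) (hb : ∀ j, b j ∈ M.gr (deg j))
      (T : M.twistedDual.TriangularBasis J),
      T.basis = dualBasis b hb (hM.finite_deg_le b hb) := by
  classical
  obtain ⟨J, b, deg, cyc, hb, hcyc, hrepr⟩ := exists_cycle_basis M.isInternal M.diff
    fun n x hx => M.diff_mem hx
  obtain ⟨b0, hb0⟩ := hM.2
  have hdeg : ∀ j, b0 ≤ deg j := fun j => by
    by_contra h
    exact b.ne_zero j ((Submodule.mem_bot k).1 (hb0 _ (not_le.1 h) ▸ hb j))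
  let level : J → ℕ := fun j => (deg j - b0 + if cyc j then 2 else 0).toNat
  have hfin := hM.finite_deg_le b hb
  have hval : ∀ j (x : M.carrier), b.repr x j = 0 →
      M.evalDual (dualBasis b hb hfin j) x = 0 := fun j x hx => by
    conv_lhs => rw [← b.linearCombination_repr x, Finsupp.linearCombination_apply, Finsupp.sum,
      map_sum]
    refine Finset.sum_eq_zero fun i _ => ?_
    rw [map_smul, evalDual_dualBasis]
    split_ifs with h
    · rw [← h, hx, zero_smul]
    · rw [smul_zero]
  have hsgn : ∀ i, M.sgn (b i) = ((deg i).negOnePow : ℤ) • b i := fun i =>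
    signMap_of_mem _ (hb i)
  refine ⟨J, b, deg, hb, ⟨dualBasis b hb hfin, fun j => -deg j, level,
    dualBasis_mem b hb hfin, fun j i hji => ?_⟩, rfl⟩
  rw [dualBasis_repr, evalDual_diff, twistedD_apply]
  have h1 : M.evalDual (dualBasis b hb hfin j) (M.innerDiff (b i)) = 0 := by
    apply hval
    by_cases hi : cyc i
    · rw [innerDiff, LinearMap.comp_apply, hsgn, map_zsmul, hcyc i hi]; simp
    · by_cases hj : cyc j
      · by_cases hd : deg j = deg i - 1
        · exfalso
          have := hdeg i
          simp only [level, hi, hj, if_true, if_false] at hji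
          omega
        · exact repr_eq_zero_of_mem M.isInternal b hb (M.innerDiff_mem _ _ (hb i)) hd
      · exact hrepr _ (M.diff_diff _) j hj
  have h2 : ∀ l, M.evalDual (dualBasis b hb hfin j) (M.innerGen l (b i)) = 0 := fun l => by
    apply hval
    by_cases hd : deg j = (w l : ℕ) + deg i
    · by_cases h : cyc i ∧ ¬ cyc j
      · refine hrepr _ ?_ j h.2
        rw [innerGen, LinearMap.comp_apply, act_apply, diff_gen, hsgn, map_zsmul, hcyc i h.1]
        simp
      · exfalso
        have := hdeg i
        have := (w l).2.pos
        simp only [level] at hji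
        split_ifs at hji <;> first | omega | tauto
    · exact repr_eq_zero_of_mem M.isInternal b hb (M.innerGen_mem l _ _ (hb i)) hd
  rw [h1, zero_add]
  exact Finset.sum_eq_zero fun l _ => by rw [h2, mul_zero]

theorem IsFiniteType.isSemifree (hM : M.IsFiniteType) : M.twistedDual.IsSemifree := by
  obtain ⟨J, -, -, -, T, -⟩ := hM.exists_triangularBasis
  exact T.isSemifree

end DualBasis

section Multiplication

variable {k : Type u} [Field k] {c : ℕ} {w : OddDegrees c} (M N : DGModule (extGr k w))

/-- The operator `m ⊗ n ↦ (-1)^(|m| |n|) m ⊗ n`. -/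
def koszulSign : M.carrier ⊗[k] N.carrier →ₗ[k] M.carrier ⊗[k] N.carrier :=
  TensorProduct.lift (gluedMap M.isInternal fun j =>
    if Even j then TensorProduct.mk k M.carrier N.carrier
    else (TensorProduct.mk k M.carrier N.carrier).compl₂ N.sgn)

variable {M N}

theorem koszulSign_even {p : ℤ} (hp : Even p) {m : M.carrier} (hm : m ∈ M.gr p) (n : N.carrier) :
    koszulSign M N (m ⊗ₜ n) = m ⊗ₜ n := by
  rw [koszulSign, TensorProduct.lift.tmul, gluedMap_of_mem _ _ hm, if_pos hp]; rfl

theorem koszulSign_odd {p : ℤ} (hp : ¬ Even p) {m : M.carrier} (hm : m ∈ M.gr p) (n : N.carrier) :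
    koszulSign M N (m ⊗ₜ n) = m ⊗ₜ N.sgn n := by
  rw [koszulSign, TensorProduct.lift.tmul, gluedMap_of_mem _ _ hm, if_neg hp]; rfl

/-- The map `m ⊗ n ↦ (-1)^(|m| |n|) f(m) g(n)`. -/
def mulMap : (M.carrier →ₗ[k] MvPolynomial (Fin c) k) →ₗ[MvPolynomial (Fin c) k]
    (N.carrier →ₗ[k] MvPolynomial (Fin c) k) →ₗ[MvPolynomial (Fin c) k]
      (M.carrier ⊗[k] N.carrier →ₗ[k] MvPolynomial (Fin c) k) :=
  LinearMap.mk₂ _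
    (fun f g => LinearMap.mul' k (MvPolynomial (Fin c) k) ∘ₗ TensorProduct.map f g ∘ₗ
      koszulSign M N)
    (fun f f' g => by rw [TensorProduct.map_add_left, LinearMap.add_comp, LinearMap.comp_add])
    (fun s f g => by
      have : LinearMap.mul' k (MvPolynomial (Fin c) k) ∘ₗ TensorProduct.map (s • f) g =
          s • (LinearMap.mul' k (MvPolynomial (Fin c) k) ∘ₗ TensorProduct.map f g) :=
        TensorProduct.ext' fun m n => mul_assoc s (f m) (g n)
      rw [← LinearMap.comp_assoc, this]; rfl)
    (fun f g g' => by rw [TensorProduct.map_add_right, LinearMap.add_comp, LinearMap.comp_add])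
    (fun s f g => by
      have : LinearMap.mul' k (MvPolynomial (Fin c) k) ∘ₗ TensorProduct.map f (s • g) =
          s • (LinearMap.mul' k (MvPolynomial (Fin c) k) ∘ₗ TensorProduct.map f g) :=
        TensorProduct.ext' fun m n => mul_left_comm (f m) s (g n)
      rw [← LinearMap.comp_assoc, this]; rfl)

theorem mulMap_even {p : ℤ} (hp : Even p) (f : M.carrier →ₗ[k] MvPolynomial (Fin c) k)
    (g : N.carrier →ₗ[k] MvPolynomial (Fin c) k) {m : M.carrier} (hm : m ∈ M.gr p)
    (n : N.carrier) : mulMap f g (m ⊗ₜ n) = f m * g n := by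
  have : mulMap f g (m ⊗ₜ n) = LinearMap.mul' k (MvPolynomial (Fin c) k)
    (TensorProduct.map f g (koszulSign M N (m ⊗ₜ n))) := rfl
  rw [this, koszulSign_even hp hm]; rfl

theorem mulMap_odd {p : ℤ} (hp : ¬ Even p) (f : M.carrier →ₗ[k] MvPolynomial (Fin c) k)
    (g : N.carrier →ₗ[k] MvPolynomial (Fin c) k) {m : M.carrier} (hm : m ∈ M.gr p)
    (n : N.carrier) : mulMap f g (m ⊗ₜ n) = f m * g (N.sgn n) := by
  have : mulMap f g (m ⊗ₜ n) = LinearMap.mul' k (MvPolynomial (Fin c) k)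
    (TensorProduct.map f g (koszulSign M N (m ⊗ₜ n))) := rfl
  rw [this, koszulSign_odd hp hm]; rfl

theorem mulMap_mem {a b : ℤ} {f : M.carrier →ₗ[k] MvPolynomial (Fin c) k}
    {g : N.carrier →ₗ[k] MvPolynomial (Fin c) k} (hf : f ∈ symMapGr w M.gr a)
    (hg : g ∈ symMapGr w N.gr b) : mulMap f g ∈ symMapGr w (tensorGr M.gr N.gr) (a + b) := by
  intro j x hx
  induction hx using Submodule.span_induction with
  | mem x hx =>
    obtain ⟨p, q, rfl, m, hm, n, hn, rfl⟩ := hx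
    rw [show p + q + (a + b) = (p + a) + (q + b) by ring]
    by_cases hp : Even p
    · rw [mulMap_even hp f g hm]
      exact SetLike.GradedMul.mul_mem (hf p m hm) (hg q n hn)
    · rw [mulMap_odd hp f g hm]
      exact SetLike.GradedMul.mul_mem (hf p m hm) (hg q _ (N.sgn_mem hn))
  | zero => rw [map_zero]; exact zero_mem _
  | add x y _ _ hx hy => rw [map_add]; exact add_mem hx hy
  | smul t x _ hx => rw [map_smul]; exact Submodule.smul_mem _ _ hx

/-- The Leibniz rule for operators of odd degree. -/
theorem mulMap_comp (f : M.carrier →ₗ[k] MvPolynomial (Fin c) k)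
    (g : N.carrier →ₗ[k] MvPolynomial (Fin c) k) (α : M.carrier →ₗ[k] M.carrier)
    (β : N.carrier →ₗ[k] N.carrier)
    (hα : ∀ p, ∀ m ∈ M.gr p, ∃ q, α m ∈ M.gr q ∧ (Even q ↔ ¬ Even p))
    (hβ : ∀ n, N.sgn (β n) = - β (N.sgn n)) (x : M.carrier ⊗[k] N.carrier) :
    mulMap f g (TensorProduct.map α N.sgn x + TensorProduct.map LinearMap.id β x) =
      mulMap (f ∘ₗ α) g x + mulMap (f ∘ₗ M.sgn) (g ∘ₗ β) x := by
  have H : mulMap f g ∘ₗ (TensorProduct.map α N.sgn + TensorProduct.map LinearMap.id β) =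
      mulMap (f ∘ₗ α) g + mulMap (f ∘ₗ M.sgn) (g ∘ₗ β) := by
    refine TensorProduct.ext (linearMap_ext_homogeneous M.isInternal fun p m hm =>
      LinearMap.ext fun n => ?_)
    obtain ⟨q, hq, hpq⟩ := hα p m hm
    refine (LinearMap.map_add (mulMap f g) (α m ⊗ₜ N.sgn n) (m ⊗ₜ β n)).trans ?_
    show _ = mulMap (f ∘ₗ α) g (m ⊗ₜ n) + mulMap (f ∘ₗ M.sgn) (g ∘ₗ β) (m ⊗ₜ n)
    by_cases hp : Even p
    · have hm' : M.sgn m = m := by rw [M.sgn_of_mem hm, Int.negOnePow_even _ hp]; simp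
      have a1 := mulMap_odd (fun h => hpq.1 h hp) f g hq (N.sgn n)
      have a2 := mulMap_even hp f g hm (β n)
      have a3 := mulMap_even hp (f ∘ₗ α) g hm n
      have a4 := mulMap_even hp (f ∘ₗ M.sgn) (g ∘ₗ β) hm n
      rw [N.sgn_sgn] at a1
      rw [LinearMap.comp_apply] at a3
      rw [LinearMap.comp_apply, LinearMap.comp_apply, hm'] at a4
      rw [a1, a2, a3, a4]
    · have hm' : M.sgn m = -m := by
        rw [M.sgn_of_mem hm, Int.negOnePow_odd _ (Int.not_even_iff_odd.1 hp)]; simp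
      have a1 := mulMap_even (hpq.2 hp) f g hq (N.sgn n)
      have a2 := mulMap_odd hp f g hm (β n)
      have a3 := mulMap_odd hp (f ∘ₗ α) g hm n
      have a4 := mulMap_odd hp (f ∘ₗ M.sgn) (g ∘ₗ β) hm n
      rw [hβ, map_neg] at a2
      rw [LinearMap.comp_apply] at a3
      rw [LinearMap.comp_apply, LinearMap.comp_apply, hm', map_neg] at a4
      rw [a1, a2, a3, a4, neg_mul, mul_neg]
  exact LinearMap.congr_fun H x

theorem innerDiff_hopfTensor (x : M.carrier ⊗[k] N.carrier) :
    (M.hopfTensor N).innerDiff x =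
      (TensorProduct.map M.innerDiff N.sgn x + TensorProduct.map LinearMap.id N.innerDiff x :
        M.carrier ⊗[k] N.carrier) := by
  have h : ∀ x : M.carrier ⊗[k] N.carrier,
      tensorDiff M N (signMap (tensorGr_isInternal M.isInternal N.isInternal) x) =
        TensorProduct.map M.innerDiff N.sgn x + TensorProduct.map LinearMap.id N.innerDiff x := by
    intro x
    induction x using TensorProduct.induction_on with
    | zero => simp
    | add x y hx hy => simp only [map_add, hx, hy]; abel
    | tmul m n =>
      rw [signMap_tmul, tensorDiff_tmul]
      have := M.sgn_sgn m
      rw [sgn] at this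
      rw [sgn, this]
      rfl
  exact h x

theorem innerGen_hopfTensor (i : Fin c) (x : M.carrier ⊗[k] N.carrier) :
    (M.hopfTensor N).innerGen i x =
      (TensorProduct.map (M.innerGen i) N.sgn x + TensorProduct.map LinearMap.id (N.innerGen i) x :
        M.carrier ⊗[k] N.carrier) := by
  have h : ∀ x : M.carrier ⊗[k] N.carrier,
      hopfAct M N (extGen k i) (signMap (tensorGr_isInternal M.isInternal N.isInternal) x) =
        TensorProduct.map (M.innerGen i) N.sgn x +
          TensorProduct.map LinearMap.id (N.innerGen i) x := by
    intro x
    induction x using TensorProduct.induction_on with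
    | zero => simp
    | add x y hx hy => simp only [map_add, hx, hy]; abel
    | tmul m n =>
      rw [signMap_tmul, hopfAct_gen_tmul]
      have := M.sgn_sgn m
      rw [sgn] at this
      rw [sgn, this]
      rfl
  exact h x

theorem twistedD_mulMap (f : M.carrier →ₗ[k] MvPolynomial (Fin c) k)
    (g : N.carrier →ₗ[k] MvPolynomial (Fin c) k) :
    twistedD (M.hopfTensor N).innerDiff (M.hopfTensor N).innerGen
      (mulMap f g : M.carrier ⊗[k] N.carrier →ₗ[k] MvPolynomial (Fin c) k) =
      (mulMap (twistedD M.innerDiff M.innerGen f) g +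
        mulMap (f ∘ₗ M.sgn) (twistedD N.innerDiff N.innerGen g) :
        M.carrier ⊗[k] N.carrier →ₗ[k] MvPolynomial (Fin c) k) := by
  have hodd : ∀ p : ℤ, Even (p - 1) ↔ ¬ Even p := fun p => by
    rw [Int.even_sub]; simp
  have hw : ∀ (i : Fin c) (p : ℤ), Even (((w i : ℕ) : ℤ) + p) ↔ ¬ Even p := fun i p => by
    rw [Int.even_add]
    have : ¬ Even ((w i : ℕ) : ℤ) := Int.not_even_iff_odd.2 ((Int.odd_coe_nat _).2 (w i).2)
    tauto
  have h1 := mulMap_comp f g M.innerDiff N.innerDiff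
    (fun p m hm => ⟨_, M.innerDiff_mem p m hm, hodd p⟩)
    (fun n => by simp [innerDiff, sgn_diff])
  have h2 := fun i => mulMap_comp f g (M.innerGen i) (N.innerGen i)
    (fun p m hm => ⟨_, M.innerGen_mem i p m hm, hw i p⟩)
    (fun n => by simp [innerGen, sgn_gen])
  refine LinearMap.ext fun x => ?_
  refine (twistedD_apply _ _ _ _).trans ?_
  have e1 : (mulMap f g : M.carrier ⊗[k] N.carrier →ₗ[k] MvPolynomial (Fin c) k)
      ((M.hopfTensor N).innerDiff x) =
        mulMap (f ∘ₗ M.innerDiff) g x + mulMap (f ∘ₗ M.sgn) (g ∘ₗ N.innerDiff) x :=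
    (congrArg _ (innerDiff_hopfTensor x)).trans (h1 x)
  have e2 : ∀ i, (mulMap f g : M.carrier ⊗[k] N.carrier →ₗ[k] MvPolynomial (Fin c) k)
      ((M.hopfTensor N).innerGen i x) =
        mulMap (f ∘ₗ M.innerGen i) g x + mulMap (f ∘ₗ M.sgn) (g ∘ₗ N.innerGen i) x := fun i =>
    (congrArg _ (innerGen_hopfTensor i x)).trans (h2 i x)
  have e3 : ∀ (L : DGModule (extGr k w)) (f : L.carrier →ₗ[k] MvPolynomial (Fin c) k),
      twistedD L.innerDiff L.innerGen f = f ∘ₗ L.innerDiff +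
        ∑ i, (MvPolynomial.X i : MvPolynomial (Fin c) k) • f ∘ₗ L.innerGen i := fun L f => by
    refine LinearMap.ext fun y => ?_
    rw [twistedD_apply]
    simp [LinearMap.sum_apply]
  have e4 : ∀ x : M.carrier ⊗[k] N.carrier, (mulMap (twistedD M.innerDiff M.innerGen f) g +
      mulMap (f ∘ₗ M.sgn) (twistedD N.innerDiff N.innerGen g)) x =
        mulMap (f ∘ₗ M.innerDiff) g x +
          ∑ i, MvPolynomial.X i * mulMap (f ∘ₗ M.innerGen i) g x +
        (mulMap (f ∘ₗ M.sgn) (g ∘ₗ N.innerDiff) x +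
          ∑ i, MvPolynomial.X i * mulMap (f ∘ₗ M.sgn) (g ∘ₗ N.innerGen i) x) := fun x => by
    rw [e3, e3]
    simp only [map_add, map_sum, map_smul, LinearMap.add_apply, LinearMap.sum_apply,
      LinearMap.smul_apply, smul_eq_mul]
  refine (congrArg₂ (· + ·) e1 (Finset.sum_congr rfl fun i _ => congrArg _ (e2 i))).trans
    (Eq.trans ?_ (e4 x).symm)
  simp only [mul_add, Finset.sum_add_distrib]
  ring

theorem evalDual_sgn (f : M.twistedDual.carrier) :
    M.evalDual (M.twistedDual.sgn f) = M.evalDual f ∘ₗ M.sgn := by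
  induction f using homogeneous_induction M.twistedDual.isInternal with
  | hom n f hf =>
    rw [M.twistedDual.sgn_of_mem hf, map_zsmul]
    refine linearMap_ext_homogeneous M.isInternal fun j x hx => ?_
    rw [LinearMap.smul_apply, LinearMap.comp_apply, M.sgn_of_mem hx, map_zsmul]
    have := smul_symGr k w (hf j x hx) (1 : MvPolynomial (Fin c) k)
    rw [smul_eq_mul, mul_one] at this
    have h2 : ((j.negOnePow : ℤ)) • M.evalDual f x =
        (j.negOnePow : ℤ) • ((j + n).negOnePow : ℤ) • M.evalDual f x := congrArg _ this.symm
    rw [h2, Int.negOnePow_add, Units.val_mul, mul_smul, negOnePow_zsmul_zsmul]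
  | add f g hf hg => rw [map_add, map_add, hf, hg, map_add, LinearMap.add_comp]

variable (M N)

/-- The linear map underlying `DGModule.dualTensorMap`. -/
def dualTensorLin : M.twistedDual.carrier ⊗[MvPolynomial (Fin c) k] N.twistedDual.carrier
    →ₗ[MvPolynomial (Fin c) k] (M.hopfTensor N).twistedDual.carrier :=
  TensorProduct.lift (LinearMap.mk₂ (MvPolynomial (Fin c) k)
    (fun f g => (⟨mulMap (M.evalDual f) (N.evalDual g), by
      have hf := M.evalDual_mem f
      have hg := N.evalDual_mem g
      generalize M.evalDual f = f at hf
      generalize N.evalDual g = g at hg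
      induction hf using Submodule.iSup_induction' with
      | mem a f hf =>
        induction hg using Submodule.iSup_induction' with
        | mem b g hg => exact Submodule.mem_iSup_of_mem (a + b) (mulMap_mem hf hg)
        | zero => rw [map_zero]; exact zero_mem _
        | add g g' _ _ hg hg' => rw [map_add]; exact add_mem hg hg'
      | zero => rw [map_zero]; exact zero_mem _
      | add f f' _ _ hf hf' => rw [map_add]; exact add_mem hf hf'⟩ :
        (M.hopfTensor N).twistedDual.carrier))
    (fun f f' g => Subtype.ext (by
      show mulMap (M.evalDual (f + f')) (N.evalDual g) = mulMap (M.evalDual f) (N.evalDual g) +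
        mulMap (M.evalDual f') (N.evalDual g)
      rw [map_add, map_add, LinearMap.add_apply]))
    (fun s f g => Subtype.ext (by
      show mulMap (M.evalDual (s • f)) (N.evalDual g) = s • mulMap (M.evalDual f) (N.evalDual g)
      rw [map_smul, map_smul, LinearMap.smul_apply]))
    (fun f g g' => Subtype.ext (by
      show mulMap (M.evalDual f) (N.evalDual (g + g')) = mulMap (M.evalDual f) (N.evalDual g) +
        mulMap (M.evalDual f) (N.evalDual g')
      rw [map_add, map_add]))
    (fun s f g => Subtype.ext (by
      show mulMap (M.evalDual f) (N.evalDual (s • g)) = s • mulMap (M.evalDual f) (N.evalDual g)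
      rw [map_smul, map_smul])))

variable {M N} in
theorem evalDual_dualTensorLin (f : M.twistedDual.carrier) (g : N.twistedDual.carrier) :
    (M.hopfTensor N).evalDual (dualTensorLin M N (f ⊗ₜ g)) =
      mulMap (M.evalDual f) (N.evalDual g) := rfl

/-- The morphism `C(M) ⊗_S C(N) → C(M ⊗ N)` of twisted duals, sending `f ⊗ g` to
`m ⊗ n ↦ (-1)^(|m| |n|) f(m) g(n)`. -/
def dualTensorMap : Hom (M.twistedDual.symTensor N.twistedDual) (M.hopfTensor N).twistedDual where
  toLin := dualTensorLin M N
  map_mem {n z} hz := by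
    have h : ∀ z ∈ symTensorGr M.twistedDual N.twistedDual n,
        dualTensorLin M N z ∈ (M.hopfTensor N).twistedDual.gr n := by
      intro z hz
      induction hz using Submodule.span_induction with
      | mem z hz =>
        obtain ⟨a, b, rfl, f, hf, g, hg, rfl⟩ := hz
        rw [mem_twistedDual_gr, evalDual_dualTensorLin]
        exact mulMap_mem hf hg
      | zero => rw [map_zero]; exact zero_mem _
      | add x y _ _ hx hy => rw [map_add]; exact add_mem hx hy
      | smul a z _ hz =>
        rw [← algebraMap_smul (MvPolynomial (Fin c) k) a z, map_smul, algebraMap_smul]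
        exact Submodule.smul_mem _ a hz
    exact h z hz
  map_diff z := by
    refine LinearMap.congr_fun (f := dualTensorLin M N ∘ₗ
      symTensorDiff M.twistedDual N.twistedDual)
      (g := (M.hopfTensor N).twistedDual.symDiff ∘ₗ dualTensorLin M N)
      (TensorProduct.ext' fun f g => (M.hopfTensor N).evalDual_injective ?_) z
    rw [LinearMap.comp_apply, LinearMap.comp_apply, symTensorDiff_tmul]
    have e1 := (evalDual_dualTensorLin (M.twistedDual.sgn f) (N.twistedDual.diff g)).trans
      (congrArg (fun a => mulMap a (N.evalDual (N.twistedDual.diff g))) (evalDual_sgn f))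
    exact (congrArg _ (map_add (dualTensorLin M N) _ _)).trans <|
      (map_add (M.hopfTensor N).evalDual _ _).trans <|
      (congrArg₂ (· + ·) (evalDual_dualTensorLin (M.twistedDual.diff f) g) e1).trans <|
      (twistedD_mulMap (M.evalDual f) (N.evalDual g)).symm.trans
        (congrArg (twistedD _ _) (evalDual_dualTensorLin f g).symm)

variable {M N}

/-- For dg modules of finite type, the twisted dual of the tensor product is the tensor product of
the twisted duals. -/
theorem dualTensorMap_bijective (hM : M.IsFiniteType) (hN : N.IsFiniteType) :
    Function.Bijective (dualTensorMap M N).toLin := by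
  classical
  obtain ⟨J, b, deg, hb, -⟩ := hM.exists_triangularBasis
  obtain ⟨J', b', deg', hb', -⟩ := hN.exists_triangularBasis
  have hfin := hM.finite_deg_le b hb
  have hfin' := hN.finite_deg_le b' hb'
  obtain ⟨b0, hb0⟩ := hM.2
  obtain ⟨b0', hb0'⟩ := hN.2
  have hdeg : ∀ j, b0 ≤ deg j := fun j => by
    by_contra h
    exact b.ne_zero j ((Submodule.mem_bot k).1 (hb0 _ (not_le.1 h) ▸ hb j))
  have hdeg' : ∀ j, b0' ≤ deg' j := fun j => by
    by_contra h
    exact b'.ne_zero j ((Submodule.mem_bot k).1 (hb0' _ (not_le.1 h) ▸ hb' j))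
  let B : Module.Basis (J × J') k (M.hopfTensor N).carrier := b.tensorProduct b'
  have hBval : ∀ p, B p = (b p.1 ⊗ₜ b' p.2 : M.carrier ⊗[k] N.carrier) := fun p =>
    b.tensorProduct_apply' b' p
  have hB : ∀ p, B p ∈ (M.hopfTensor N).gr (deg p.1 + deg' p.2) := fun p => by
    rw [hBval]
    exact tmul_mem_tensorGr (hb p.1) (hb' p.2) rfl
  have hBfin : ∀ t, {p : J × J' | deg p.1 + deg' p.2 ≤ t}.Finite := fun t => by
    refine ((hfin (t - b0')).prod (hfin' (t - b0))).subset fun p hp => ?_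
    have hp : deg p.1 + deg' p.2 ≤ t := hp
    have h1 := hdeg p.1
    have h2 := hdeg' p.2
    exact ⟨show deg p.1 ≤ t - b0' by omega, show deg' p.2 ≤ t - b0 by omega⟩
  let ε : J × J' → (MvPolynomial (Fin c) k)ˣ := fun p =>
    Units.map (Int.castRingHom (MvPolynomial (Fin c) k)).toMonoidHom
      ((deg p.1 * deg' p.2).negOnePow)
  have hmul : ∀ p q, mulMap (M.evalDual (dualBasis b hb hfin p.1))
      (N.evalDual (dualBasis b' hb' hfin' p.2)) (b q.1 ⊗ₜ b' q.2) =
        (ε p : MvPolynomial (Fin c) k) * if p = q then 1 else 0 := by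
    intro p q
    have hval : ∀ p : J × J', (ε p : MvPolynomial (Fin c) k) =
      (((deg p.1 * deg' p.2).negOnePow : ℤ) : MvPolynomial (Fin c) k) := fun _ => rfl
    have hif : (if p.1 = q.1 then (1 : MvPolynomial (Fin c) k) else 0) *
        (if p.2 = q.2 then 1 else 0) = if p = q then 1 else 0 := by
      simp only [Prod.ext_iff]
      split_ifs <;> simp_all
    by_cases hq : Even (deg q.1)
    · rw [mulMap_even hq _ _ (hb q.1), evalDual_dualBasis, evalDual_dualBasis, hif]
      split_ifs with h
      · rw [hval, h, Int.negOnePow_even _ (hq.mul_right _)]; simp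
      · rw [mul_zero]
    · rw [mulMap_odd hq _ _ (hb q.1), N.sgn_of_mem (hb' q.2), map_zsmul,
        evalDual_dualBasis, evalDual_dualBasis, zsmul_eq_mul, mul_left_comm, hif]
      split_ifs with h
      · rw [hval, h]
        congr 3
        by_cases h' : Even (deg' q.2)
        · rw [Int.negOnePow_even _ h', Int.negOnePow_even _ (h'.mul_left _)]
        · rw [Int.not_even_iff_odd] at hq h'
          rw [Int.negOnePow_odd _ h', Int.negOnePow_odd _ (hq.mul h')]
      · rw [mul_zero, mul_zero]
  let e := ((dualBasis b hb hfin).tensorProduct (dualBasis b' hb' hfin')).equiv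
    ((dualBasis B hB hBfin).unitsSMul ε) (Equiv.refl _)
  have he : dualTensorLin M N = e.toLinearMap := by
    refine ((dualBasis b hb hfin).tensorProduct (dualBasis b' hb' hfin')).ext fun p => ?_
    refine (M.hopfTensor N).evalDual_injective (B.ext fun q => ?_)
    rw [LinearEquiv.coe_coe, Module.Basis.equiv_apply, Equiv.refl_apply,
      Module.Basis.unitsSMul_apply, Module.Basis.tensorProduct_apply', evalDual_dualTensorLin,
      Units.smul_def, map_smul, LinearMap.smul_apply, evalDual_dualBasis, smul_eq_mul, ← hmul,
      hBval]
    rfl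
  show Function.Bijective (dualTensorLin M N)
  rw [he]
  exact e.bijective

end Multiplication

end DGModule

/-! ### Models of finite type -/

section FixedPoint

/-- A recursion on the integers that is constant below some bound has a solution. -/
theorem exists_fixedPoint_of_causal {α : Type*} (T : (ℤ → α) → ℤ → α) (b : ℤ) (a : α)
    (h0 : ∀ F, ∀ n < b, T F n = a)
    (h : ∀ F G n, (∀ m < n, F m = G m) → T F n = T G n) : ∃ F, ∀ n, F n = T F n := by
  let F : ℕ → ℤ → α := fun r => Nat.rec (fun _ => a) (fun _ G => T G) r
  have hF : ∀ r, F (r + 1) = T (F r) := fun _ => rfl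
  have hstep : ∀ (r : ℕ) (n : ℤ), n < b + r → F (r + 1) n = F r n := by
    intro r
    induction r with
    | zero => exact fun n hn => h0 _ n (by simpa using hn)
    | succ r ih =>
      intro n hn
      rw [hF (r + 1), hF r]
      exact h _ _ n fun m hm => (hF r ▸ ih m (by push_cast at hn; omega))
  have hstab : ∀ (n : ℤ) (r : ℕ), (n - b + 1).toNat ≤ r → F r n = F (n - b + 1).toNat n := by
    intro n r hr
    induction r, hr using Nat.le_induction with
    | base => rfl
    | succ r hr ih => rw [hstep r n (by omega), ih]
  refine ⟨fun n => F (n - b + 1).toNat n, fun n => ?_⟩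
  show F (n - b + 1).toNat n = _
  rw [← hstab n ((n - b + 1).toNat + 1) (by omega), hF]
  exact h _ _ n fun m hm => hstab m _ (by omega)

end FixedPoint

namespace DGModule

section Submodules

variable {k : Type u} [Field k] {c : ℕ} {w : OddDegrees c}

/-- A dg submodule of a dg `Λ`-module, given by its homogeneous parts. -/
structure DGSubmodule (M : DGModule (extGr k w)) where
  /-- The homogeneous parts. -/
  part : ℤ → Submodule k M.carrier
  le_gr : ∀ n, part n ≤ M.gr n
  gen_smul_mem : ∀ (i : Fin c) (n : ℤ), ∀ x ∈ part n, extGen k i • x ∈ part ((w i : ℕ) + n)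
  diff_mem : ∀ n, ∀ x ∈ part n, M.diff x ∈ part (n - 1)

namespace DGSubmodule

variable {M : DGModule (extGr k w)} (P : DGSubmodule M)

theorem smul_mem {i n : ℤ} {a : ExteriorAlgebra k (Fin c → k)} {x : M.carrier}
    (ha : a ∈ extGr k w i) (hx : x ∈ P.part n) : a • x ∈ P.part (i + n) :=
  ext_act_mem (w := w) (Algebra.lsmul k k M.carrier) P.gen_smul_mem ha hx

theorem diff_mem_iSup {x : M.carrier} (hx : x ∈ ⨆ n, P.part n) : M.diff x ∈ ⨆ n, P.part n := by
  induction hx using Submodule.iSup_induction' with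
  | mem n x hx => exact Submodule.mem_iSup_of_mem _ (P.diff_mem n x hx)
  | zero => rw [map_zero]; exact zero_mem _
  | add x y _ _ hx hy => rw [map_add]; exact add_mem hx hy

/-- The sum of the homogeneous parts. -/
def toSubmodule : Submodule (ExteriorAlgebra k (Fin c → k)) M.carrier where
  carrier := (⨆ n, P.part n : Submodule k M.carrier)
  zero_mem' := zero_mem _
  add_mem' := add_mem
  smul_mem' a x hx := by
    replace hx : x ∈ ⨆ n, P.part n := hx
    show a • x ∈ ⨆ n, P.part n
    induction a using homogeneous_induction (algebra_isInternal (extGr k w)) with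
    | hom i a ha =>
      induction hx using Submodule.iSup_induction' with
      | mem n x hx => exact Submodule.mem_iSup_of_mem _ (P.smul_mem ha hx)
      | zero => rw [smul_zero]; exact zero_mem _
      | add x y _ _ hx hy => rw [smul_add]; exact add_mem hx hy
    | add a b ha hb => rw [add_smul]; exact add_mem ha hb

theorem mem_toSubmodule {x : M.carrier} : x ∈ P.toSubmodule ↔ x ∈ ⨆ n, P.part n := Iff.rfl

theorem part_le {n : ℤ} {x : M.carrier} (hx : x ∈ P.part n) : x ∈ P.toSubmodule :=
  Submodule.mem_iSup_of_mem n hx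

theorem component_mem_part {x : M.carrier} (hx : x ∈ P.toSubmodule) (n : ℤ) :
    component M.isInternal n x ∈ P.part n := by
  rw [mem_toSubmodule] at hx
  induction hx using Submodule.iSup_induction' with
  | mem i x hx =>
    by_cases h : i = n
    · subst h; rwa [component_of_mem _ (P.le_gr _ hx)]
    · rw [component_of_mem_ne _ (P.le_gr _ hx) h]; exact zero_mem _
  | zero => rw [map_zero]; exact zero_mem _
  | add x y _ _ hx hy => rw [map_add]; exact add_mem hx hy

theorem mem_part {x : M.carrier} (hx : x ∈ P.toSubmodule) {n : ℤ} (hn : x ∈ M.gr n) :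
    x ∈ P.part n := by
  rw [← component_of_mem M.isInternal hn]
  exact P.component_mem_part hx n

/-- A dg submodule as a dg module. -/
def toDGModule : DGModule (extGr k w) where
  carrier := P.toSubmodule
  gr n := (P.part n).comap (P.toSubmodule.subtype.restrictScalars k)
  isInternal := isInternal_comap_iSup (k := k) (X := M.carrier) (P := P.part)
    ((DirectSum.isInternal_submodule_iff_iSupIndep_and_iSup_eq_top _).1 M.isInternal |>.1.mono
      P.le_gr)
  smul_mem ha hx := P.smul_mem ha hx
  diff :=
    { toFun := fun x => ⟨M.diff x.1, P.diff_mem_iSup x.2⟩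
      map_add' := fun x y => Subtype.ext (map_add M.diff x.1 y.1)
      map_smul' := fun a x => Subtype.ext (map_smul M.diff a x.1) }
  diff_mem {n x} hx := P.diff_mem n x.1 hx
  diff_diff x := Subtype.ext (M.diff_diff x.1)
  leibniz x ha := Subtype.ext (M.leibniz x.1 ha)

/-- The inclusion of a dg submodule. -/
def incl : Hom P.toDGModule M :=
  ⟨P.toSubmodule.subtype, fun hx => P.le_gr _ hx, fun _ => rfl⟩

/-- The projection onto the quotient by a dg submodule, as a `k`-linear map. -/
def mkMap : M.carrier →ₗ[k] (M.carrier ⧸ P.toSubmodule) := P.toSubmodule.mkQ.restrictScalars k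

theorem mkMap_surjective : Function.Surjective P.mkMap := P.toSubmodule.mkQ_surjective

theorem mkMap_eq_zero {x : M.carrier} : P.mkMap x = 0 ↔ x ∈ P.toSubmodule :=
  Submodule.Quotient.mk_eq_zero _

theorem mkMap_smul (a : ExteriorAlgebra k (Fin c → k)) (x : M.carrier) :
    P.mkMap (a • x) = a • P.mkMap x :=
  rfl

/-- The differential of the quotient by a dg submodule. -/
def quotientDiff : (M.carrier ⧸ P.toSubmodule) →ₗ[k] (M.carrier ⧸ P.toSubmodule) :=
  (Submodule.liftQ (P.toSubmodule.restrictScalars k) (P.mkMap ∘ₗ M.diff) (fun x hx => by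
      rw [LinearMap.mem_ker, LinearMap.comp_apply, mkMap_eq_zero]
      exact P.diff_mem_iSup hx)) ∘ₗ
    (Submodule.Quotient.restrictScalarsEquiv k P.toSubmodule).symm.toLinearMap

theorem quotientDiff_mk (x : M.carrier) : P.quotientDiff (P.mkMap x) = P.mkMap (M.diff x) := rfl

/-- The decomposition of the elements of the quotient into homogeneous components. -/
def quotientComponents : (M.carrier ⧸ P.toSubmodule) →+ (ℤ →₀ M.carrier ⧸ P.toSubmodule) :=
  (Submodule.liftQ (P.toSubmodule.restrictScalars k)
    (Finsupp.mapRange.linearMap P.mkMap ∘ₗ components M.isInternal) (fun x hx => by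
      rw [LinearMap.mem_ker]
      ext n
      exact P.mkMap_eq_zero.2 (P.part_le (P.component_mem_part hx n)))).toAddMonoidHom.comp
    (Submodule.Quotient.restrictScalarsEquiv k P.toSubmodule).symm.toLinearMap.toAddMonoidHom

theorem quotientComponents_mk (x : M.carrier) :
    P.quotientComponents (P.mkMap x) =
      Finsupp.mapRange.linearMap P.mkMap (components M.isInternal x) :=
  rfl

/-- The quotient by a dg submodule. -/
def quotient : DGModule (extGr k w) where
  carrier := M.carrier ⧸ P.toSubmodule
  gr n := (M.gr n).map P.mkMap
  isInternal := by
    refine isInternal_of_coaction P.quotientComponents (fun n x hx => ?_) ?_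
    · obtain ⟨x, hx, rfl⟩ := hx
      rw [quotientComponents_mk, components_of_mem _ hx, Finsupp.mapRange.linearMap_apply,
        Finsupp.mapRange_single]
    · rw [← Submodule.map_iSup, M.isInternal.submodule_iSup_eq_top, Submodule.map_top,
        LinearMap.range_eq_top]
      exact P.mkMap_surjective
  smul_mem {i j a x} ha hx := by
    obtain ⟨x, hx, rfl⟩ := hx
    exact ⟨a • x, M.smul_mem ha hx, rfl⟩
  diff := P.quotientDiff
  diff_mem {n x} hx := by
    obtain ⟨x, hx, rfl⟩ := hx
    exact ⟨M.diff x, M.diff_mem hx, rfl⟩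
  diff_diff x := by
    obtain ⟨x, rfl⟩ := P.mkMap_surjective x
    rw [quotientDiff_mk, quotientDiff_mk, M.diff_diff, map_zero]
  leibniz {i a} x ha := by
    obtain ⟨x, rfl⟩ := P.mkMap_surjective x
    rw [quotientDiff_mk, ← mkMap_smul, ← mkMap_smul, quotientDiff_mk, M.leibniz x ha, map_zsmul]

/-- The projection onto the quotient by a dg submodule. -/
def proj : Hom M P.quotient :=
  ⟨P.toSubmodule.mkQ, fun {_ x} hx => ⟨x, hx, rfl⟩, fun _ => rfl⟩

/-- The projection is a quasi-isomorphism if the submodule is acyclic. -/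
theorem quasiIso_proj
    (hP : ∀ n, ∀ x ∈ P.part n, M.diff x = 0 → ∃ z ∈ P.part (n + 1), M.diff z = x) :
    quasiIso (extGr k w) (X := M) (Y := P.quotient) P.proj := by
  refine quasiIso_of_homogeneous _ fun n x hx y hy hdx hxy => ?_
  obtain ⟨y, hy, rfl⟩ := hy
  have hxy : P.mkMap x = P.mkMap (M.diff y) := hxy
  have h1 : x - M.diff y ∈ P.part n := by
    refine P.mem_part (P.mkMap_eq_zero.1 (by rw [map_sub, hxy, sub_self])) (sub_mem hx ?_)
    have := M.diff_mem hy
    rwa [add_sub_cancel_right] at this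
  obtain ⟨z, hz, hdz⟩ := hP n _ h1 (by rw [map_sub, hdx, M.diff_diff, sub_zero])
  refine ⟨y + z, 0, by rw [map_add, hdz]; abel, ?_⟩
  have : P.mkMap (y + z) = P.mkMap y := by
    rw [map_add, P.mkMap_eq_zero.2 (P.part_le hz), add_zero]
  refine Eq.trans ?_ (map_zero P.quotient.diff).symm
  exact sub_eq_zero.2 this.symm

end DGSubmodule

section Models

variable (M : DGModule (extGr k w))

/-- The cycles representing a finite-dimensional homology group can be taken from a
finite-dimensional space. -/
theorem exists_cycle_representatives {n : ℤ} (hn : Module.Finite k (M.homologyGr n)) :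
    ∃ R : Submodule k M.carrier, Module.Finite k R ∧ R ≤ M.gr n ∧ (∀ x ∈ R, M.diff x = 0) ∧
      ∀ z ∈ M.gr n, M.diff z = 0 → ∃ r ∈ R, ∃ y, z = r + M.diff y := by
  let Z : Submodule k M.cycles := (M.gr n).comap (M.cycles.subtype.restrictScalars k)
  let φ : Z →ₗ[k] M.Homology :=
    ((M.boundaries.submoduleOf M.cycles).mkQ.restrictScalars k).domRestrict Z
  have hφ : LinearMap.range φ = M.homologyGr n := LinearMap.range_domRestrict _ _
  obtain ⟨g, hg⟩ := φ.rangeRestrict.exists_rightInverse_of_surjective φ.range_rangeRestrict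
  let ψ : LinearMap.range φ →ₗ[k] M.carrier :=
    M.cycles.subtype.restrictScalars k ∘ₗ Z.subtype ∘ₗ g
  have hfin : Module.Finite k (LinearMap.range φ) := hφ ▸ hn
  refine ⟨LinearMap.range ψ, inferInstance, ?_, ?_, fun z hz hdz => ?_⟩
  · rintro _ ⟨x, rfl⟩
    exact (g x).2
  · rintro _ ⟨x, rfl⟩
    exact (g x).1.2
  · let z' : Z := ⟨⟨z, hdz⟩, hz⟩
    have h : φ (g (φ.rangeRestrict z')) = φ z' :=
      congrArg Subtype.val (LinearMap.congr_fun hg (φ.rangeRestrict z'))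
    refine ⟨ψ (φ.rangeRestrict z'), ⟨_, rfl⟩, ?_⟩
    have hψ : M.diff (ψ (φ.rangeRestrict z')) = 0 := (g (φ.rangeRestrict z')).1.2
    have h2 : M.homologyClass (z - ψ (φ.rangeRestrict z')) (by rw [map_sub, hdz, hψ, sub_zero]) =
        0 := sub_eq_zero.2 h.symm
    obtain ⟨y, hy⟩ := homologyClass_eq_zero.1 h2
    exact ⟨y, by rw [hy]; abel⟩

variable {M}

/-- A dg `Λ`-module whose homology is bounded below and finite-dimensional in each degree has a
quasi-isomorphic dg submodule with the same properties: going up degree by degree, one adds the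
products with the `e_i`, representatives of the homology and elements whose boundaries are the
boundaries in the part already constructed. -/
theorem IsDfPlus.exists_submodule (hM : M.IsDfPlus) : ∃ P : DGSubmodule M,
    P.toDGModule.IsFiniteType ∧ quasiIso (extGr k w) (X := P.toDGModule) (Y := M) P.incl := by
  obtain ⟨hfin, b, hb⟩ := hM
  choose R hRfin hRgr hRcyc hR using fun n => M.exists_cycle_representatives (hfin n)
  obtain ⟨σ, hσ⟩ :=
    M.diff.rangeRestrict.exists_rightInverse_of_surjective M.diff.range_rangeRestrict
  have hσ' : ∀ y : LinearMap.range M.diff, M.diff (σ y) = y :=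
    fun y => congrArg Subtype.val (LinearMap.congr_fun hσ y)
  let Y : ℤ → Submodule k M.carrier → Submodule k M.carrier := fun n Q =>
    (Q.comap (LinearMap.range M.diff).subtype).map (component M.isInternal n ∘ₗ σ)
  let T : (ℤ → Submodule k M.carrier) → ℤ → Submodule k M.carrier := fun F n =>
    if n < b then ⊥ else
      (⨆ i : Fin c, (F (n - (w i : ℕ))).map (M.act (extGen k i))) ⊔ R n ⊔ Y n (F (n - 1))
  obtain ⟨F, hF⟩ := exists_fixedPoint_of_causal T b ⊥ (fun F n hn => if_pos hn) (by
    intro F G n h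
    have h1 : ∀ i : Fin c, F (n - (w i : ℕ)) = G (n - (w i : ℕ)) := fun i =>
      h _ (by have := (w i).2.pos; omega)
    simp only [T, h1, h (n - 1) (by omega)])
  have hF0 : ∀ n < b, F n = ⊥ := fun n hn => (hF n).trans (if_pos hn)
  have hF1 : ∀ n, b ≤ n → F n = (⨆ i : Fin c, (F (n - (w i : ℕ))).map (M.act (extGen k i))) ⊔
      R n ⊔ Y n (F (n - 1)) := fun n hn => by
    conv_lhs => rw [hF]
    exact if_neg (not_lt.2 hn)
  have ind : ∀ {p : ℤ → Prop}, (∀ n, (∀ m < n, p m) → p n) → (∀ n < b, p n) → ∀ n, p n := by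
    intro p h h0 n
    have : ∀ (r : ℕ) n, n < b + r → p n := by
      intro r
      induction r with
      | zero => exact fun n hn => h0 n (by simpa using hn)
      | succ r ih => exact fun n hn => h n fun m hm => ih m (by push_cast at hn; omega)
    exact this (n - b + 1).toNat n (by omega)
  have hgr : ∀ n, F n ≤ M.gr n := by
    refine ind (fun n ih => ?_) fun n hn => by rw [hF0 n hn]; exact bot_le
    by_cases hn : n < b
    · rw [hF0 n hn]; exact bot_le
    rw [hF1 n (not_lt.1 hn)]
    refine sup_le (sup_le (iSup_le fun i => ?_) (hRgr n)) ?_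
    · rintro _ ⟨x, hx, rfl⟩
      have := M.smul_mem (extGen_mem k w i) (ih _ (by have := (w i).2.pos; omega) hx)
      rwa [add_sub_cancel] at this
    · rintro _ ⟨x, -, rfl⟩
      exact component_mem _ _ _
  have hgen : ∀ (i : Fin c) (n : ℤ), ∀ x ∈ F n, extGen k i • x ∈ F ((w i : ℕ) + n) := by
    intro i n x hx
    by_cases hn : (w i : ℕ) + n < b
    · have : x = 0 := by
        rw [hF0 n (by omega)] at hx
        exact (Submodule.mem_bot k).1 hx
      rw [this, smul_zero]; exact zero_mem _
    · rw [hF1 _ (not_lt.1 hn)]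
      refine Submodule.mem_sup_left
        (Submodule.mem_sup_left (Submodule.mem_iSup_of_mem i ⟨x, ?_, rfl⟩))
      rwa [add_sub_cancel_left]
  have hYd : ∀ n, ∀ x ∈ F (n - 1), ∀ hx : x ∈ LinearMap.range M.diff,
      M.diff (component M.isInternal n (σ ⟨x, hx⟩)) = x := by
    intro n x hxF hx
    rw [M.diff_component, hσ', component_of_mem _ (hgr _ hxF)]
  have hdiff : ∀ n, ∀ x ∈ F n, M.diff x ∈ F (n - 1) := by
    refine ind (fun n ih x hx => ?_) fun n hn x hx => ?_
    swap
    · rw [hF0 n hn, Submodule.mem_bot] at hx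
      rw [hx, map_zero]; exact zero_mem _
    by_cases hn : n < b
    · rw [hF0 n hn, Submodule.mem_bot] at hx
      rw [hx, map_zero]; exact zero_mem _
    have hle : F n ≤ (F (n - 1)).comap M.diff := by
      rw [hF1 n (not_lt.1 hn)]
      refine sup_le (sup_le (iSup_le fun i => ?_) fun r hr => ?_) ?_
      · rintro _ ⟨x, hx, rfl⟩
        have h := hgen i _ _ (ih _ (by have := (w i).2.pos; omega) x hx)
        rw [show ((w i : ℕ) : ℤ) + (n - (w i : ℕ) - 1) = n - 1 by ring] at h
        rw [Submodule.mem_comap, act_apply, diff_gen]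
        exact neg_mem h
      · rw [Submodule.mem_comap, hRcyc n r hr]; exact zero_mem _
      · rintro _ ⟨⟨x, hx⟩, hxF, rfl⟩
        rw [Submodule.mem_comap, LinearMap.comp_apply, hYd n x hxF]
        exact hxF
    exact hle hx
  have hFfin : ∀ n, Module.Finite k (F n) := by
    refine ind (fun n ih => ?_) fun n hn => by rw [hF0 n hn]; infer_instance
    by_cases hn : n < b
    · rw [hF0 n hn]; infer_instance
    have h1 : ∀ i : Fin c, Module.Finite k (F (n - (w i : ℕ))) := fun i =>
      ih _ (by have := (w i).2.pos; omega)
    have h2 := ih (n - 1) (by omega)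
    have h3 : Module.Finite k ((F (n - 1)).comap (LinearMap.range M.diff).subtype) :=
      Module.Finite.of_injective
        ((LinearMap.range M.diff).subtype.restrict (p := (F (n - 1)).comap
          (LinearMap.range M.diff).subtype) (q := F (n - 1)) fun x hx => hx)
        fun x y hxy => by
          have h : (x.1.1 : M.carrier) = y.1.1 := congrArg (fun z => z.1) hxy
          exact Subtype.ext (Subtype.ext h)
    have h4 := hRfin n
    rw [hF1 n (not_lt.1 hn)]
    infer_instance
  refine ⟨⟨F, hgr, hgen, hdiff⟩, ⟨fun n => ?_, b, fun n hn => ?_⟩, ?_⟩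
  · have := hFfin n
    exact Module.Finite.of_injective
      ((DGSubmodule.toSubmodule ⟨F, hgr, hgen, hdiff⟩).subtype.restrictScalars k |>.restrict
        (p := (F n).comap (
          (DGSubmodule.toSubmodule ⟨F, hgr, hgen, hdiff⟩).subtype.restrictScalars k))
        (q := F n) fun x hx => hx)
      fun x y hxy => by
          have h : (x.1.1 : M.carrier) = y.1.1 := congrArg (fun z => z.1) hxy
          exact Subtype.ext (Subtype.ext h)
  · refine (Submodule.eq_bot_iff _).2 fun x hx => Subtype.ext ?_
    have hx : x.1 ∈ F n := hx
    rw [hF0 n hn] at hx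
    exact (Submodule.mem_bot k).1 hx
  · refine quasiIso_of_homogeneous _ fun n x hx y hy hdx hxy => ?_
    have hx : x.1 ∈ F n := hx
    have hxy : x.1 = M.diff y := hxy
    have hbn : n < b → x.1 = 0 := fun hn => by
      rw [hF0 n hn] at hx; exact (Submodule.mem_bot k).1 hx
    obtain ⟨x1, hx1, hx1'⟩ : ∃ x1 ∈ F (n + 1), M.diff x1 = x.1 := by
      by_cases hn : n + 1 < b
      · exact ⟨0, zero_mem _, by rw [map_zero, hbn (by omega)]⟩
      · have hx' : x.1 ∈ F (n + 1 - 1) := by rwa [add_sub_cancel_right]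
        refine ⟨_, ?_, hYd (n + 1) x.1 hx' ⟨y, hxy.symm⟩⟩
        rw [hF1 _ (not_lt.1 hn)]
        exact Submodule.mem_sup_right ⟨⟨x.1, y, hxy.symm⟩, hx', rfl⟩
    obtain ⟨r, hr, y1, hy1⟩ : ∃ r ∈ F (n + 1), ∃ y1, y - x1 = r + M.diff y1 := by
      have hc : M.diff (y - x1) = 0 := by rw [map_sub, hx1', hxy, sub_self]
      by_cases hn : n + 1 < b
      · have h0 : M.homologyClass _ hc = 0 := by
          have hmem : M.homologyClass _ hc ∈ M.homologyGr (n + 1) :=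
            ⟨⟨y - x1, hc⟩, sub_mem hy (hgr _ hx1), rfl⟩
          rw [hb _ hn] at hmem
          exact (Submodule.mem_bot k).1 hmem
        obtain ⟨y1, hy1⟩ := homologyClass_eq_zero.1 h0
        exact ⟨0, zero_mem _, y1, by rw [hy1, zero_add]⟩
      · obtain ⟨r, hr, y1, hy1⟩ := hR (n + 1) (y - x1) (sub_mem hy (hgr _ hx1)) hc
        refine ⟨r, ?_, y1, hy1⟩
        rw [hF1 _ (not_lt.1 hn)]
        exact Submodule.mem_sup_left (Submodule.mem_sup_right hr)
    have hrc : M.diff r = 0 := by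
      have := congrArg M.diff hy1
      rw [map_add, M.diff_diff, add_zero, map_sub, hx1', hxy, sub_self] at this
      exact this.symm
    refine ⟨⟨x1 + r, Submodule.mem_iSup_of_mem (n + 1) (add_mem hx1 hr)⟩, y1, Subtype.ext ?_, ?_⟩
    · show M.diff (x1 + r) = x.1
      rw [map_add, hx1', hrc, add_zero]
    · show y - (x1 + r) = M.diff y1
      rw [← sub_sub, hy1]; abel

/-- A dg `Λ`-module of finite type whose homology is bounded above has a quasi-isomorphic quotient
that is bounded: the truncation. -/
theorem IsFiniteType.exists_quotient (hM : M.IsFiniteType) {t : ℤ}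
    (ht : ∀ n > t, ∀ x ∈ M.gr n, M.diff x = 0 → ∃ y, M.diff y = x) :
    ∃ P : DGSubmodule M, P.quotient.IsFiniteType ∧ (∀ n > t, P.quotient.gr n = ⊥) ∧
      quasiIso (extGr k w) (X := M) (Y := P.quotient) P.proj := by
  let F : ℤ → Submodule k M.carrier := fun n =>
    if t < n then M.gr n else if n = t then (M.gr (t + 1)).map M.diff else ⊥
  have h1 : ∀ n, t < n → F n = M.gr n := fun n hn => if_pos hn
  have h2 : F t = (M.gr (t + 1)).map M.diff := by simp [F]
  have h3 : ∀ n, n < t → F n = ⊥ := fun n hn => by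
    simp only [F, if_neg hn.le.not_gt, if_neg hn.ne]
  have hdt : ∀ x ∈ M.gr (t + 1), M.diff x ∈ M.gr t := fun x hx => by
    have := M.diff_mem hx
    rwa [add_sub_cancel_right] at this
  have hgr : ∀ n, F n ≤ M.gr n := by
    intro n
    rcases lt_trichotomy t n with hn | rfl | hn
    · rw [h1 n hn]
    · rw [h2]
      rintro _ ⟨x, hx, rfl⟩
      exact hdt x hx
    · rw [h3 n hn]; exact bot_le
  let P : DGSubmodule M := ⟨F, hgr, fun i n x hx => by
      have hi := (w i).2.pos
      by_cases hn : n < t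
      · rw [h3 n hn, Submodule.mem_bot] at hx
        rw [hx, smul_zero]; exact zero_mem _
      · rw [h1 _ (by omega)]
        exact M.smul_mem (extGen_mem k w i) (hgr n hx), fun n x hx => by
      rcases lt_trichotomy t n with hn | rfl | hn
      · by_cases hn' : n = t + 1
        · subst hn'
          rw [add_sub_cancel_right, h2]
          exact ⟨x, hgr _ hx, rfl⟩
        · rw [h1 (n - 1) (by omega)]
          exact M.diff_mem (hgr n hx)
      · rw [h2] at hx
        obtain ⟨x, -, rfl⟩ := hx
        rw [M.diff_diff]; exact zero_mem _
      · rw [h3 n hn, Submodule.mem_bot] at hx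
        rw [hx, map_zero]; exact zero_mem _⟩
  obtain ⟨hfin, b, hb⟩ := hM
  refine ⟨P, ⟨fun n => ?_, b, fun n hn => ?_⟩, fun n hn => ?_, P.quasiIso_proj fun n x hx hdx => ?_⟩
  · have := hfin n
    exact Module.Finite.map (M.gr n) P.mkMap
  · show (M.gr n).map P.mkMap = ⊥
    rw [hb n hn, Submodule.map_bot]
  · refine (Submodule.eq_bot_iff _).2 ?_
    rintro _ ⟨x, hx, rfl⟩
    exact P.mkMap_eq_zero.2 (P.part_le (n := n) (by show x ∈ F n; rw [h1 n hn]; exact hx))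
  · have hx : x ∈ F n := hx
    rcases lt_trichotomy t n with hn | rfl | hn
    · obtain ⟨y, rfl⟩ := ht n hn x (hgr n hx) hdx
      refine ⟨component M.isInternal (n + 1) y, ?_, ?_⟩
      · show _ ∈ F (n + 1)
        rw [h1 _ (by omega)]; exact component_mem _ _ _
      · rw [M.diff_component, add_sub_cancel_right, component_of_mem _ (hgr n hx)]
    · rw [h2] at hx
      obtain ⟨y, hy, rfl⟩ := hx
      refine ⟨y, ?_, rfl⟩
      show y ∈ F (t + 1)
      rwa [h1 _ (by omega)]
    · rw [h3 n hn, Submodule.mem_bot] at hx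
      exact ⟨0, zero_mem _, by rw [map_zero, hx]⟩

end Models

end Submodules

end DGModule

/-! ### The resolution and the tensor product in the derived category -/

namespace DGModule

section Derived

variable {k A : Type u} [Field k] [Ring A] [Algebra k A] {𝒜 : ℤ → Submodule k A} [GradedAlgebra 𝒜]
  {M N : DGModule 𝒜}

/-- A quasi-isomorphism is an isomorphism in the derived category. -/
def derivedIso (f : Hom M N) (hf : quasiIso 𝒜 (X := M) (Y := N) f) : M.toDerived ≅ N.toDerived :=
  CategoryTheory.Localization.isoOfHom (quasiIso 𝒜).Q (quasiIso 𝒜) (X := M) (Y := N) f hf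

/-- The isomorphism on homology induced by a quasi-isomorphism. -/
def homologyEquiv (f : Hom M N) (hf : quasiIso 𝒜 (X := M) (Y := N) f) :
    M.Homology ≃ₗ[A] N.Homology :=
  LinearEquiv.ofBijective f.mapHomology hf

end Derived

section Models

variable {k : Type u} [Field k] {c : ℕ} {w : OddDegrees c} {M N L : DGModule (extGr k w)}

/-- The twisted dual turns injective morphisms into surjective ones: homogeneous maps extend along
homogeneous retractions. -/
theorem dualMap_surjective (φ : Hom M L) (hφ : Function.Injective φ.toLin) :
    Function.Surjective φ.dualMap.toLin := by
  obtain ⟨ρ, hρ⟩ := LinearMap.exists_leftInverse_of_injective (φ.toLin.restrictScalars k)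
    (LinearMap.ker_eq_bot.2 hφ)
  have hρ : ∀ x, ρ (φ.toLin x) = x := fun x => LinearMap.congr_fun hρ x
  let ρ' := gluedMap L.isInternal fun j => component M.isInternal j ∘ₗ ρ
  have hρ1 : ∀ j, ∀ x ∈ L.gr j, ρ' x ∈ M.gr j := fun j x hx => by
    rw [gluedMap_of_mem _ _ hx]; exact component_mem _ _ _
  have hρ2 : ∀ x, ρ' (φ.toLin x) = x := fun x => by
    induction x using homogeneous_induction M.isInternal with
    | hom n x hx =>
      rw [gluedMap_of_mem _ _ (φ.map_mem hx), LinearMap.comp_apply, hρ, component_of_mem _ hx]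
    | add x y hx hy => rw [map_add, map_add, hx, hy]
  intro f
  have key : ∀ f ∈ ⨆ n, symMapGr w M.gr n, f ∘ₗ ρ' ∈ ⨆ n, symMapGr w L.gr n := by
    intro f hf
    induction hf using Submodule.iSup_induction' with
    | mem n f hf =>
      exact Submodule.mem_iSup_of_mem n fun j x hx => hf j _ (hρ1 j x hx)
    | zero => exact zero_mem _
    | add f g _ _ hf hg => rw [LinearMap.add_comp]; exact add_mem hf hg
  obtain ⟨g, hg⟩ := exists_evalDual (key _ (M.evalDual_mem f))
  refine ⟨g, M.evalDual_injective (LinearMap.ext fun x => ?_)⟩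
  rw [evalDual_dualMap, hg]
  exact congrArg _ (hρ2 x)

/-- The comparison of the dual of the universal resolution with a twisted dual. -/
def bggToTwistedDual (M : DGModule (extGr k w)) : Hom M.bgg M.twistedDual :=
  M.twistedDualToBgg.inverse M.twistedDualToBgg_bijective

theorem quasiIso_bggToTwistedDual (M : DGModule (extGr k w)) :
    quasiIso (symGr k w) (X := M.bgg) (Y := M.twistedDual) M.bggToTwistedDual :=
  quasiIso_of_bijective _ (Hom.inverse_bijective _ _)

theorem IsDfPlus.nonempty_resolution (hM : M.IsDfPlus) : Nonempty M.bgg.SemifreeResolution := by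
  obtain ⟨P, hP, hqi⟩ := hM.exists_submodule
  obtain ⟨J, -, -, -, T, -⟩ := hP.exists_triangularBasis
  have hr := quasiIso_dualMap P.incl hqi
  obtain ⟨s, hs⟩ := exists_section T P.incl.dualMap hr
    (dualMap_surjective P.incl P.toSubmodule.injective_subtype)
  have hsq : quasiIso (symGr k w) (X := P.toDGModule.twistedDual) (Y := M.twistedDual) s := by
    refine quasiIso_of_comp_left hr (quasiIso_of_bijective _ ?_)
    have : ⇑(P.incl.dualMap.comp s).toLin = _root_.id := funext hs
    rw [this]
    exact Function.bijective_id
  exact nonempty_semifreeResolution hP.isSemifree (M.twistedDualToBgg.comp s)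
    (quasiIso_comp (quasiIso_of_bijective _ M.twistedDualToBgg_bijective) hsq)

theorem IsDfPlus.nonempty_derivedIso (hM : M.IsDfPlus) (hN : N.IsDfPlus)
    (P : M.bgg.SemifreeResolution) :
    Nonempty ((M.hopfTensor N).bgg.toDerived ≅ (P.obj.symTensor N.bgg).toDerived) := by
  obtain ⟨A, hA, hAq⟩ := hM.exists_submodule
  obtain ⟨B, hB, hBq⟩ := hN.exists_submodule
  have e1 := derivedIso _ (M.hopfTensor N).quasiIso_bggToTwistedDual
  have e2 := derivedIso _ (quasiIso_dualMap _ (quasiIso_hopfMap A.incl B.incl hAq hBq))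
  have e3 := derivedIso _ (quasiIso_of_bijective _ (dualTensorMap_bijective hA hB))
  have e4 := derivedIso _ (quasiIso_symTensorMap
    ((A.incl.dualMap.comp M.bggToTwistedDual).comp P.π) (B.incl.dualMap.comp N.bggToTwistedDual)
    (quasiIso_comp (quasiIso_comp (quasiIso_dualMap _ hAq) M.quasiIso_bggToTwistedDual) P.quasiIso)
    (quasiIso_comp (quasiIso_dualMap _ hBq) N.quasiIso_bggToTwistedDual)
    P.isSemifree hB.isSemifree)
  exact ⟨e1 ≪≫ e2 ≪≫ e3.symm ≪≫ e4.symm⟩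

/-- A dg `Λ`-module with finite-dimensional homology is related by quasi-isomorphisms to a
finite-dimensional one. -/
theorem IsDfb.exists_models (hM : M.IsDfb) : ∃ (A : DGSubmodule M) (B : DGSubmodule A.toDGModule),
    A.toDGModule.IsFiniteType ∧ B.quotient.IsFiniteType ∧ (∃ t, ∀ n > t, B.quotient.gr n = ⊥) ∧
      quasiIso (extGr k w) (X := A.toDGModule) (Y := M) A.incl ∧
      quasiIso (extGr k w) (X := A.toDGModule) (Y := B.quotient) B.proj := by
  obtain ⟨A, hA, hAq⟩ := hM.1.exists_submodule
  obtain ⟨t, ht⟩ := hM.2.2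
  obtain ⟨B, hB, hBt, hBq⟩ := hA.exists_quotient (t := t) fun n hn x hx hdx => by
    have h0 : M.homologyClass x.1 (A.incl.diff_eq_zero hdx) = 0 := by
      have hmem : M.homologyClass x.1 (A.incl.diff_eq_zero hdx) ∈ M.homologyGr n :=
        ⟨⟨x.1, A.incl.diff_eq_zero hdx⟩, A.le_gr n hx, rfl⟩
      rw [ht n hn] at hmem
      exact (Submodule.mem_bot k).1 hmem
    have h1 : A.toDGModule.homologyClass x hdx = 0 := hAq.1 (h0.trans (map_zero _).symm)
    exact homologyClass_eq_zero.1 h1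
  exact ⟨A, B, hA, hB, ⟨t, hBt⟩, hAq, hBq⟩

/-- The homology of the dual of the universal resolution, for `M`, `N` and their tensor product,
computed by dg `S`-modules with finite triangular bases. -/
theorem IsDfb.exists_finite_models (hM : M.IsDfb) (hN : N.IsDfb) :
    ∃ (X Y : DGModule (symGr k w)) (I J : Type u) (_ : X.TriangularBasis I)
      (_ : Y.TriangularBasis J), Finite I ∧ Finite J ∧
      Nonempty (M.bgg.Homology ≃ₗ[MvPolynomial (Fin c) k] X.Homology) ∧
      Nonempty (N.bgg.Homology ≃ₗ[MvPolynomial (Fin c) k] Y.Homology) ∧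
      Nonempty ((M.hopfTensor N).bgg.Homology ≃ₗ[MvPolynomial (Fin c) k]
        (X.symTensor Y).Homology) := by
  obtain ⟨A, A', hA, hA', ⟨t, ht⟩, hAq, hAq'⟩ := hM.exists_models
  obtain ⟨B, B', hB, hB', ⟨s, hs⟩, hBq, hBq'⟩ := hN.exists_models
  obtain ⟨I, b, deg, hb, T, -⟩ := hA'.exists_triangularBasis
  obtain ⟨J, b', deg', hb', T', -⟩ := hB'.exists_triangularBasis
  have hfinite : ∀ {L : DGModule (extGr k w)} {I : Type u} (_ : L.IsFiniteType) {t : ℤ}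
      (_ : ∀ n > t, L.gr n = ⊥) (b : Module.Basis I k L.carrier) {deg : I → ℤ}
      (_ : ∀ i, b i ∈ L.gr (deg i)), Finite I := fun hL t ht b deg hb => by
    have h := hL.finite_deg_le b hb t
    refine Set.finite_univ_iff.1 (h.subset fun i _ => ?_)
    by_contra h
    exact b.ne_zero i ((Submodule.mem_bot k).1 (ht _ (not_le.1 h) ▸ hb i))
  have qA := quasiIso_dualMap _ hAq
  have qA' := quasiIso_dualMap _ hAq'
  have qB := quasiIso_dualMap _ hBq
  have qB' := quasiIso_dualMap _ hBq'
  refine ⟨_, _, I, J, T, T', hfinite hA' ht b hb, hfinite hB' hs b' hb', ⟨?_⟩, ⟨?_⟩, ⟨?_⟩⟩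
  · exact ((homologyEquiv _ M.quasiIso_bggToTwistedDual).trans (homologyEquiv _ qA)).trans
      (homologyEquiv _ qA').symm
  · exact ((homologyEquiv _ N.quasiIso_bggToTwistedDual).trans (homologyEquiv _ qB)).trans
      (homologyEquiv _ qB').symm
  · have e2 := homologyEquiv _ (quasiIso_dualMap _ (quasiIso_hopfMap A.incl B.incl hAq hBq))
    have e3 := homologyEquiv _ (quasiIso_of_bijective _ (dualTensorMap_bijective hA hB))
    have e4 := homologyEquiv _ (quasiIso_symTensorMap _ _ qA' qB' hA'.isSemifree hB.isSemifree)
    exact (((homologyEquiv _ (M.hopfTensor N).quasiIso_bggToTwistedDual).trans e2).trans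
      e3.symm).trans e4.symm

end Models

end DGModule

/-! ### Differential modules over a commutative ring and their fibers -/

section Fibers

variable {R : Type*} [CommRing R]

/-- The differential module `(X, d)` has nonzero homology after base change to the `R`-algebra `κ`,
which is meant to be a residue field. This is witnessed by an element `x` of `X` which becomes a
cycle over `κ`, and a functional with values in `κ` which vanishes on boundaries but not on `x`. -/
def HasFiberHomology {X : Type*} [AddCommGroup X] [Module R X] (d : X →ₗ[R] X) (κ : Type*) [Field κ]
    [Algebra R κ] : Prop :=
  ∃ (x : X) (φ : X →ₗ[R] κ), (∀ y, φ (d y) = 0) ∧ φ x ≠ 0 ∧ ∀ ψ : X →ₗ[R] κ, ψ (d x) = 0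

/-- If `t` kills the homology of a differential module with a finite triangular basis, then some
power of `t` is null-homotopic. -/
theorem exists_homotopy_of_triangular {X J : Type*} [AddCommGroup X] [Module R X] [Finite J]
    (d : X →ₗ[R] X) (b : Module.Basis J R X) (level : J → ℕ) (t : R) (hd : ∀ x, d (d x) = 0)
    (htri : ∀ j i, level j ≤ level i → b.repr (d (b j)) i = 0)
    (ht : ∀ x, d x = 0 → ∃ u, d u = t • x) :
    ∃ (m : ℕ) (h : X →ₗ[R] X), ∀ x, d (h x) + h (d x) = t ^ m • x := by
  classical
  have hcongr : ∀ (φ φ' : X →ₗ[R] X) (j : J), (∀ i, level i < level j → φ (b i) = φ' (b i)) →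
      φ (d (b j)) = φ' (d (b j)) := by
    intro φ φ' j h
    rw [← b.linearCombination_repr (d (b j)), Finsupp.linearCombination_apply, Finsupp.sum,
      map_sum, map_sum]
    refine Finset.sum_congr rfl fun i hi => ?_
    have : level i < level j := by
      by_contra hne
      exact Finsupp.mem_support_iff.1 hi (htri j i (not_lt.1 hne))
    rw [map_smul, map_smul, h i this]
  have key : ∀ n, ∃ (m : ℕ) (h : X →ₗ[R] X), ∀ j, level j < n →
      d (h (b j)) + h (d (b j)) = t ^ m • b j := by
    intro n
    induction n with
    | zero => exact ⟨0, 0, fun j hj => absurd hj (Nat.not_lt_zero _)⟩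
    | succ n ih =>
      obtain ⟨m, h, hh⟩ := ih
      have hu : ∀ j, ∃ u, level j = n → d u = t • (t ^ m • b j - h (d (b j))) := by
        intro j
        by_cases hj : level j = n
        · have h1 : (d ∘ₗ h + h ∘ₗ d) (d (b j)) = (t ^ m • LinearMap.id : X →ₗ[R] X) (d (b j)) :=
            hcongr _ _ j fun i hi => hh i (hj ▸ hi)
          simp only [LinearMap.add_apply, LinearMap.comp_apply, hd, map_zero, add_zero,
            LinearMap.smul_apply, LinearMap.id_apply] at h1
          obtain ⟨u, hu⟩ := ht (t ^ m • b j - h (d (b j))) (by rw [map_sub, h1, map_smul, sub_self])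
          exact ⟨u, fun _ => hu⟩
        · exact ⟨0, fun h => absurd h hj⟩
      choose u hu using hu
      let h' : X →ₗ[R] X := b.constr R fun j => if level j < n then t • h (b j) else u j
      have hlow : ∀ j, level j < n → h' (b j) = (t • h) (b j) := fun j hj => by
        simp [h', hj]
      refine ⟨m + 1, h', fun j hj => ?_⟩
      rw [hcongr h' (t • h) j fun i hi => hlow i (by omega), LinearMap.smul_apply]
      rcases Nat.lt_succ_iff_lt_or_eq.1 hj with hj | hj
      · rw [hlow j hj, LinearMap.smul_apply, map_smul, ← smul_add, hh j hj, ← mul_smul, pow_succ']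
      · have : h' (b j) = u j := by simp [h', hj]
        rw [this, hu j hj, smul_sub, sub_add_cancel, ← mul_smul, pow_succ']
  obtain ⟨n, hn⟩ : ∃ n, ∀ j, level j < n := by
    obtain ⟨n, hn⟩ := (Set.finite_range level).bddAbove
    exact ⟨n + 1, fun j => Nat.lt_succ_of_le (hn ⟨j, rfl⟩)⟩
  obtain ⟨m, h, hh⟩ := key n
  refine ⟨m, h, LinearMap.congr_fun (f := d ∘ₗ h + h ∘ₗ d) (g := t ^ m • LinearMap.id) ?_⟩
  exact b.ext fun j => hh j (hn j)

/-- If the homology of a differential module with a finite triangular basis is killed by an element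
that is invertible in `κ`, then its fiber over `κ` is acyclic. -/
theorem not_hasFiberHomology {X J : Type*} [AddCommGroup X] [Module R X] [Finite J]
    (d : X →ₗ[R] X) (b : Module.Basis J R X) (level : J → ℕ) (t : R) (hd : ∀ x, d (d x) = 0)
    (htri : ∀ j i, level j ≤ level i → b.repr (d (b j)) i = 0)
    (ht : ∀ x, d x = 0 → ∃ u, d u = t • x) {κ : Type*} [Field κ] [Algebra R κ]
    (htκ : algebraMap R κ t ≠ 0) : ¬ HasFiberHomology d κ := by
  rintro ⟨x, φ, hφ, hx, hψ⟩
  obtain ⟨m, h, hh⟩ := exists_homotopy_of_triangular d b level t hd htri ht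
  have h1 := congrArg φ (hh x)
  have h2 : φ (h (d x)) = 0 := hψ (φ ∘ₗ h)
  rw [map_add, hφ, h2, add_zero, map_smul, algebra_compatible_smul κ, smul_eq_mul, eq_comm,
    mul_eq_zero, map_pow] at h1
  exact h1.elim (pow_ne_zero _ htκ) hx

/-- A finite family in the residue field of a prime has a common denominator. -/
theorem exists_common_denominator (p : Ideal R) [p.IsPrime] {ι : Type*} [Finite ι]
    (f : ι → p.ResidueField) :
    ∃ (s : R) (g : ι → R), algebraMap R p.ResidueField s ≠ 0 ∧
      ∀ i, algebraMap R p.ResidueField (g i) = algebraMap R p.ResidueField s * f i := by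
  obtain ⟨⟨a, ha⟩, h⟩ := IsLocalization.exist_integer_multiples_of_finite
    (nonZeroDivisors (R ⧸ p)) f
  obtain ⟨s, rfl⟩ := Ideal.Quotient.mk_surjective a
  have hmap : ∀ r : R, algebraMap (R ⧸ p) p.ResidueField (Ideal.Quotient.mk p r) =
      algebraMap R p.ResidueField r := fun r =>
    (IsScalarTower.algebraMap_apply R (R ⧸ p) p.ResidueField r).symm
  have hg : ∀ i, ∃ r : R, algebraMap R p.ResidueField r = algebraMap R p.ResidueField s * f i := by
    intro i
    obtain ⟨q, hq⟩ := h i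
    obtain ⟨r, rfl⟩ := Ideal.Quotient.mk_surjective q
    refine ⟨r, ?_⟩
    rw [← hmap, hq, ← hmap]
    exact Algebra.smul_def _ _
  choose g hg using hg
  refine ⟨s, g, fun h0 => nonZeroDivisors.ne_zero ha ?_, hg⟩
  rw [Ideal.algebraMap_residueField_eq_zero] at h0
  exact Ideal.Quotient.eq_zero_iff_mem.2 h0

/-- A differential on a vector space whose cycles are boundaries admits a contraction. -/
theorem exists_contraction_of_ker_le_range {κ V : Type*} [Field κ] [AddCommGroup V] [Module κ V]
    (D : V →ₗ[κ] V) (hD : ∀ v, D (D v) = 0) (h : LinearMap.ker D ≤ LinearMap.range D) :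
    ∃ K : V →ₗ[κ] V, ∀ v, D (K v) + K (D v) = v := by
  obtain ⟨G0, hG0⟩ := LinearMap.exists_rightInverse_of_surjective D.rangeRestrict
    D.range_rangeRestrict
  obtain ⟨G, hG⟩ := LinearMap.exists_extend G0
  have hDG : ∀ y ∈ LinearMap.range D, D (G y) = y := by
    intro y hy
    have h1 : G y = G0 ⟨y, hy⟩ := LinearMap.congr_fun hG ⟨y, hy⟩
    have h2 := congrArg Subtype.val (LinearMap.congr_fun hG0 ⟨y, hy⟩)
    rw [h1]; exact h2
  refine ⟨G ∘ₗ (LinearMap.id - G ∘ₗ D), fun v => ?_⟩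
  have h1 : v - G (D v) ∈ LinearMap.range D :=
    h (by rw [LinearMap.mem_ker, map_sub, hDG _ ⟨v, rfl⟩, sub_self])
  simp only [LinearMap.comp_apply, LinearMap.sub_apply, LinearMap.id_apply, hD, map_zero, sub_zero]
  rw [hDG _ h1, sub_add_cancel]

/-- Linear maps from a finite free module to a vector space over `κ` factor through the fiber, here
described by coordinates. -/
theorem exists_fiber_factorization {X J Z κ : Type*} [AddCommGroup X] [Module R X] [Fintype J]
    [DecidableEq J] [Field κ] [Algebra R κ] [AddCommGroup Z] [Module R Z] [Module κ Z]
    [IsScalarTower R κ Z] (b : Module.Basis J R X) (f : X →ₗ[R] Z) :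
    ∃ F : (J → κ) →ₗ[κ] Z, ∀ x, F (b.constr R (fun j => Pi.single j 1) x) = f x := by
  let F : (J → κ) →ₗ[κ] Z := (Pi.basisFun κ J).constr κ fun j => f (b j)
  refine ⟨F, LinearMap.congr_fun
    (f := F.restrictScalars R ∘ₗ b.constr R fun j => Pi.single j 1) (g := f) (b.ext fun j => ?_)⟩
  rw [LinearMap.comp_apply, b.constr_basis, ← Pi.basisFun_apply]
  exact (Pi.basisFun κ J).constr_basis κ _ j

/-- If the fiber of a finite free differential module over the residue field of `p` is acyclic, then
its homology is killed by an element outside `p`. The element is, up to sign, the determinant of an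
endomorphism homotopic to zero, obtained by lifting a contraction of the fiber. -/
theorem exists_smul_boundary_of_not_hasFiberHomology {X J : Type*} [AddCommGroup X] [Module R X]
    [Finite J] (d : X →ₗ[R] X) (b : Module.Basis J R X) (hd : ∀ x, d (d x) = 0) (p : Ideal R)
    [p.IsPrime] (h : ¬ HasFiberHomology d p.ResidueField) :
    ∃ t ∉ p, ∀ x, d x = 0 → ∃ u, d u = t • x := by
  classical
  have := Fintype.ofFinite J
  set κ := p.ResidueField
  let c : X →ₗ[R] (J → κ) := b.constr R fun j => Pi.single j 1
  have hcb : ∀ j, c (b j) = Pi.single j 1 := fun j => b.constr_basis R _ j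
  have hind : ∀ F G : (J → κ) →ₗ[κ] (J → κ),
      (∀ x, F (c x) = G (c x)) → F = G := fun F G hFG =>
    (Pi.basisFun κ J).ext fun j => by rw [Pi.basisFun_apply, ← hcb, hFG]
  -- The differential of the fiber.
  obtain ⟨D, hD⟩ := exists_fiber_factorization (κ := κ) b (c ∘ₗ d)
  replace hD : ∀ x, D (c x) = c (d x) := hD
  have hDD : ∀ v, D (D v) = 0 := LinearMap.congr_fun (f := D ∘ₗ D) (g := 0)
    (hind _ _ fun x => by simp [hD, hd])
  have hlift : ∀ v : J → κ, ∃ (s : R) (x : X), algebraMap R κ s ≠ 0 ∧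
      c x = algebraMap R κ s • v := by
    intro v
    obtain ⟨s, g, hs, hg⟩ := exists_common_denominator p v
    refine ⟨s, ∑ j, g j • b j, hs, ?_⟩
    ext i
    simp only [map_sum, map_smul, hcb, Finset.sum_apply, Pi.smul_apply, Pi.single_apply, smul_ite,
      smul_zero, Finset.sum_ite_eq, Finset.mem_univ, if_true, smul_eq_mul]
    rw [Algebra.smul_def, mul_one]
    exact hg i
  have hexact : LinearMap.ker D ≤ LinearMap.range D := by
    intro v hv
    by_contra hne
    obtain ⟨f, hf, hfr⟩ := Submodule.exists_le_ker_of_notMem hne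
    obtain ⟨s, x, hs, hx⟩ := hlift v
    refine h ⟨x, f.restrictScalars R ∘ₗ c, fun y => ?_, ?_, fun ψ => ?_⟩
    · rw [LinearMap.comp_apply, ← hD]
      exact hfr ⟨_, rfl⟩
    · rw [LinearMap.comp_apply, hx]
      show f (_ • v) ≠ 0
      rw [map_smul, smul_eq_mul]
      exact mul_ne_zero hs hf
    · obtain ⟨Ψ, hΨ⟩ := exists_fiber_factorization (κ := κ) b ψ
      replace hΨ : ∀ x, Ψ (c x) = ψ x := hΨ
      rw [← hΨ, ← hD, hx, map_smul, LinearMap.mem_ker.1 hv, smul_zero, map_zero]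
  obtain ⟨K, hK⟩ := exists_contraction_of_ker_le_range D hDD hexact
  -- `H` lifts `s` times the contraction `K`, so that `E = dH + Hd` is `s` times the identity on the
  -- fiber.
  obtain ⟨s, g, hs, hg⟩ := exists_common_denominator p fun ij : J × J => K (Pi.single ij.1 1) ij.2
  let H : X →ₗ[R] X := b.constr R fun j => ∑ i, g (j, i) • b i
  have hH : ∀ x, c (H x) = algebraMap R κ s • K (c x) := by
    refine LinearMap.congr_fun (f := c ∘ₗ H)
      (g := (algebraMap R κ s • K).restrictScalars R ∘ₗ c) (b.ext fun j => ?_)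
    have : H (b j) = ∑ i, g (j, i) • b i := b.constr_basis R _ j
    rw [LinearMap.comp_apply, LinearMap.comp_apply, this, hcb]
    ext i
    simp only [map_sum, map_smul, hcb, Finset.sum_apply, Pi.smul_apply, Pi.single_apply, smul_ite,
      smul_zero, Finset.sum_ite_eq, Finset.mem_univ, if_true, LinearMap.restrictScalars_apply,
      LinearMap.smul_apply, smul_eq_mul]
    rw [Algebra.smul_def, mul_one, hg]
  let E : X →ₗ[R] X := d ∘ₗ H + H ∘ₗ d
  have hE : ∀ x, c (E x) = algebraMap R κ s • c x := by
    intro x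
    show c (d (H x) + H (d x)) = _
    rw [map_add, ← hD, hH, hH, map_smul, ← smul_add, ← hD, hK]
  have hEd : ∀ x, d (E x) = E (d x) := by
    intro x
    simp [E, hd]
  have hdet : algebraMap R κ (LinearMap.det E) ≠ 0 := by
    have hc : ∀ x i, c x i = algebraMap R κ (b.repr x i) := by
      intro x i
      have := LinearMap.congr_fun (f := LinearMap.proj i ∘ₗ c)
        (g := Algebra.linearMap R κ ∘ₗ b.coord i) (b.ext fun j => ?_) x
      · exact this
      · simp [hcb, Pi.single_apply, Finsupp.single_apply, eq_comm, apply_ite]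
    have : (algebraMap R κ).mapMatrix (LinearMap.toMatrix b b E) = algebraMap R κ s • 1 := by
      ext i j
      rw [RingHom.mapMatrix_apply, Matrix.map_apply, LinearMap.toMatrix_apply, ← hc, hE, hcb]
      simp [Matrix.one_apply, Pi.single_apply]
    rw [← LinearMap.det_toMatrix b, RingHom.map_det, this, Matrix.det_smul, Matrix.det_one, mul_one]
    exact pow_ne_zero _ hs
  have := Module.Free.of_basis b
  have := Module.Finite.of_basis b
  -- By Cayley–Hamilton, the constant coefficient of the characteristic polynomial, which is `± det E`,
  -- maps a cycle `x` into `E` of a cycle, and `E` sends cycles to boundaries.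
  refine ⟨E.charpoly.coeff 0, fun h0 => hdet ?_, fun x hx => ?_⟩
  · rw [Ideal.algebraMap_residueField_eq_zero, LinearMap.det_eq_sign_charpoly_coeff]
    exact p.mul_mem_left _ h0
  · have hcomm : ∀ (q : Polynomial R) y,
        d (Polynomial.aeval E q y) = Polynomial.aeval E q (d y) := by
      intro q y
      induction q using Polynomial.induction_on' with
      | add q q' hq hq' => simp only [map_add, LinearMap.add_apply, hq, hq']
      | monomial n a =>
        have hpow : ∀ (n : ℕ) y, d ((E ^ n) y) = (E ^ n) (d y) := by
          intro n
          induction n with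
          | zero => intro y; rfl
          | succ n ih => intro y; rw [pow_succ', Module.End.mul_apply, hEd, ih]; rfl
        simp [Polynomial.aeval_monomial, hpow]
    have hch := LinearMap.congr_fun E.aeval_self_charpoly x
    rw [← Polynomial.X_mul_divX_add E.charpoly, map_add, map_mul, Polynomial.aeval_X,
      Polynomial.aeval_C, LinearMap.add_apply, Module.End.mul_apply, LinearMap.zero_apply,
      Module.algebraMap_end_apply] at hch
    refine ⟨- H (Polynomial.aeval E E.charpoly.divX x), ?_⟩
    have hw : d (Polynomial.aeval E E.charpoly.divX x) = 0 := by rw [hcomm, hx, map_zero]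
    have hEw : E (Polynomial.aeval E E.charpoly.divX x) =
        d (H (Polynomial.aeval E E.charpoly.divX x)) := by
      show d (H _) + H (d _) = _
      rw [hw, map_zero, add_zero]
    rw [map_neg, ← hEw, neg_eq_iff_add_eq_zero]
    exact hch

/-- The Künneth formula over the residue field, in the weak form that nonzero homology of the fibers
of both factors yields nonzero homology of the fiber of the tensor product. -/
theorem HasFiberHomology.tensor {X Y : Type*} [AddCommGroup X] [Module R X] [AddCommGroup Y]
    [Module R Y] {d : X →ₗ[R] X} (σ : X →ₗ[R] X) {dY : Y →ₗ[R] Y} {κ : Type*} [Field κ]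
    [Algebra R κ]
    (hX : HasFiberHomology d κ) (hY : HasFiberHomology dY κ) :
    HasFiberHomology (tensorD d σ dY) κ := by
  obtain ⟨x, φ, hφ, hx, hx'⟩ := hX
  obtain ⟨y, ψ, hψ, hy, hy'⟩ := hY
  refine ⟨x ⊗ₜ y, LinearMap.mul' R κ ∘ₗ TensorProduct.map φ ψ, fun z => ?_, ?_, fun Ψ => ?_⟩
  · induction z using TensorProduct.induction_on with
    | zero => simp
    | add z z' hz hz' => rw [map_add, map_add, hz, hz', add_zero]
    | tmul x y => simp [tensorD_tmul, hφ, hψ]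
  · simpa using ⟨hx, hy⟩
  · rw [tensorD_tmul, map_add]
    have h1 : Ψ (d x ⊗ₜ y) = 0 := hx' (Ψ ∘ₗ (TensorProduct.mk R X Y).flip y)
    have h2 : Ψ (σ x ⊗ₜ dY y) = 0 := hy' (Ψ ∘ₗ TensorProduct.mk R X Y (σ x))
    rw [h1, h2, add_zero]

/-- The tensor product of triangular bases is triangular for the sum of the levels. -/
theorem tensorProduct_repr_tensorD {X Y I J : Type*} [AddCommGroup X] [Module R X] [AddCommGroup Y]
    [Module R Y] (d σ : X →ₗ[R] X) (dY : Y →ₗ[R] Y) (b : Module.Basis I R X)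
    (b' : Module.Basis J R Y) (level : I → ℕ) (level' : J → ℕ)
    (htri : ∀ j i, level j ≤ level i → b.repr (d (b j)) i = 0)
    (htri' : ∀ j i, level' j ≤ level' i → b'.repr (dY (b' j)) i = 0)
    (hb : ∀ j, ∃ ε : R, ε * ε = 1 ∧ σ (b j) = ε • b j) (a a' : I × J)
    (ha : level a.1 + level' a.2 ≤ level a'.1 + level' a'.2) :
    (b.tensorProduct b').repr (tensorD d σ dY (b.tensorProduct b' a)) a' = 0 := by
  classical
  obtain ⟨i, j⟩ := a
  obtain ⟨i', j'⟩ := a'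
  obtain ⟨ε, -, hε⟩ := hb i
  replace ha : level i + level' j ≤ level i' + level' j' := ha
  rw [Module.Basis.tensorProduct_apply, tensorD_tmul, map_add, Finsupp.add_apply,
    Module.Basis.tensorProduct_repr_tmul_apply, Module.Basis.tensorProduct_repr_tmul_apply, hε]
  have h1 : b.repr (d (b i)) i' = 0 ∨ b'.repr (b' j) j' = 0 := by
    by_cases hj : j = j'
    · subst hj; exact Or.inl (htri i i' (by omega))
    · right; simp [hj]
  have h2 : b.repr (b i) i' = 0 ∨ b'.repr (dY (b' j)) j' = 0 := by
    by_cases hi : i = i'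
    · subst hi; exact Or.inr (htri' j j' (by omega))
    · left; simp [hi]
  rw [map_smul, Finsupp.smul_apply]
  rcases h1 with h1 | h1 <;> rcases h2 with h2 | h2 <;> rw [h1, h2] <;> simp

/-- Over a noetherian ring, if every cycle of a finite differential module is a boundary up to an
element outside `p`, then one such element works for all cycles. -/
theorem exists_uniform_smul_boundary [IsNoetherianRing R] {X : Type*} [AddCommGroup X] [Module R X]
    [Module.Finite R X] (d : X →ₗ[R] X) (p : Ideal R) [p.IsPrime]
    (h : ∀ x, d x = 0 → ∃ t ∉ p, ∃ u, d u = t • x) :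
    ∃ t ∉ p, ∀ x, d x = 0 → ∃ u, d u = t • x := by
  obtain ⟨S, hS⟩ := IsNoetherian.noetherian (LinearMap.ker d)
  have hmem : ∀ x ∈ S, d x = 0 := fun x hx =>
    LinearMap.mem_ker.1 (hS ▸ Submodule.subset_span hx)
  choose! t ht ht' using h
  refine ⟨∏ x ∈ S, t x, ?_, fun x hx => ?_⟩
  · exact (p.primeCompl.prod_mem fun x hx => ht x (hmem x hx) : ∏ x ∈ S, t x ∈ p.primeCompl)
  · replace hx : x ∈ Submodule.span R (S : Set X) := hS ▸ LinearMap.mem_ker.2 hx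
    induction hx using Submodule.span_induction with
    | mem x hx =>
      obtain ⟨u, hu⟩ := ht' x (hmem x hx)
      obtain ⟨q, hq⟩ := Finset.dvd_prod_of_mem t hx
      exact ⟨q • u, by rw [map_smul, hu, hq, ← mul_smul, mul_comm]⟩
    | zero => exact ⟨0, by simp⟩
    | add x y _ _ hx hy =>
      obtain ⟨u, hu⟩ := hx
      obtain ⟨v, hv⟩ := hy
      exact ⟨u + v, by rw [map_add, hu, hv, smul_add]⟩
    | smul a x _ hx =>
      obtain ⟨u, hu⟩ := hx
      exact ⟨a • u, by rw [map_smul, hu, smul_comm]⟩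

end Fibers

/-! ### Supports -/

namespace DGModule

section Support

variable {k : Type u} [Field k] {c : ℕ} {w : OddDegrees c}

/-- The lower grading of `S` is the negative of the upper one. -/
theorem mem_symUpperGr_of_mem_symGr {n : ℕ} {s : MvPolynomial (Fin c) k}
    (hs : s ∈ symGr k w (-(n : ℤ))) : s ∈ symUpperGr k w n := by
  have hs : MvPolynomial.IsWeightedHomogeneous (fun i => -(((w i : ℕ) : ℤ) + 1)) s (-n) := hs
  show MvPolynomial.IsWeightedHomogeneous (fun i => (w i : ℕ) + 1) s n
  intro d hd
  have h := weight_eq_neg w d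
  rw [hs hd] at h
  omega

theorem projSupport_congr {X Y : Type u} [AddCommGroup X] [Module (MvPolynomial (Fin c) k) X]
    [AddCommGroup Y] [Module (MvPolynomial (Fin c) k) Y] (e : X ≃ₗ[MvPolynomial (Fin c) k] Y) :
    projSupport (k := k) w X = projSupport (k := k) w Y := by
  ext 𝔭
  rw [projSupport, projSupport, Set.mem_ofPred_eq, Set.mem_ofPred_eq]
  rw [← not_iff_not, not_nontrivial_iff_subsingleton, not_nontrivial_iff_subsingleton,
    LocalizedModule.subsingleton_iff, LocalizedModule.subsingleton_iff]
  constructor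
  · intro h y
    obtain ⟨r, hr, h⟩ := h (e.symm y)
    exact ⟨r, hr, by rw [← e.symm.map_eq_zero_iff, map_smul, h]⟩
  · intro h x
    obtain ⟨r, hr, h⟩ := h (e x)
    exact ⟨r, hr, by rw [← e.map_eq_zero_iff, map_smul, h]⟩

/-- A homogeneous element of `S` outside `𝔭` that turns a homogeneous cycle into a boundary is found
among the components of an arbitrary such element. -/
theorem exists_homogeneous_smul_boundary (Z : DGModule (symGr k w))
    (I : Ideal (MvPolynomial (Fin c) k)) {n : ℤ} {x : Z.carrier} (hx : x ∈ Z.gr n)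
    {t : MvPolynomial (Fin c) k} (ht : t ∉ I)
    {u : Z.carrier} (hu : Z.diff u = t • x) :
    ∃ s ∈ SetLike.homogeneousSubmonoid (symUpperGr k w), s ∉ I ∧ ∃ u, Z.diff u = s • x := by
  set h := algebra_isInternal (symGr k w)
  obtain ⟨m, hm⟩ : ∃ m, component h m t ∉ I := by
    by_contra! hne
    exact ht (mem_of_component_mem h I hne)
  have hm0 : component h m t ≠ 0 := fun h0 => hm (h0 ▸ zero_mem _)
  have hmem : component h m t ∈ symGr k w m := component_mem h m t
  have hle : m ≤ 0 := by
    by_contra! hlt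
    exact hm0 (eq_zero_of_mem_symGr hlt hmem)
  refine ⟨component h m t, ⟨(-m).toNat, mem_symUpperGr_of_mem_symGr ?_⟩, hm,
    component Z.isInternal (m + n + 1) u, ?_⟩
  · rwa [Int.toNat_of_nonneg (by omega), neg_neg]
  · rw [diff_component, hu, add_sub_cancel_right]
    exact (map_component h Z.isInternal ((LinearMap.toSpanSingleton _ _ x).toAddMonoidHom) n
      (fun i a ha => Z.smul_mem ha hx) m t).symm

/-- A point `𝔭` lies outside the support of the homology if and only if each cycle becomes a
boundary after multiplication by some element outside `𝔭`, homogeneous or not. -/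
theorem notMem_projSupport_iff (Z : DGModule (symGr k w))
    (𝔭 : ProjectiveSpectrum (symUpperGr k w)) :
    𝔭 ∉ projSupport w Z.Homology ↔ ∀ x, Z.diff x = 0 →
      ∃ t ∉ 𝔭.asHomogeneousIdeal.toIdeal, ∃ u, Z.diff u = t • x := by
  rw [projSupport, Set.mem_ofPred_eq]
  rw [not_nontrivial_iff_subsingleton, LocalizedModule.subsingleton_iff]
  constructor
  · intro h x hx
    obtain ⟨r, hr, h⟩ := h (Z.homologyClass x hx)
    rw [smul_homologyClass, homologyClass_eq_zero] at h
    exact ⟨r, hr.2, h⟩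
  · intro h z
    obtain ⟨x, hx, rfl⟩ := exists_homologyClass z
    set P := SetLike.homogeneousSubmonoid (symUpperGr k w) ⊓
      𝔭.asHomogeneousIdeal.toIdeal.primeCompl
    have hc : ∀ n, Z.diff (component Z.isInternal n x) = 0 := fun n => by
      rw [diff_component, hx, map_zero]
    have key : ∀ n, ∃ s ∈ P, ∃ u, Z.diff u = s • component Z.isInternal n x := by
      intro n
      obtain ⟨t, ht, u, hu⟩ := h _ (hc n)
      obtain ⟨s, hs, hsp, u, hu⟩ := exists_homogeneous_smul_boundary Z _
        (component_mem Z.isInternal n x) ht hu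
      exact ⟨s, ⟨hs, hsp⟩, u, hu⟩
    choose s hs u hu using key
    set N := (components Z.isInternal x).support
    refine ⟨∏ n ∈ N, s n, P.prod_mem fun n _ => hs n, ?_⟩
    rw [smul_homologyClass, homologyClass_eq_zero]
    have hsum : ∑ n ∈ N, component Z.isInternal n x = x := components_sum Z.isInternal x
    refine ⟨∑ n ∈ N, (∏ m ∈ N.erase n, s m) • u n, ?_⟩
    rw [map_sum]
    conv_rhs => rw [← hsum, Finset.smul_sum]
    refine Finset.sum_congr rfl fun n hn => ?_
    rw [diff_smul, hu, ← mul_smul, Finset.prod_erase_mul _ _ hn]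

/-- For a finite semifree dg module, membership in the support is detected by the residue field. -/
theorem TriangularBasis.mem_projSupport_iff {Z : DGModule (symGr k w)} {J : Type u} [Finite J]
    (T : Z.TriangularBasis J) (𝔭 : ProjectiveSpectrum (symUpperGr k w)) :
    𝔭 ∈ projSupport w Z.Homology ↔
      HasFiberHomology Z.symDiff 𝔭.asHomogeneousIdeal.toIdeal.ResidueField := by
  have := Module.Finite.of_basis T.basis
  rw [← not_iff_not, notMem_projSupport_iff]
  constructor
  · intro h
    obtain ⟨t, ht, h⟩ := exists_uniform_smul_boundary Z.symDiff _ h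
    refine not_hasFiberHomology Z.symDiff T.basis T.level t Z.diff_diff T.repr_diff h ?_
    rwa [Ne, Ideal.algebraMap_residueField_eq_zero]
  · intro h x hx
    obtain ⟨t, ht, h⟩ := exists_smul_boundary_of_not_hasFiberHomology Z.symDiff T.basis Z.diff_diff
      _ h
    exact ⟨t, ht, h x hx⟩

/-- The tensor product of triangular bases. -/
def TriangularBasis.symTensor {X Y : DGModule (symGr k w)} {I J : Type u}
    (T : X.TriangularBasis I) (T' : Y.TriangularBasis J) :
    (X.symTensor Y).TriangularBasis (I × J) where
  basis := T.basis.tensorProduct T'.basis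
  deg a := T.deg a.1 + T'.deg a.2
  level a := T.level a.1 + T'.level a.2
  basis_mem a := by
    have := tmul_mem_symTensorGr X Y (T.basis_mem a.1) (T'.basis_mem a.2) rfl
    rw [← Module.Basis.tensorProduct_apply] at this
    exact this
  repr_diff a a' ha :=
    tensorProduct_repr_tensorD X.symDiff X.symSgn Y.symDiff T.basis T'.basis T.level T'.level
      T.repr_diff T'.repr_diff (sgn_basis T) a a' ha

/-- The support of a tensor product of finite semifree dg modules is the intersection of the
supports. -/
theorem projSupport_symTensor {X Y : DGModule (symGr k w)} {I J : Type u} [Finite I] [Finite J]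
    (T : X.TriangularBasis I) (T' : Y.TriangularBasis J) :
    projSupport (k := k) w (X.symTensor Y).Homology =
      projSupport (k := k) w X.Homology ∩ projSupport (k := k) w Y.Homology := by
  have hsgn : ∀ x, X.symSgn (X.symDiff x) = - X.symDiff (X.symSgn x) := X.sgn_diff
  have := Module.Finite.of_basis T.basis
  have := Module.Finite.of_basis T'.basis
  refine Set.Subset.antisymm (fun 𝔭 h => ⟨?_, ?_⟩) fun 𝔭 h => ?_
  · by_contra hne
    obtain ⟨t, ht, hV⟩ := exists_uniform_smul_boundary X.symDiff _
      ((notMem_projSupport_iff X 𝔭).1 hne)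
    refine (notMem_projSupport_iff _ 𝔭).2 (fun z hz => ?_) h
    obtain ⟨n, u, hu⟩ := exists_boundary_tensor_right X.symDiff X.symSgn Y.symDiff T'.basis T'.level
      t X.diff_diff hsgn Y.diff_diff T'.repr_diff hV z hz
    exact ⟨t ^ n, 𝔭.asHomogeneousIdeal.toIdeal.primeCompl.pow_mem ht n, u, hu⟩
  · by_contra hne
    obtain ⟨t, ht, hV⟩ := exists_uniform_smul_boundary Y.symDiff _
      ((notMem_projSupport_iff Y 𝔭).1 hne)
    refine (notMem_projSupport_iff _ 𝔭).2 (fun z hz => ?_) h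
    obtain ⟨n, u, hu⟩ := exists_boundary_tensor_left Y.symDiff X.symDiff X.symSgn T.basis T.level
      t Y.diff_diff hsgn X.diff_diff T.repr_diff (sgn_basis T) hV z hz
    exact ⟨t ^ n, 𝔭.asHomogeneousIdeal.toIdeal.primeCompl.pow_mem ht n, u, hu⟩
  · rw [(T.symTensor T').mem_projSupport_iff]
    exact HasFiberHomology.tensor X.symSgn ((T.mem_projSupport_iff 𝔭).1 h.1)
      ((T'.mem_projSupport_iff 𝔭).1 h.2)

end Support

end DGModule

theorem propositionp {k : Type u} [Field k] {c : ℕ} (w : OddDegrees c)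
    (M N : DGModule (extGr k w)) (hM : M.IsDfPlus) (hN : N.IsDfPlus) :
    (Nonempty M.bgg.SemifreeResolution ∧
      ∀ P : M.bgg.SemifreeResolution,
        Nonempty ((M.hopfTensor N).bgg.toDerived ≅ (P.obj.symTensor N.bgg).toDerived)) ∧
    (M.IsDfb → N.IsDfb →
      (M.hopfTensor N).supportVariety = M.supportVariety ∩ N.supportVariety) := by
  refine ⟨⟨hM.nonempty_resolution, fun P => hM.nonempty_derivedIso hN P⟩, fun hM hN => ?_⟩
  obtain ⟨X, Y, I, J, T, T', _, _, ⟨e⟩, ⟨e'⟩, ⟨e''⟩⟩ := hM.exists_finite_models hN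
  simp only [DGModule.supportVariety]
  rw [DGModule.projSupport_congr e, DGModule.projSupport_congr e', DGModule.projSupport_congr e'',
    DGModule.projSupport_symTensor T T']

end
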